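/- Let $\mathcal X,\mathcal Z,\mathcal U$ be real or complex Hilbert spaces, $E\in\mathcal L(\mathcal X,\mathcal Z)$, $B\in\mathcal L(\mathcal U,\mathcal Z)$, $A:D(A)\subset\mathcal X\to\mathcal Z$ closed and densely defined, and consider $\frac{d}{dt}Ex=Ax+Bu$, $Ex(0)=Ex_i$, on $[0,t_f]$, $t_f>0$. Let $P^{\mathcal X_1},P^{\mathcal Z_1}$ be bounded (not necessarily orthogonal) projections with ranges $\mathcal X_1,\mathcal Z_1$, put $P^{\mathcal X_0}=I-P^{\mathcal X_1}$, $P^{\mathcal Z_0}=I-P^{\mathcal Z_1}$ with ranges $\mathcal X_0,\mathcal Z_0$, and assume $P^{\mathcal Z_1}E=EP^{\mathcal X_1}$, $P^{\mathcal X_1}D(A)\subset D(A)$ and $P^{\mathcal Z_1}A=AP^{\mathcal X_1}$ on $D(A)$. Let $E_1=E|_{\mathcal X_1}$, $A_k=A|_{\mathcal X_k\cap D(A)}$, $B_k=P^{\mathcal Z_k}B$ $(k=0,1)$. Assume that $E|_{\mathcal X_0}=0$; that $A_0$ has a bounded inverse $A_0^{-1}\in\mathcal L(\mathcal Z_0,\mathcal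 X_0)$ and $E_1$ a bounded inverse $E_1^{-1}\in\mathcal L(\mathcal Z_1,\mathcal X_1)$; that $A_1$ is closed and densely defined, and $E_1^{-1}A_1$ generates a $C_0$-semigroup $T(t)$ on $\mathcal X_1$. Put $\tilde B_1=E_1^{-1}B_1$, $\tilde B_0=A_0^{-1}B_0$. Let $G,Q\in\mathcal L(\mathcal X)$ be self-adjoint and non-negative and $R\in\mathcal L(\mathcal U)$ self-adjoint and coercive, with $P^{\mathcal X_1*}GP^{\mathcal X_0}=P^{\mathcal X_0*}GP^{\mathcal X_1}=P^{\mathcal X_0*}GP^{\mathcal X_0}=0$ and $P^{\mathcal X_0*}QP^{\mathcal X_1}=P^{\mathcal X_1*}QP^{\mathcal X_0}=0$; let $G_1,Q_1\in\mathcal L(\mathcal X_1)$, $Q_0\in\mathcal L(\mathcal X_0)$ be given by $\langle a,G_1b\rangle=\langle a,Gb\rangle$, $\langle a,Q_kb\rangle=\langle a,Qb\rangle$ on $\mathcal X_1$, resp. $\mathcal X_k$. For $t_0\in[0,t_f]$ and $x_i\in\mathcal X$ the admissible controls are the $u\in C([t_0,t_f];\mathcal U)$ with $P^{\mathcal X_0}x_i=-\tilde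 B_0u(t_0)$; the state is $x=x_1+x_0$ with $x_1(t)=T(t-t_0)P^{\mathcal X_1}x_i+\int_{t_0}^tT(t-s)\tilde B_1u(s)\,ds$, $x_0(t)=-\tilde B_0u(t)$; the cost is $J(x_i,u;t_0,t_f)=\langle x(t_f),Gx(t_f)\rangle+\int_{t_0}^{t_f}\langle x,Qx\rangle+\langle u,Ru\rangle\,ds$, and $J(x_i,u)=J(x_i,u;0,t_f)$. An admissible control is optimal if it minimizes the cost among the admissible controls. For $t\in[0,t_f]$ and $a\in\mathcal X_1$ let $$\Pi_1(t)a=T^*(t_f-t)G_1x_1^{opt}(t_f)+\int_t^{t_f}T^*(r-t)Q_1x_1^{opt}(r)\,dr,$$ where $x_1^{opt}$ is the $\mathcal X_1$-part of the state for an optimal control on $[t,t_f]$ from some initial state $x$ with $P^{\mathcal X_1}x=a$. Put $\Pi_0=-A_0^{-*}Q_0$, $\tilde\Pi_0=P^{\mathcal Z_0*}\Pi_0P^{\mathcal X_0}$, $Z_1(t)=E_1^{-*}\Pi_1(t)E_1^{-1}$, $\tilde\Pi_1(t)=P^{\mathcal Z_1*}Z_1(t)P^{\mathcal Z_1}$.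 Here $\Pi_1(t)$ is well defined and in $\mathcal L(\mathcal X_1)$ (such $x$ and an optimal control exist for every $a$, and the value does not depend on their choice), $\tilde\Pi_1$ is strongly continuous on $[0,t_f]$, and $\langle Ey,\tilde\Pi_1(t)Ex\rangle$ is differentiable on $(0,t_f)$ for $x,y\in D(A)$. Consider strongly continuous $Z:[0,t_f]\to\mathcal L(\mathcal Z)$, with $\langle Ey,Z(t)Ex\rangle$ differentiable on $(0,t_f)$ for all $x,y\in D(A)$, that satisfy there $$\tfrac{d}{dt}\langle Ey,ZEx\rangle+\langle Ey,ZAx\rangle+\langle Ay,ZEx\rangle-\langle Ey,ZBR^{-1}B^*ZEx\rangle-\langle Ey,ZBR^{-1}B^*\tilde\Pi_0x\rangle+\langle y,QP^{\mathcal X_1}x\rangle=0$$ and $E^*Z(t_f)E=G$. 1. Solutions exist, and the general solution is $$Z(t)=\tilde\Pi_1(t)+P^{\mathcal Z_1*}Z_2(t)P^{\mathcal Z_0}+P^{\mathcal Z_0*}Z_4(t)P^{\mathcal Z_0},$$ where $Z_4:[0,t_f]\to\mathcal L(\mathcal Z_0)$ is an arbitrary strongly continuous function and $Z_2:[0,t_f]\to\mathcal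 L(\mathcal Z_0,\mathcal Z_1)$ is strongly continuous and satisfies $Z_2(t)(A_0-B_0R^{-1}B_0^*\Pi_0)=Z_1(t)B_1R^{-1}B_0^*\Pi_0$ on $D(A_0)$ for all $t\in[0,t_f]$. 2. $Z(t)E$ is the same for all solutions $Z$. Let $Z$ be a solution and $x_i\in\mathcal X$. There is an initial state $x$ with $Ex=Ex_i$ that has an optimal control. An admissible control $u$ for $x_i$, with state $x(t)$, is optimal if and only if $u(t)=-R^{-1}B^*(\tilde\Pi_0+Z(t)E)x(t)$ on $[0,t_f]$; there is at most one optimal control $u^{opt}$; if there is one, then $J(x_i,u^{opt})=\langle Ex_i,Z(0)Ex_i\rangle$. Whenever an admissible control exists, $\inf J(x_i,\cdot)$ over the admissible controls equals $\langle Ex_i,Z(0)Ex_i\rangle$. -/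

import Mathlib

open Set Filter Topology MeasureTheory
open scoped InnerProduct

/-- The Bochner integral `∫ s in a..b, f s` of a function with values in a Hilbert space over
`𝕜 = ℝ` or `ℂ`, the space being seen as a real normed space. -/
noncomputable def hilbertIntegral (𝕜 : Type*) {H : Type*} [RCLike 𝕜] [NormedAddCommGroup H]
    [InnerProductSpace 𝕜 H] (f : ℝ → H) (a b : ℝ) : H :=
  letI : NormedSpace ℝ H := NormedSpace.restrictScalars ℝ 𝕜 H
  ∫ s in a..b, f s

/-- `T` (restricted to `t ≥ 0`) is a `C₀`-semigroup of bounded operators on `H`. -/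
structure IsC0Semigroup {𝕜 H : Type*} [RCLike 𝕜] [NormedAddCommGroup H]
    [InnerProductSpace 𝕜 H] (T : ℝ → H →L[𝕜] H) : Prop where
  zero : T 0 = ContinuousLinearMap.id 𝕜 H
  add : ∀ s t : ℝ, 0 ≤ s → 0 ≤ t → T (s + t) = T s ∘L T t
  strongly_continuous : ∀ x : H, ContinuousOn (fun t => T t x) (Ici 0)

/-- The (unbounded) operator `L` is the infinitesimal generator of `T`: its graph consists of all
`(x, y)` such that `(T h x - x) / h → y` as `h → 0+`. -/
def IsGenerator {𝕜 H : Type*} [RCLike 𝕜] [NormedAddCommGroup H]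
    [InnerProductSpace 𝕜 H] (L : H →ₗ.[𝕜] H) (T : ℝ → H →L[𝕜] H) : Prop :=
  ∀ x y : H, Tendsto (fun h : ℝ => ((h : 𝕜)⁻¹) • (T h x - x)) (𝓝[>] 0) (𝓝 y) ↔
    ∃ hx : x ∈ L.domain, L ⟨x, hx⟩ = y

/-- A control system `d/dt E x = A x + B u` with `E`, `B` bounded and `A` closed and densely
defined, together with bounded (not necessarily orthogonal) projections on the state space and on
the range space that commute with `E` and `A`. -/
structure ProjectedPDAE (𝕜 X Z U : Type*) [RCLike 𝕜]
    [NormedAddCommGroup X] [InnerProductSpace 𝕜 X]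
    [NormedAddCommGroup Z] [InnerProductSpace 𝕜 Z]
    [NormedAddCommGroup U] [InnerProductSpace 𝕜 U] where
  E : X →L[𝕜] Z
  A : X →ₗ.[𝕜] Z
  B : U →L[𝕜] Z
  A_closed : A.IsClosed
  A_dense : Dense (A.domain : Set X)
  /-- The projection `P^{X₁}`, as an operator on `X`. -/
  PX : X →L[𝕜] X
  /-- The projection `P^{Z₁}`, as an operator on `Z`. -/
  PZ : Z →L[𝕜] Z
  PX_proj : ∀ x, PX (PX x) = PX x
  PZ_proj : ∀ z, PZ (PZ z) = PZ z
  PZ_E : ∀ x, PZ (E x) = E (PX x)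
  PX_mem : ∀ x, x ∈ A.domain → PX x ∈ A.domain
  PZ_A : ∀ (x : X) (hx : x ∈ A.domain), PZ (A ⟨x, hx⟩) = A ⟨PX x, PX_mem x hx⟩

namespace ProjectedPDAE

variable {𝕜 X Z U : Type*} [RCLike 𝕜]
  [NormedAddCommGroup X] [InnerProductSpace 𝕜 X]
  [NormedAddCommGroup Z] [InnerProductSpace 𝕜 Z]
  [NormedAddCommGroup U] [InnerProductSpace 𝕜 U]
  (S : ProjectedPDAE 𝕜 X Z U)

/-- `X₁`, the range of `P^{X₁}`. -/
def X₁ : Submodule 𝕜 X := LinearMap.range (S.PX : X →ₗ[𝕜] X)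

/-- `X₀`, the range of `P^{X₀} = I - P^{X₁}`, i.e. the kernel of `P^{X₁}`. -/
def X₀ : Submodule 𝕜 X := LinearMap.ker (S.PX : X →ₗ[𝕜] X)

/-- `Z₁`, the range of `P^{Z₁}`. -/
def Z₁ : Submodule 𝕜 Z := LinearMap.range (S.PZ : Z →ₗ[𝕜] Z)

/-- `Z₀`, the range of `P^{Z₀} = I - P^{Z₁}`, i.e. the kernel of `P^{Z₁}`. -/
def Z₀ : Submodule 𝕜 Z := LinearMap.ker (S.PZ : Z →ₗ[𝕜] Z)

theorem mem_X₁ {x : X} : x ∈ S.X₁ ↔ S.PX x = x :=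
  ⟨by rintro ⟨y, rfl⟩; exact S.PX_proj y, fun h => ⟨x, h⟩⟩

theorem mem_X₀ {x : X} : x ∈ S.X₀ ↔ S.PX x = 0 := LinearMap.mem_ker

theorem mem_Z₁ {z : Z} : z ∈ S.Z₁ ↔ S.PZ z = z :=
  ⟨by rintro ⟨y, rfl⟩; exact S.PZ_proj y, fun h => ⟨z, h⟩⟩

theorem mem_Z₀ {z : Z} : z ∈ S.Z₀ ↔ S.PZ z = 0 := LinearMap.mem_ker

instance [CompleteSpace X] : CompleteSpace S.X₁ := by
  have h : IsClosed (S.X₁ : Set X) := by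
    have : (S.X₁ : Set X) = {x | S.PX x = x} := by ext x; exact S.mem_X₁
    rw [this]
    exact isClosed_eq S.PX.continuous continuous_id
  exact h.completeSpace_coe

instance [CompleteSpace X] : CompleteSpace S.X₀ := by
  have h : IsClosed (S.X₀ : Set X) := by
    have : (S.X₀ : Set X) = {x | S.PX x = 0} := by ext x; exact S.mem_X₀
    rw [this]
    exact isClosed_eq S.PX.continuous continuous_const
  exact h.completeSpace_coe

instance [CompleteSpace Z] : CompleteSpace S.Z₁ := by
  have h : IsClosed (S.Z₁ : Set Z) := by
    have : (S.Z₁ : Set Z) = {x | S.PZ x = x} := by ext x; exact S.mem_Z₁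
    rw [this]
    exact isClosed_eq S.PZ.continuous continuous_id
  exact h.completeSpace_coe

instance [CompleteSpace Z] : CompleteSpace S.Z₀ := by
  have h : IsClosed (S.Z₀ : Set Z) := by
    have : (S.Z₀ : Set Z) = {x | S.PZ x = 0} := by ext x; exact S.mem_Z₀
    rw [this]
    exact isClosed_eq S.PZ.continuous continuous_const
  exact h.completeSpace_coe

/-- `P^{X₁} : X → X₁`. -/
def projX₁ : X →L[𝕜] S.X₁ := S.PX.codRestrict S.X₁ fun x => ⟨x, rfl⟩

/-- `P^{X₀} = I - P^{X₁} : X → X₀`. -/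
def projX₀ : X →L[𝕜] S.X₀ :=
  (ContinuousLinearMap.id 𝕜 X - S.PX).codRestrict S.X₀ fun x => by
    simp [mem_X₀, S.PX_proj]

/-- `P^{Z₁} : Z → Z₁`. -/
def projZ₁ : Z →L[𝕜] S.Z₁ := S.PZ.codRestrict S.Z₁ fun x => ⟨x, rfl⟩

/-- `P^{Z₀} = I - P^{Z₁} : Z → Z₀`. -/
def projZ₀ : Z →L[𝕜] S.Z₀ :=
  (ContinuousLinearMap.id 𝕜 Z - S.PZ).codRestrict S.Z₀ fun x => by
    simp [mem_Z₀, S.PZ_proj]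

theorem E_mem_Z₁ (x : S.X₁) : S.E x ∈ S.Z₁ := by
  rw [mem_Z₁, S.PZ_E, S.mem_X₁.1 x.2]

theorem A_mem_Z₁ (x : X) (hx : x ∈ S.A.domain) (h1 : x ∈ S.X₁) : S.A ⟨x, hx⟩ ∈ S.Z₁ := by
  rw [mem_Z₁, S.PZ_A]
  congr 1
  exact Subtype.ext (S.mem_X₁.1 h1)

theorem A_mem_Z₀ (x : X) (hx : x ∈ S.A.domain) (h0 : x ∈ S.X₀) : S.A ⟨x, hx⟩ ∈ S.Z₀ := by
  rw [mem_Z₀, S.PZ_A]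
  have : (⟨S.PX x, S.PX_mem x hx⟩ : S.A.domain) = 0 := Subtype.ext (S.mem_X₀.1 h0)
  rw [this, LinearPMap.map_zero]

/-- `E₁ = E|_{X₁} : X₁ → Z₁`. -/
def E₁ : S.X₁ →L[𝕜] S.Z₁ := (S.E ∘L S.X₁.subtypeL).codRestrict S.Z₁ S.E_mem_Z₁

/-- `A₁ = A|_{X₁ ∩ D(A)} : D(A) ∩ X₁ → Z₁`. -/
def A₁ : S.X₁ →ₗ.[𝕜] S.Z₁ where
  domain := S.A.domain.comap S.X₁.subtype
  toFun :=
    { toFun := fun x => ⟨S.A ⟨(x : S.X₁), x.2⟩, S.A_mem_Z₁ _ x.2 x.1.2⟩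
      map_add' := fun x y => Subtype.ext (S.A.map_add ⟨(x : S.X₁), x.2⟩ ⟨(y : S.X₁), y.2⟩)
      map_smul' := fun c x => Subtype.ext (S.A.map_smul c ⟨(x : S.X₁), x.2⟩) }

/-- `A₀ = A|_{X₀ ∩ D(A)} : D(A) ∩ X₀ → Z₀`. -/
def A₀ : S.X₀ →ₗ.[𝕜] S.Z₀ where
  domain := S.A.domain.comap S.X₀.subtype
  toFun :=
    { toFun := fun x => ⟨S.A ⟨(x : S.X₀), x.2⟩, S.A_mem_Z₀ _ x.2 x.1.2⟩
      map_add' := fun x y => Subtype.ext (S.A.map_add ⟨(x : S.X₀), x.2⟩ ⟨(y : S.X₀), y.2⟩)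
      map_smul' := fun c x => Subtype.ext (S.A.map_smul c ⟨(x : S.X₀), x.2⟩) }

/-- `B₁ = P^{Z₁} B`. -/
def B₁ : U →L[𝕜] S.Z₁ := S.projZ₁ ∘L S.B

/-- `B₀ = P^{Z₀} B`. -/
def B₀ : U →L[𝕜] S.Z₀ := S.projZ₀ ∘L S.B

end ProjectedPDAE

/-- The systems that are radial with degree `0`, in Weierstrass form: `E` vanishes on `X₀`,
`A₀` has a bounded inverse `Z₀ → X₀`, `E₁` has a bounded inverse `Z₁ → X₁`, and `E₁⁻¹ A₁`
generates the `C₀`-semigroup `T` on `X₁`. (The two inverses and `T` are determined by `E`, `A` and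
the projections.) -/
structure RadialPDAE (𝕜 X Z U : Type*) [RCLike 𝕜]
    [NormedAddCommGroup X] [InnerProductSpace 𝕜 X]
    [NormedAddCommGroup Z] [InnerProductSpace 𝕜 Z]
    [NormedAddCommGroup U] [InnerProductSpace 𝕜 U] extends ProjectedPDAE 𝕜 X Z U where
  E_X₀ : ∀ x ∈ toProjectedPDAE.X₀, E x = 0
  A₀inv : toProjectedPDAE.Z₀ →L[𝕜] toProjectedPDAE.X₀
  A₀inv_mem : ∀ z, A₀inv z ∈ toProjectedPDAE.A₀.domain
  A₀_A₀inv : ∀ z, toProjectedPDAE.A₀ ⟨A₀inv z, A₀inv_mem z⟩ = z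
  A₀inv_A₀ : ∀ x : toProjectedPDAE.A₀.domain, A₀inv (toProjectedPDAE.A₀ x) = x
  E₁inv : toProjectedPDAE.Z₁ →L[𝕜] toProjectedPDAE.X₁
  E₁_E₁inv : ∀ z, toProjectedPDAE.E₁ (E₁inv z) = z
  E₁inv_E₁ : ∀ x, E₁inv (toProjectedPDAE.E₁ x) = x
  A₁_closed : toProjectedPDAE.A₁.IsClosed
  A₁_dense : Dense (toProjectedPDAE.A₁.domain : Set toProjectedPDAE.X₁)
  /-- The semigroup generated by `E₁⁻¹ A₁`. -/
  T : ℝ → toProjectedPDAE.X₁ →L[𝕜] toProjectedPDAE.X₁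
  T_semigroup : IsC0Semigroup T
  T_generator :
    IsGenerator ((E₁inv : toProjectedPDAE.Z₁ →ₗ[𝕜] toProjectedPDAE.X₁).compPMap
      toProjectedPDAE.A₁) T

/-- A finite-time linear-quadratic control problem for such a system: horizon `tf > 0`, bounded
self-adjoint non-negative weights `G`, `Q` on the state, a self-adjoint coercive weight `R` on the
control; `G` vanishes on `X₀` and `Q` has no cross terms between `X₁` and `X₀`. -/
structure LQProblem (𝕜 X Z U : Type*) [RCLike 𝕜]
    [NormedAddCommGroup X] [InnerProductSpace 𝕜 X] [CompleteSpace X]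
    [NormedAddCommGroup Z] [InnerProductSpace 𝕜 Z] [CompleteSpace Z]
    [NormedAddCommGroup U] [InnerProductSpace 𝕜 U] [CompleteSpace U]
    extends RadialPDAE 𝕜 X Z U where
  tf : ℝ
  tf_pos : 0 < tf
  G : X →L[𝕜] X
  Q : X →L[𝕜] X
  R : U →L[𝕜] U
  G_nonneg : G.IsPositive
  Q_nonneg : Q.IsPositive
  R_selfAdjoint : IsSelfAdjoint R
  R_coercive : ∃ ε : ℝ, 0 < ε ∧ ∀ u : U, ε * ‖u‖ ^ 2 ≤ RCLike.re (inner 𝕜 u (R u))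
  G₁₀ : PX† ∘L G ∘L (ContinuousLinearMap.id 𝕜 X - PX) = 0
  G₀₁ : (ContinuousLinearMap.id 𝕜 X - PX)† ∘L G ∘L PX = 0
  G₀₀ : (ContinuousLinearMap.id 𝕜 X - PX)† ∘L G ∘L (ContinuousLinearMap.id 𝕜 X - PX) = 0
  Q₀₁ : (ContinuousLinearMap.id 𝕜 X - PX)† ∘L Q ∘L PX = 0
  Q₁₀ : PX† ∘L Q ∘L (ContinuousLinearMap.id 𝕜 X - PX) = 0

namespace LQProblem

variable {𝕜 X Z U : Type*} [RCLike 𝕜]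
  [NormedAddCommGroup X] [InnerProductSpace 𝕜 X] [CompleteSpace X]
  [NormedAddCommGroup Z] [InnerProductSpace 𝕜 Z] [CompleteSpace Z]
  [NormedAddCommGroup U] [InnerProductSpace 𝕜 U] [CompleteSpace U]
  (S : LQProblem 𝕜 X Z U)

/-- `B̃₁ = E₁⁻¹ B₁`. -/
def Bt₁ : U →L[𝕜] S.X₁ := S.E₁inv ∘L S.B₁

/-- `B̃₀ = A₀⁻¹ B₀`. -/
def Bt₀ : U →L[𝕜] S.X₀ := S.A₀inv ∘L S.B₀

/-- `R⁻¹`; a bounded operator, because `R` is coercive. -/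
noncomputable def Rinv : U →L[𝕜] U := S.R.inverse

/-- `G₁`, the restriction of the form of `G` to `X₁`: `⟨a, G₁ b⟩ = ⟨a, G b⟩` for `a, b ∈ X₁`. -/
noncomputable def G₁ : S.X₁ →L[𝕜] S.X₁ := (S.X₁.subtypeL)† ∘L S.G ∘L S.X₁.subtypeL

/-- `Q₁`, the restriction of the form of `Q` to `X₁`. -/
noncomputable def Q₁ : S.X₁ →L[𝕜] S.X₁ := (S.X₁.subtypeL)† ∘L S.Q ∘L S.X₁.subtypeL

/-- `Q₀`, the restriction of the form of `Q` to `X₀`. -/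
noncomputable def Q₀ : S.X₀ →L[𝕜] S.X₀ := (S.X₀.subtypeL)† ∘L S.Q ∘L S.X₀.subtypeL

/-- The dynamical sub-state at time `t`, for the control `u` and the initial state `x` at time
`t₀`: the mild solution of `x₁' = E₁⁻¹ A₁ x₁ + B̃₁ u`, `x₁(t₀) = P^{X₁} x`. -/
noncomputable def state₁ (t₀ : ℝ) (x : X) (u : ℝ → U) (t : ℝ) : S.X₁ :=
  S.T (t - t₀) (S.projX₁ x) + hilbertIntegral 𝕜 (fun s => S.T (t - s) (S.Bt₁ (u s))) t₀ t

/-- The state `x(t) = x₁(t) + x₀(t)`, where `x₀(t) = - B̃₀ u(t)`. -/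
noncomputable def state (t₀ : ℝ) (x : X) (u : ℝ → U) (t : ℝ) : X :=
  (S.state₁ t₀ x u t : X) - (S.Bt₀ (u t) : X)

/-- The cost `⟨x(tf), G x(tf)⟩ + ∫_{t₀}^{tf} ⟨x, Q x⟩ + ⟨u, R u⟩ ds`. -/
noncomputable def cost (t₀ : ℝ) (x : X) (u : ℝ → U) : ℝ :=
  RCLike.re (inner 𝕜 (S.state t₀ x u S.tf) (S.G (S.state t₀ x u S.tf))) +
    ∫ s in t₀..S.tf, (RCLike.re (inner 𝕜 (S.state t₀ x u s) (S.Q (S.state t₀ x u s))) +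
      RCLike.re (inner 𝕜 (u s) (S.R (u s))))

/-- The admissible controls on `[t₀, tf]` for the initial state `x` at time `t₀`: continuous, and
consistent with the initial state, `P^{X₀} x = - B̃₀ u(t₀)`. -/
def admissible (t₀ : ℝ) (x : X) : Set (ℝ → U) :=
  {u | ContinuousOn u (Icc t₀ S.tf) ∧ S.projX₀ x = - S.Bt₀ (u t₀)}

/-- `u` is an optimal control on `[t₀, tf]` for the initial state `x` at time `t₀`. -/
def IsOptimal (t₀ : ℝ) (x : X) (u : ℝ → U) : Prop :=
  u ∈ S.admissible t₀ x ∧ ∀ v ∈ S.admissible t₀ x, S.cost t₀ x u ≤ S.cost t₀ x v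

/-- `b = T*(tf - t) G₁ x₁ᵒᵖᵗ(tf; a, t, tf) + ∫_t^{tf} T*(r - t) Q₁ x₁ᵒᵖᵗ(r; a, t, tf) dr`, where
`x₁ᵒᵖᵗ(·; a, t, tf)` is the optimal dynamical sub-state that starts in `a ∈ X₁` at time `t`
(the algebraic sub-state at time `t` being the one with which the optimal control is consistent). -/
def IsPi₁Value (t : ℝ) (a b : S.X₁) : Prop :=
  ∃ (x : X) (u : ℝ → U), S.projX₁ x = a ∧ S.IsOptimal t x u ∧
    b = ((S.T (S.tf - t))†) (S.G₁ (S.state₁ t x u S.tf)) +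
      hilbertIntegral 𝕜 (fun r => ((S.T (r - t))†) (S.Q₁ (S.state₁ t x u r))) t S.tf

open Classical in
/-- The operator `Π₁(t) ∈ L(X₁)`, the bounded operator with `a ↦ b` as in `IsPi₁Value`. -/
noncomputable def Pi₁ (t : ℝ) : S.X₁ →L[𝕜] S.X₁ :=
  if h : ∃ L : S.X₁ →L[𝕜] S.X₁, ∀ a, S.IsPi₁Value t a (L a) then h.choose else 0

/-- `Π₀ = - A₀⁻* Q₀ ∈ L(X₀, Z₀)`. -/
noncomputable def Pi₀ : S.X₀ →L[𝕜] S.Z₀ := -((S.A₀inv)† ∘L S.Q₀)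

/-- `Π̃₀ = P^{Z₀}* Π₀ P^{X₀}`. -/
noncomputable def PiTilde₀ : X →L[𝕜] Z := (S.projZ₀)† ∘L S.Pi₀ ∘L S.projX₀

/-- `E₁⁻* Π₁(t) E₁⁻¹ ∈ L(Z₁)`. -/
noncomputable def block₁ (t : ℝ) : S.Z₁ →L[𝕜] S.Z₁ := (S.E₁inv)† ∘L S.Pi₁ t ∘L S.E₁inv

/-- `Π̃₁(t) = P^{Z₁}* E₁⁻* Π₁(t) E₁⁻¹ P^{Z₁}`. -/
noncomputable def PiTilde₁ (t : ℝ) : Z →L[𝕜] Z := (S.projZ₁)† ∘L S.block₁ t ∘L S.projZ₁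

/-- Strong continuity on `[0, tf]` of an operator-valued function. -/
def StronglyContinuous {H K : Type*} [NormedAddCommGroup H] [InnerProductSpace 𝕜 H]
    [NormedAddCommGroup K] [InnerProductSpace 𝕜 K] (W : ℝ → H →L[𝕜] K) : Prop :=
  ∀ z : H, ContinuousOn (fun t => W t z) (Icc 0 S.tf)

/-- `W : [0, tf] → L(Z)` is a (strongly continuous) solution of
`d/dt E* W E x + E* W A x + A* W E x - E* W B R⁻¹ B* W E x - E* W B R⁻¹ B* Π̃₀ x + Q P^{X₁} x = 0`,
for `x ∈ D(A)` and `t ∈ (0, tf)`, in the usual inner product sense (tested with all `y ∈ D(A)`),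
with the final condition `E* W(tf) E = G`. -/
structure IsRiccatiSolution (W : ℝ → Z →L[𝕜] Z) : Prop where
  continuous : S.StronglyContinuous W
  differentiable : ∀ y x : S.A.domain, ∀ t ∈ Ioo 0 S.tf,
    DifferentiableAt ℝ (fun t => inner 𝕜 (S.E y) (W t (S.E x))) t
  equation : ∀ y x : S.A.domain, ∀ t ∈ Ioo 0 S.tf,
    deriv (fun t => inner 𝕜 (S.E y) (W t (S.E x))) t
      + inner 𝕜 (S.E y) (W t (S.A x))
      + inner 𝕜 (S.A y) (W t (S.E x))
      - inner 𝕜 (S.E y) (W t (S.B (S.Rinv ((S.B†) (W t (S.E x))))))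
      - inner 𝕜 (S.E y) (W t (S.B (S.Rinv ((S.B†) (S.PiTilde₀ x)))))
      + inner 𝕜 (y : X) (S.Q (S.PX x)) = 0
  final : ∀ x : X, (S.E†) (W S.tf (S.E x)) = S.G x

/-- `Z₂ : [0, tf] → L(Z₀, Z₁)` satisfies
`Z₂(t) (A₀ - B₀ R⁻¹ B₀* Π₀) = E₁⁻* Π₁(t) E₁⁻¹ B₁ R⁻¹ B₀* Π₀` on `D(A₀)`, for `t ∈ [0, tf]`. -/
def SolvesAlgebraic (Z₂ : ℝ → S.Z₀ →L[𝕜] S.Z₁) : Prop :=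
  ∀ t ∈ Icc 0 S.tf, ∀ x : S.A₀.domain,
    Z₂ t (S.A₀ x - S.B₀ (S.Rinv (((S.B₀)†) (S.Pi₀ x)))) =
      S.block₁ t (S.B₁ (S.Rinv (((S.B₀)†) (S.Pi₀ x))))

end LQProblem

/-! On `X₀` the state follows the control instantly, `x₀ = -B̃₀ u`, and neither `G` nor `Q` couples
`X₀` with `X₁`. Hence the cost is that of an ordinary regulator on `X₁` with weights `G₁`, `Q₁` and
the control weight `Rt = R + B̃₀* Q₀ B̃₀` (`LQProblem.cost_eq`). What is left of the algebraic part
is one constraint: consistency restricts the single value `u(t₀)`.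

For the regulator put `L = E₁⁻¹ A₁`, `S = B̃₁ Rt⁻¹ B̃₁*`, and let `P` be the mild solution of `P' +
L* P + P L - P S P + Q₁ = 0`, `P(tf) = G₁`. Picard iteration extends a solution backwards by a step
that depends only on a bound for it, and an a priori bound on the form of `P` makes the solution
global (`exists_isRiccatiFlow`). Although a mild state need not lie in the domain of `L`, `⟨y, P x⟩`
is differentiable from the right along mild states (`inner_sub_eq_integral`). This completes the
square (`Regulator.IsFlow.cost_eq`): the cost is `⟨a, P(t) a⟩ + ∫ ⟨w, Rt w⟩` with `w = u + Rt⁻¹ B̃₁*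
P x₁`. A rapidly decaying correction of the control near the initial time shows that prescribing
`u(t₀)` does not raise the infimum (`exists_almost_optimal`), although it may no longer be attained.
So on a nondegenerate interval the optimal controls are exactly the admissible ones with `w = 0`.
Their costate is `P(t) a` (`costate_eq`), whence `Π₁ = P`.

The operator equation on `Z` is then read block by block. Testing with `y ∈ X₀` kills every term
with `E y` and forces the block `Z₁ → Z₀` to vanish (`inner_Z₀_Z₁`). Taking `x ∈ X₀` gives the
algebraic equation for `Z₂`. With `x, y ∈ X₁` the algebraic equation exchanges `R⁻¹` for `Rt⁻¹`
(`feedback_coefficient_of_algebraic`), which leaves the weak Riccati equation of the regulator. A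
weak solution is a mild one, and mild solutions are unique (`eq_of_weak`), so the block on `Z₁` is
determined, while the block on `Z₀` does not enter. Multiplying by `R` turns the feedback law into
`w = 0` (`feedback_iff`). -/

set_option linter.unusedSectionVars false

/-! ### Strongly continuous operator families and their strong integrals. -/

section StronglyContinuousFamilies

variable {𝕜 H K V : Type*} [RCLike 𝕜]
  [NormedAddCommGroup H] [InnerProductSpace 𝕜 H]
  [NormedAddCommGroup K] [InnerProductSpace 𝕜 K]
  [NormedAddCommGroup V] [InnerProductSpace 𝕜 V]

/-- Strong continuity of an operator-valued function on the whole real line. -/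
def StrongCont (W : ℝ → H →L[𝕜] K) : Prop := ∀ x, Continuous fun t => W t x

/-- Each orbit is bounded on the compact interval, so the uniform boundedness principle applies.
This bound is what makes strong continuity stable under composition. -/
theorem StrongCont.exists_bound [CompleteSpace H] {W : ℝ → H →L[𝕜] K} (hW : StrongCont W)
    (a b : ℝ) : ∃ C, 0 ≤ C ∧ ∀ t ∈ Icc a b, ‖W t‖ ≤ C := by
  obtain ⟨C, hC⟩ := banach_steinhaus (g := fun t : Icc a b => W t) fun x => by
    obtain ⟨C, hC⟩ := isCompact_Icc.exists_bound_of_continuousOn (hW x).continuousOn (s := Icc a b)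
    exact ⟨C, fun t => hC t t.2⟩
  exact ⟨max C 0, le_max_right _ _, fun t ht => (hC ⟨t, ht⟩).trans (le_max_left _ _)⟩

theorem StrongCont.tendsto_apply [CompleteSpace H] {W : ℝ → H →L[𝕜] K} (hW : StrongCont W)
    {ι : Type*} {l : Filter ι} {τ : ι → ℝ} {x : ι → H} {t : ℝ} {x₀ : H}
    (hτ : Tendsto τ l (𝓝 t)) (hx : Tendsto x l (𝓝 x₀)) :
    Tendsto (fun i => W (τ i) (x i)) l (𝓝 (W t x₀)) := by
  obtain ⟨C, hC0, hC⟩ := hW.exists_bound (t - 1) (t + 1)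
  have h1 : Tendsto (fun i => W (τ i) x₀) l (𝓝 (W t x₀)) := ((hW x₀).tendsto t).comp hτ
  have h2 : Tendsto (fun i => W (τ i) (x i - x₀)) l (𝓝 0) := by
    have hb : ∀ᶠ i in l, ‖W (τ i) (x i - x₀)‖ ≤ C * ‖x i - x₀‖ := by
      filter_upwards [hτ (Icc_mem_nhds (by linarith : t - 1 < t) (by linarith : t < t + 1))]
        with i hi
      exact (W (τ i)).le_of_opNorm_le (hC _ hi) _
    refine squeeze_zero_norm' hb ?_
    have := (tendsto_iff_norm_sub_tendsto_zero.1 hx).const_mul C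
    simpa using this
  simpa using h2.add h1

theorem StrongCont.continuous_apply [CompleteSpace H] {W : ℝ → H →L[𝕜] K} (hW : StrongCont W)
    {Y : Type*} [TopologicalSpace Y] {τ : Y → ℝ} {x : Y → H} (hτ : Continuous τ)
    (hx : Continuous x) : Continuous fun i => W (τ i) (x i) :=
  continuous_iff_continuousAt.2 fun i => hW.tendsto_apply (hτ.tendsto i) (hx.tendsto i)

theorem StrongCont.comp_continuous {W : ℝ → H →L[𝕜] K} (hW : StrongCont W) {τ : ℝ → ℝ}
    (hτ : Continuous τ) : StrongCont fun t => W (τ t) := fun x => (hW x).comp hτ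

theorem StrongCont.comp [CompleteSpace K] {W : ℝ → K →L[𝕜] V} (hW : StrongCont W)
    {W' : ℝ → H →L[𝕜] K} (hW' : StrongCont W') : StrongCont fun t => W t ∘L W' t :=
  fun x => hW.continuous_apply continuous_id (hW' x)

theorem StrongCont.const (L : H →L[𝕜] K) : StrongCont fun _ => L := fun _ => continuous_const

theorem StrongCont.add {W W' : ℝ → H →L[𝕜] K} (hW : StrongCont W) (hW' : StrongCont W') :
    StrongCont fun t => W t + W' t := fun x => (hW x).add (hW' x)

theorem StrongCont.sub {W W' : ℝ → H →L[𝕜] K} (hW : StrongCont W) (hW' : StrongCont W') :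
    StrongCont fun t => W t - W' t := fun x => (hW x).sub (hW' x)

variable [NormedSpace ℝ K] [IsScalarTower ℝ 𝕜 K]

/-- The strong integral of a strongly continuous family of operators. -/
noncomputable def strongInt [CompleteSpace H] (W : ℝ → H →L[𝕜] K) (hW : StrongCont W)
    (a b : ℝ) : H →L[𝕜] K :=
  LinearMap.mkContinuousOfExistsBound
    { toFun := fun x => ∫ r in a..b, W r x
      map_add' := fun x y => by
        simp only [map_add]
        exact intervalIntegral.integral_add ((hW x).intervalIntegrable _ _)
          ((hW y).intervalIntegrable _ _)
      map_smul' := fun c x => by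
        simp only [map_smul]
        exact intervalIntegral.integral_smul _ _ }
    (by
      obtain ⟨C, _, hC⟩ := hW.exists_bound (min a b) (max a b)
      refine ⟨C * |b - a|, fun x => ?_⟩
      refine (intervalIntegral.norm_integral_le_of_norm_le_const (C := C * ‖x‖)
        fun t ht => (W t).le_of_opNorm_le (hC t (uIoc_subset_uIcc ht)) x).trans_eq (by ring))

theorem strongInt_apply [CompleteSpace H] {W : ℝ → H →L[𝕜] K} (hW : StrongCont W) (a b : ℝ)
    (x : H) : strongInt W hW a b x = ∫ r in a..b, W r x := rfl

theorem inner_strongInt [CompleteSpace H] [CompleteSpace K] {W : ℝ → H →L[𝕜] K}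
    (hW : StrongCont W) {a b : ℝ} (hab : a ≤ b) (y : K) (x : H) :
    inner 𝕜 y (strongInt W hW a b x) = ∫ r in a..b, inner 𝕜 y (W r x) := by
  rw [strongInt_apply, intervalIntegral.integral_of_le hab, intervalIntegral.integral_of_le hab,
    integral_inner]
  exact ((hW x).intervalIntegrable a b).1

theorem continuous_integral_triangle {E : Type*} [NormedAddCommGroup E] [NormedSpace ℝ E]
    {f : ℝ → ℝ → E} (hf : Continuous (Function.uncurry f)) (b : ℝ) :
    Continuous fun t => ∫ r in t..b, f t r := by
  have := (intervalIntegral.continuous_parametric_intervalIntegral_of_continuous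
    (μ := volume) (a₀ := b) hf continuous_id).neg
  convert this using 2 with t
  rw [intervalIntegral.integral_symm]; rfl

/-- The mean value of a continuous function of two variables over a shrinking interval. -/
theorem tendsto_average {E : Type*} [NormedAddCommGroup E] [NormedSpace ℝ E] [CompleteSpace E]
    {f : ℝ → ℝ → E} (hf : Continuous (Function.uncurry f)) (s : ℝ) :
    Tendsto (fun h : ℝ => h⁻¹ • ∫ r in s..s + h, f h r) (𝓝[>] 0) (𝓝 (f 0 s)) := by
  rw [Metric.tendsto_nhds]
  intro ε hε
  have hc := Metric.continuous_iff.1 hf (0, s) (ε / 2) (half_pos hε)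
  obtain ⟨δ, hδ, hc⟩ := hc
  filter_upwards [Ioo_mem_nhdsGT hδ] with h hh
  have h0 : h ≠ 0 := hh.1.ne'
  have hfc : Continuous fun r => f h r := hf.comp (by fun_prop : Continuous fun r : ℝ => (h, r))
  have : h⁻¹ • (∫ r in s..s + h, f h r) - f 0 s = h⁻¹ • ∫ r in s..s + h, (f h r - f 0 s) := by
    rw [intervalIntegral.integral_sub (hfc.intervalIntegrable _ _)
      (continuous_const.intervalIntegrable _ _), smul_sub]
    simp [smul_smul, h0]
  rw [dist_eq_norm, this, norm_smul]
  have hb : ‖∫ r in s..s + h, (f h r - f 0 s)‖ ≤ ε / 2 * |s + h - s| := by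
    refine intervalIntegral.norm_integral_le_of_norm_le_const fun r hr => ?_
    rw [uIoc_of_le (by linarith [hh.1])] at hr
    rw [← dist_eq_norm]
    refine (hc (h, r) ?_).le
    rw [Prod.dist_eq, max_lt_iff]
    simp only [Real.dist_eq, sub_zero, abs_of_pos hh.1]
    exact ⟨hh.2, by rw [abs_of_pos (by linarith [hr.1])]; linarith [hr.2, hh.2]⟩
  rw [add_sub_cancel_left, abs_of_pos hh.1] at hb
  rw [norm_inv, Real.norm_of_nonneg hh.1.le]
  calc h⁻¹ * _ ≤ h⁻¹ * (ε / 2 * h) := by gcongr; exact inv_nonneg.2 hh.1.le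
    _ = ε / 2 := by field_simp
    _ < ε := by linarith

end StronglyContinuousFamilies

/-! ### Semigroups and strong continuity of the adjoint semigroup. -/

section Semigroups

variable {𝕜 H : Type*} [RCLike 𝕜] [NormedAddCommGroup H] [InnerProductSpace 𝕜 H]

/-- A `C₀`-semigroup, extended to the real line by the identity for negative times. -/
structure IsHalfLineSemigroup (T : ℝ → H →L[𝕜] H) : Prop where
  of_nonpos : ∀ t ≤ 0, T t = ContinuousLinearMap.id 𝕜 H
  add : ∀ s t : ℝ, 0 ≤ s → 0 ≤ t → T (s + t) = T s ∘L T t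
  strongCont : StrongCont T

/-- With a value prescribed for negative times, all integrands become continuous on the whole line,
and no side conditions are needed for measurability or integrability. -/
theorem IsC0Semigroup.isHalfLineSemigroup {T : ℝ → H →L[𝕜] H} (hT : IsC0Semigroup T) :
    IsHalfLineSemigroup fun t => T (max t 0) where
  of_nonpos t ht := by rw [max_eq_right ht, hT.zero]
  add s t hs ht := by
    rw [max_eq_left hs, max_eq_left ht, max_eq_left (add_nonneg hs ht), hT.add s t hs ht]
  strongCont x := (hT.strongly_continuous x).comp_continuous
    (continuous_id.max continuous_const) fun t => mem_Ici.2 (le_max_right t 0)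

namespace IsHalfLineSemigroup

variable {T : ℝ → H →L[𝕜] H}

theorem zero (hT : IsHalfLineSemigroup T) : T 0 = ContinuousLinearMap.id 𝕜 H :=
  hT.of_nonpos 0 le_rfl

theorem add_apply (hT : IsHalfLineSemigroup T) {s t : ℝ} (hs : 0 ≤ s) (ht : 0 ≤ t) (x : H) :
    T (s + t) x = T s (T t x) := by rw [hT.add s t hs ht]; rfl

theorem max_zero (hT : IsHalfLineSemigroup T) (t : ℝ) : T (max t 0) = T t := by
  rcases le_total t 0 with h | h
  · rw [max_eq_right h, hT.zero, hT.of_nonpos t h]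
  · rw [max_eq_left h]

theorem exists_bound [CompleteSpace H] (hT : IsHalfLineSemigroup T) (b : ℝ) :
    ∃ M, 1 ≤ M ∧ ∀ t ≤ b, ‖T t‖ ≤ M := by
  obtain ⟨C, _, hC⟩ := hT.strongCont.exists_bound 0 (max b 0)
  refine ⟨max C 1, le_max_right _ _, fun t ht => ?_⟩
  rw [← hT.max_zero]
  exact (hC _ ⟨le_max_right _ _, max_le_max_right _ ht⟩).trans (le_max_left _ _)

variable [CompleteSpace H]

/-- Shifting the variable of integration leaves only two integrals over intervals of length `h`. The
estimate is in operator norm and so passes to adjoints, which strong convergence would not. -/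
theorem norm_integral_comp_sub_le (hT : IsHalfLineSemigroup T) [NormedSpace ℝ H]
    [IsScalarTower ℝ 𝕜 H] {M : ℝ} (hM : ∀ t ≤ 2, ‖T t‖ ≤ M) (hM0 : 0 ≤ M) {ε h : ℝ}
    (hε : ε ∈ Ioc 0 1) (hh : h ∈ Ioc 0 1) :
    ‖strongInt T hT.strongCont 0 ε ∘L T h - strongInt T hT.strongCont 0 ε‖ ≤ 2 * M * h := by
  refine ContinuousLinearMap.opNorm_le_bound _ (by have := hh.1; positivity) fun x => ?_
  have hi : ∀ a b, IntervalIntegrable (fun r => T r x) volume a b :=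
    fun a b => (hT.strongCont x).intervalIntegrable a b
  have h1 : ∫ r in (0:ℝ)..ε, T r (T h x) = ∫ r in h..ε + h, T r x := by
    have := intervalIntegral.integral_comp_add_right (a := 0) (b := ε) (fun r => T r x) h
    rw [zero_add] at this
    rw [← this]
    refine intervalIntegral.integral_congr fun r hr => ?_
    rw [uIcc_of_le hε.1.le] at hr
    exact (hT.add_apply hr.1 hh.1.le x).symm
  have h2 : (∫ r in h..ε + h, T r x) - ∫ r in (0:ℝ)..ε, T r x =
      (∫ r in ε..ε + h, T r x) - ∫ r in (0:ℝ)..h, T r x := by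
    rw [← intervalIntegral.integral_add_adjacent_intervals (hi h ε) (hi ε (ε + h)),
      ← intervalIntegral.integral_add_adjacent_intervals (hi 0 h) (hi h ε)]
    abel
  have hb : ∀ a, 0 ≤ a → a ≤ 1 → ‖∫ r in a..a + h, T r x‖ ≤ M * ‖x‖ * h := by
    intro a ha ha1
    refine (intervalIntegral.norm_integral_le_of_norm_le_const (C := M * ‖x‖) fun r hr => ?_).trans_eq
      (by rw [add_sub_cancel_left, abs_of_pos hh.1])
    rw [uIoc_of_le (by linarith [hh.1])] at hr
    exact (T r).le_of_opNorm_le (hM r (by linarith [hr.2, hh.2])) x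
  rw [_root_.sub_apply, ContinuousLinearMap.comp_apply, strongInt_apply,
    strongInt_apply, h1, h2]
  refine (norm_sub_le _ _).trans ?_
  have := hb ε hε.1.le hε.2
  have h0 := hb 0 le_rfl zero_le_one
  rw [zero_add] at h0
  linarith

/-- The adjoint of a strongly continuous semigroup on a Hilbert space is strongly continuous
at `0`. -/
theorem tendsto_adjoint (hT : IsHalfLineSemigroup T) (x : H) :
    Tendsto (fun h => ((T h)†) x) (𝓝[>] 0) (𝓝 x) := by
  let : NormedSpace ℝ H := NormedSpace.restrictScalars ℝ 𝕜 H
  obtain ⟨M, hM1, hM⟩ := hT.exists_bound 2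
  have hM0 : 0 ≤ M := zero_le_one.trans hM1
  let V : Submodule 𝕜 H :=
    { carrier := {x | Tendsto (fun h => ((T h)†) x) (𝓝[>] 0) (𝓝 x)}
      add_mem' := fun {x y} hx hy => by
        simp only [mem_ofPred_eq, map_add] at *
        exact hx.add hy
      zero_mem' := by simp
      smul_mem' := fun c x hx => by
        simp only [mem_ofPred_eq, map_smul] at *
        exact hx.const_smul c }
  -- By the preceding estimate the adjoint of `∫₀^ε T` maps into `V`. A vector `v ⊥ V` therefore
  -- satisfies `⟨v, ∫₀^ε T(r) v dr⟩ = 0` for all small `ε`; dividing by `ε` and letting `ε → 0`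
  -- gives `⟨v, v⟩ = 0`.
  have hV : V.topologicalClosure = ⊤ := by
    rw [Submodule.topologicalClosure_eq_top_iff, Submodule.eq_bot_iff]
    intro v hv
    have key : ∀ ε ∈ Ioc (0:ℝ) 1, inner 𝕜 v (∫ r in (0:ℝ)..0 + ε, T r v) = 0 := by
      intro ε hε
      have hmem : ((strongInt T hT.strongCont 0 ε)†) v ∈ V := by
        change Tendsto _ _ _
        rw [tendsto_iff_norm_sub_tendsto_zero]
        have hlim : Tendsto (fun h : ℝ => 2 * M * h * ‖v‖) (𝓝[>] 0) (𝓝 0) := by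
          have : Continuous fun h : ℝ => 2 * M * h * ‖v‖ := by fun_prop
          simpa using (this.tendsto 0).mono_left nhdsWithin_le_nhds
        refine squeeze_zero' (Eventually.of_forall fun _ => norm_nonneg _) ?_ hlim
        filter_upwards [Ioo_mem_nhdsGT zero_lt_one] with h hh
        have := hT.norm_integral_comp_sub_le hM hM0 hε ⟨hh.1, hh.2.le⟩
        rw [← LinearIsometryEquiv.norm_map (ContinuousLinearMap.adjoint (𝕜 := 𝕜)), map_sub,
          ContinuousLinearMap.adjoint_comp] at this
        exact ContinuousLinearMap.le_of_opNorm_le _ this v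
      have := Submodule.inner_right_of_mem_orthogonal hmem hv
      rw [ContinuousLinearMap.adjoint_inner_left, strongInt_apply] at this
      simpa using this
    have hl := tendsto_average (f := fun _ r => T r v)
      ((hT.strongCont v).comp continuous_snd) 0
    have hl2 := (tendsto_const_nhds (x := v)).inner (𝕜 := 𝕜) hl
    rw [hT.zero] at hl2
    have h0 : Tendsto (fun h : ℝ => inner 𝕜 v (h⁻¹ • ∫ r in (0:ℝ)..0 + h, T r v)) (𝓝[>] 0)
        (𝓝 (0:𝕜)) := by
      refine tendsto_const_nhds.congr' ?_
      filter_upwards [Ioo_mem_nhdsGT zero_lt_one] with h hh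
      rw [← algebraMap_smul 𝕜 (h⁻¹), inner_smul_right, key h ⟨hh.1, hh.2.le⟩, mul_zero]
    exact inner_self_eq_zero.1 (tendsto_nhds_unique hl2 h0)
  rw [Metric.tendsto_nhds]
  intro ε hε
  have hx : x ∈ closure (V : Set H) := by
    rw [← Submodule.topologicalClosure_coe, hV]; trivial
  obtain ⟨y, hy, hxy⟩ := Metric.mem_closure_iff.1 hx (ε / (2 * (M + 1))) (by positivity)
  filter_upwards [Metric.tendsto_nhds.1 (show Tendsto _ _ _ from hy) (ε / 2) (half_pos hε),
    Ioo_mem_nhdsGT zero_lt_one] with h hh h1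
  have hn : ‖(T h)†‖ ≤ M := by
    rw [LinearIsometryEquiv.norm_map]; exact hM h (by linarith [h1.2])
  rw [dist_eq_norm] at *
  have e : ((T h)†) x - x = ((T h)†) (x - y) + (((T h)†) y - y) - (x - y) := by
    rw [map_sub]; abel
  rw [e]
  have hb := ((T h)†).le_of_opNorm_le hn (x - y)
  calc _ ≤ ‖((T h)†) (x - y)‖ + ‖((T h)†) y - y‖ + ‖x - y‖ :=
        (norm_sub_le _ _).trans (add_le_add_left (norm_add_le _ _) _)
    _ ≤ (M + 1) * ‖x - y‖ + ‖((T h)†) y - y‖ := by linarith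
    _ < (M + 1) * (ε / (2 * (M + 1))) + ε / 2 := by gcongr
    _ = ε := by field_simp; ring

theorem adjoint (hT : IsHalfLineSemigroup T) : IsHalfLineSemigroup fun t => (T t)† where
  of_nonpos t ht := by rw [hT.of_nonpos t ht, ContinuousLinearMap.adjoint_id]
  add s t hs ht := by rw [add_comm, hT.add t s ht hs, ContinuousLinearMap.adjoint_comp]
  strongCont x := by
    refine continuous_iff_continuousAt.2 fun t => ?_
    obtain ⟨M, hM1, hM⟩ := hT.exists_bound (max t 0 + 1)
    -- Since `T(b)* = T(a)* T(b - a)*` with `T(a)*` locally bounded, continuity from either side at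
    -- any time reduces to continuity at `0`.
    have key : ∀ a b : ℝ, 0 ≤ a → a ≤ b → b ≤ max t 0 + 1 →
        ‖((T a)†) x - ((T b)†) x‖ ≤ M * ‖((T (b - a))†) x - x‖ := by
      intro a b ha hab hb
      have : ((T b)†) x = ((T a)†) (((T (b - a))†) x) := by
        have := hT.add (b - a) a (sub_nonneg.2 hab) ha
        rw [sub_add_cancel] at this
        rw [this, ContinuousLinearMap.adjoint_comp]; rfl
      rw [this, ← map_sub, norm_sub_rev _ x]
      refine ContinuousLinearMap.le_of_opNorm_le _ ?_ _
      rw [LinearIsometryEquiv.norm_map]; exact hM a (hab.trans hb)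
    have h0 : Tendsto (fun h => ((T h)†) x) (𝓝 0) (𝓝 x) := by
      rw [← nhdsLE_sup_nhdsGT]
      refine Tendsto.sup ?_ (hT.tendsto_adjoint x)
      refine tendsto_const_nhds.congr' ?_
      filter_upwards [self_mem_nhdsWithin] with h hh
      rw [hT.of_nonpos h hh, ContinuousLinearMap.adjoint_id]; rfl
    have hd : Tendsto (fun s => |max s 0 - max t 0|) (𝓝 t) (𝓝 0) := by
      have : Continuous fun s : ℝ => |max s 0 - max t 0| := by fun_prop
      simpa using this.tendsto t
    have hlim := ((tendsto_iff_norm_sub_tendsto_zero.1 (h0.comp hd))).const_mul M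
    rw [mul_zero] at hlim
    rw [ContinuousAt, tendsto_iff_norm_sub_tendsto_zero]
    refine squeeze_zero' (Eventually.of_forall fun _ => norm_nonneg _) ?_ hlim
    filter_upwards [Iio_mem_nhds (lt_add_one t)] with s hs
    have hs' : max s 0 ≤ max t 0 + 1 :=
      max_le (hs.out.le.trans (by linarith [le_max_left t 0])) (by linarith [le_max_right t 0])
    rw [← hT.max_zero s, ← hT.max_zero t]
    simp only [Function.comp]
    rcases le_total (max s 0) (max t 0) with h | h
    · rw [abs_sub_comm, abs_of_nonneg (sub_nonneg.2 h)]
      exact key _ _ (le_max_right _ _) h (by linarith)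
    · rw [norm_sub_rev, abs_of_nonneg (sub_nonneg.2 h)]
      exact key _ _ (le_max_right _ _) h hs'

end IsHalfLineSemigroup

end Semigroups

/-! ### Mild states and Lyapunov equations in mild and weak form. -/

section MildStates

variable {𝕜 H : Type*} [RCLike 𝕜] [NormedAddCommGroup H] [InnerProductSpace 𝕜 H]

/-- `x` satisfies `x' = L x + v` at time `s` in the mild sense, `L` being the generator of `T`. -/
def HasForcing (T : ℝ → H →L[𝕜] H) (x : ℝ → H) (v : H) (s : ℝ) : Prop :=
  Tendsto (fun h : ℝ => ((h : 𝕜)⁻¹) • (x (s + h) - T h (x s))) (𝓝[>] 0) (𝓝 v)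

/-- The mild solution of `x' = L x + f`, `x(t₀) = a`, where `L` is the generator of `T`. -/
noncomputable def mildState [NormedSpace ℝ H] (T : ℝ → H →L[𝕜] H) (t₀ : ℝ) (a : H) (f : ℝ → H)
    (s : ℝ) : H :=
  T (s - t₀) a + ∫ r in t₀..s, T (s - r) (f r)

/-- The mild form of the Lyapunov equation `P' + L* P + P L + M = 0` between the times `t`, `s`. -/
def IsMildLyapunov (T P M : ℝ → H →L[𝕜] H) (t s : ℝ) : Prop :=
  ∀ y x, inner 𝕜 y (P t x) = inner 𝕜 (T (s - t) y) (P s (T (s - t) x)) +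
    ∫ r in t..s, inner 𝕜 (T (r - t) y) (M r (T (r - t) x))

theorem hasDerivWithinAt_Ioi_of_tendsto {E : Type*} [NormedAddCommGroup E] [NormedSpace ℝ E]
    {φ : ℝ → E} {l : E} {s : ℝ}
    (h : Tendsto (fun h : ℝ => h⁻¹ • (φ (s + h) - φ s)) (𝓝[>] 0) (𝓝 l)) :
    HasDerivWithinAt φ l (Ioi s) s := by
  rw [hasDerivWithinAt_iff_tendsto_slope' self_notMem_Ioi]
  have ht : Tendsto (fun s' : ℝ => s' - s) (𝓝[>] s) (𝓝[>] 0) := by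
    refine tendsto_nhdsWithin_iff.2 ⟨?_, ?_⟩
    · have : Continuous fun s' : ℝ => s' - s := by fun_prop
      simpa using (this.tendsto s).mono_left nhdsWithin_le_nhds
    · filter_upwards [self_mem_nhdsWithin] with r hr
      exact sub_pos.2 (mem_Ioi.1 hr)
  refine (h.comp ht).congr fun r => ?_
  simp [slope_def_module]

variable [CompleteSpace H] {T : ℝ → H →L[𝕜] H}

theorem tendsto_add_nhdsGT (s : ℝ) : Tendsto (fun h : ℝ => s + h) (𝓝[>] 0) (𝓝 s) := by
  have : Continuous fun h : ℝ => s + h := by fun_prop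
  simpa using (this.tendsto 0).mono_left nhdsWithin_le_nhds

theorem tendsto_id_nhdsGT : Tendsto (fun h : ℝ => h) (𝓝[>] 0) (𝓝 0) :=
  tendsto_id.mono_left nhdsWithin_le_nhds

theorem IsHalfLineSemigroup.tendsto_zero (hT : IsHalfLineSemigroup T) (x : H) :
    Tendsto (fun h => T h x) (𝓝[>] 0) (𝓝 x) := by
  have := hT.strongCont.tendsto_apply tendsto_id_nhdsGT (tendsto_const_nhds (x := x))
  rwa [hT.zero] at this

/-- This is the product rule without the generator: the mild identity on `[s, s + h]` rewrites the
old value in terms of `T h (x s)` and `T h (y s)`, so that the increment contains only the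
differences controlled by `HasForcing`. -/
theorem HasForcing.hasDerivWithinAt (hT : IsHalfLineSemigroup T) {P M : ℝ → H →L[𝕜] H}
    (hP : StrongCont P) (hM : StrongCont M) {x y : ℝ → H} {f g : H} {s : ℝ}
    (hy : Continuous y) (hxf : HasForcing T x f s) (hyg : HasForcing T y g s)
    (hmild : ∀ᶠ h in 𝓝[>] 0, IsMildLyapunov T P M s (s + h)) :
    HasDerivWithinAt (fun r => inner 𝕜 (y r) (P r (x r)))
      (-inner 𝕜 (y s) (M s (x s)) + inner 𝕜 g (P s (x s)) + inner 𝕜 (y s) (P s f))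
      (Ioi s) s := by
  refine hasDerivWithinAt_Ioi_of_tendsto ?_
  have hs := tendsto_add_nhdsGT s
  have h1 : Tendsto (fun h : ℝ => inner 𝕜 (y (s + h))
      (P (s + h) (((h : 𝕜)⁻¹) • (x (s + h) - T h (x s))))) (𝓝[>] 0)
      (𝓝 (inner 𝕜 (y s) (P s f))) :=
    ((hy.tendsto s).comp hs).inner (hP.tendsto_apply hs hxf)
  have h2 : Tendsto (fun h : ℝ => inner 𝕜 (((h : 𝕜)⁻¹) • (y (s + h) - T h (y s)))
      (P (s + h) (T h (x s)))) (𝓝[>] 0) (𝓝 (inner 𝕜 g (P s (x s)))) :=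
    hyg.inner (hP.tendsto_apply hs (hT.tendsto_zero _))
  have h3 := tendsto_average
    (f := fun _ r => inner 𝕜 (T (r - s) (y s)) (M r (T (r - s) (x s)))) (by
      have hx' := (hT.strongCont.comp_continuous (continuous_id.sub continuous_const)
        (τ := fun r => r - s) (x s))
      have hy' := (hT.strongCont.comp_continuous (continuous_id.sub continuous_const)
        (τ := fun r => r - s) (y s))
      exact (hy'.inner (hM.continuous_apply continuous_id hx')).comp continuous_snd) s
  simp only [sub_self, hT.zero, ContinuousLinearMap.id_apply] at h3
  have h4 := (h3.neg.add h2).add h1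
  refine h4.congr' ?_
  filter_upwards [hmild, self_mem_nhdsWithin] with h hm hpos
  have e := hm (y s) (x s)
  rw [add_sub_cancel_left] at e
  rw [e]
  simp only [map_smul, inner_smul_left, inner_smul_right, map_sub, inner_sub_left,
    inner_sub_right, map_inv₀, RCLike.conj_ofReal, RCLike.real_smul_eq_coe_mul]
  ring

variable [NormedSpace ℝ H] [IsScalarTower ℝ 𝕜 H]

theorem continuous_mildState (hT : IsHalfLineSemigroup T) (t₀ : ℝ) (a : H) {f : ℝ → H}
    (hf : Continuous f) : Continuous (mildState T t₀ a f) := by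
  refine (hT.strongCont.continuous_apply (by fun_prop) continuous_const).add ?_
  refine intervalIntegral.continuous_parametric_intervalIntegral_of_continuous
    (f := fun s r => T (s - r) (f r)) ?_ continuous_id
  exact hT.strongCont.continuous_apply (τ := fun p : ℝ × ℝ => p.1 - p.2)
    (x := fun p : ℝ × ℝ => f p.2) (by fun_prop) (by fun_prop)

theorem mildState_self (hT : IsHalfLineSemigroup T) (t₀ : ℝ) (a : H) (f : ℝ → H) :
    mildState T t₀ a f t₀ = a := by simp [mildState, hT.zero]

theorem continuous_convolution_integrand (hT : IsHalfLineSemigroup T) {f : ℝ → H}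
    (hf : Continuous f) (s : ℝ) : Continuous fun r => T (s - r) (f r) :=
  hT.strongCont.continuous_apply (by fun_prop) hf

theorem mildState_add (hT : IsHalfLineSemigroup T) {t₀ s h : ℝ} (hs : t₀ ≤ s) (hh : 0 ≤ h) (a : H)
    {f : ℝ → H} (hf : Continuous f) : mildState T t₀ a f (s + h) =
      T h (mildState T t₀ a f s) + ∫ r in s..s + h, T (s + h - r) (f r) := by
  have hi := fun s => continuous_convolution_integrand hT hf s
  unfold mildState
  rw [← intervalIntegral.integral_add_adjacent_intervals
    ((hi (s + h)).intervalIntegrable t₀ s) ((hi (s + h)).intervalIntegrable s (s + h)), map_add,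
    ← ContinuousLinearMap.intervalIntegral_comp_comm (T h) ((hi s).intervalIntegrable t₀ s),
    ← hT.add_apply hh (sub_nonneg.2 hs), ← add_assoc]
  have e : ∫ r in t₀..s, T (s + h - r) (f r) = ∫ r in t₀..s, T h (T (s - r) (f r)) := by
    refine intervalIntegral.integral_congr fun r hr => ?_
    rw [uIcc_of_le hs] at hr
    rw [← hT.add_apply hh (sub_nonneg.2 hr.2)]
    congr 2; ring
  rw [e, show h + (s - t₀) = s + h - t₀ by ring]

theorem hasForcing_mildState (hT : IsHalfLineSemigroup T) {t₀ s : ℝ} (hs : t₀ ≤ s) (a : H)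
    {f : ℝ → H} (hf : Continuous f) : HasForcing T (mildState T t₀ a f) (f s) s := by
  have h := tendsto_average (f := fun h r => T (s + h - r) (f r))
    (hT.strongCont.continuous_apply (τ := fun p : ℝ × ℝ => s + p.1 - p.2)
      (x := fun p : ℝ × ℝ => f p.2) (by fun_prop) (by fun_prop)) s
  simp only [add_zero, sub_self, hT.zero, ContinuousLinearMap.id_apply] at h
  refine h.congr' ?_
  filter_upwards [self_mem_nhdsWithin] with h hh
  rw [mildState_add hT hs (le_of_lt hh) a hf, add_sub_cancel_left, ← RCLike.ofReal_inv]
  exact (algebraMap_smul 𝕜 h⁻¹ _).symm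

theorem mildState_congr {t₀ s : ℝ} (hs : t₀ ≤ s) (a : H) {f g : ℝ → H} (h : EqOn f g (Icc t₀ s)) :
    mildState T t₀ a f s = mildState T t₀ a g s := by
  unfold mildState
  congr 1
  refine intervalIntegral.integral_congr fun r hr => ?_
  rw [uIcc_of_le hs] at hr
  simp only [h hr]

theorem mildState_add_add (hT : IsHalfLineSemigroup T) (t₀ s : ℝ) (a b : H) {f g : ℝ → H}
    (hf : Continuous f) (hg : Continuous g) :
    mildState T t₀ (a + b) (fun r => f r + g r) s = mildState T t₀ a f s + mildState T t₀ b g s := by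
  unfold mildState
  simp only [map_add]
  rw [intervalIntegral.integral_add
    ((continuous_convolution_integrand hT hf s).intervalIntegrable _ _)
    ((continuous_convolution_integrand hT hg s).intervalIntegrable _ _)]
  abel

/-- A continuous function with a continuous right derivative is the integral of that derivative, so
the one-sided product rule is enough. The energy identity, the costate formula and both uniqueness
arguments for `P` rest on choices of `x` and `y` here or on the same computation for semigroup
orbits. -/
theorem inner_sub_eq_integral (hT : IsHalfLineSemigroup T) {P M : ℝ → H →L[𝕜] H}
    (hP : StrongCont P) (hM : StrongCont M) {x y f g : ℝ → H} (hx : Continuous x)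
    (hy : Continuous y) (hf : Continuous f) (hg : Continuous g) {a b : ℝ} (hab : a ≤ b)
    (hxf : ∀ s ∈ Ioo a b, HasForcing T x (f s) s) (hyg : ∀ s ∈ Ioo a b, HasForcing T y (g s) s)
    (hmild : ∀ s ∈ Icc a b, ∀ s' ∈ Icc s b, IsMildLyapunov T P M s s') :
    ∫ s in a..b, (-inner 𝕜 (y s) (M s (x s)) + inner 𝕜 (g s) (P s (x s)) +
      inner 𝕜 (y s) (P s (f s))) = inner 𝕜 (y b) (P b (x b)) - inner 𝕜 (y a) (P a (x a)) := by
  refine intervalIntegral.integral_eq_sub_of_hasDeriv_right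
    (f := fun r => inner 𝕜 (y r) (P r (x r))) ?_ ?_ ?_
  · exact (hy.inner (hP.continuous_apply continuous_id hx)).continuousOn
  · intro s hs
    rw [min_eq_left hab, max_eq_right hab] at hs
    refine HasForcing.hasDerivWithinAt hT hP hM hy (hxf s hs) (hyg s hs) ?_
    filter_upwards [Ioo_mem_nhdsGT (sub_pos.2 hs.2)] with h hh
    exact hmild s ⟨hs.1.le, hs.2.le⟩ _ ⟨by linarith [hh.1], by linarith [hh.2]⟩
  · refine Continuous.intervalIntegrable ?_ _ _
    have h1 := hy.inner (𝕜 := 𝕜) (hM.continuous_apply continuous_id hx)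
    have h2 := hg.inner (𝕜 := 𝕜) (hP.continuous_apply continuous_id hx)
    have h3 := hy.inner (𝕜 := 𝕜) (hP.continuous_apply continuous_id hf)
    exact (h1.neg.add h2).add h3

/-- Sandwiching by the semigroup: `T(r - t)* M(r) T(r - t)`. -/
theorem IsHalfLineSemigroup.strongCont_sandwich (hT : IsHalfLineSemigroup T)
    {M : ℝ → H →L[𝕜] H} (hM : StrongCont M) (t : ℝ) :
    StrongCont fun r => (T (r - t))† ∘L M r ∘L T (r - t) :=
  have hc : Continuous fun r : ℝ => r - t := by fun_prop
  (hT.adjoint.strongCont.comp_continuous hc).comp (hM.comp (hT.strongCont.comp_continuous hc))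

theorem isMildLyapunov_iff (hT : IsHalfLineSemigroup T) {P M : ℝ → H →L[𝕜] H}
    (hM : StrongCont M) {t s : ℝ} (hts : t ≤ s) : IsMildLyapunov T P M t s ↔
      P t = (T (s - t))† ∘L P s ∘L T (s - t) +
        strongInt _ (hT.strongCont_sandwich hM t) t s := by
  have key : ∀ y x, inner 𝕜 y (((T (s - t))† ∘L P s ∘L T (s - t) +
        strongInt _ (hT.strongCont_sandwich hM t) t s) x) =
        inner 𝕜 (T (s - t) y) (P s (T (s - t) x)) +
    ∫ r in t..s, inner 𝕜 (T (r - t) y) (M r (T (r - t) x)) := by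
    intro y x
    rw [_root_.add_apply, inner_add_right, inner_strongInt _ hts]
    simp only [ContinuousLinearMap.comp_apply, ContinuousLinearMap.adjoint_inner_right]
  constructor
  · intro h
    ext x
    refine ext_inner_left 𝕜 fun y => ?_
    rw [key, h]
  · intro h y x
    rw [h, key]

/-- The identity between `t` and `b` splits at `s`, and by the semigroup law its part after `s` is
the identity between `s` and `b`, evaluated at `T(s - t) y` and `T(s - t) x`. -/
theorem isMildLyapunov_of_final (hT : IsHalfLineSemigroup T) {P M : ℝ → H →L[𝕜] H}
    (hM : StrongCont M) {t s b : ℝ} (hts : t ≤ s) (hsb : s ≤ b) (ht : IsMildLyapunov T P M t b)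
    (hs : IsMildLyapunov T P M s b) : IsMildLyapunov T P M t s := by
  intro y x
  have hc : ∀ z t, Continuous fun r => T (r - t) z := fun z t =>
    hT.strongCont.comp_continuous (τ := fun r => r - t) (by fun_prop) z
  have hi : ∀ a b, IntervalIntegrable (fun r => inner 𝕜 (T (r - t) y) (M r (T (r - t) x)))
      volume a b := fun a b =>
    ((hc y t).inner (hM.continuous_apply continuous_id (hc x t))).intervalIntegrable a b
  have hadd : ∀ z r, s ≤ r → T (r - s) (T (s - t) z) = T (r - t) z := fun z r hr => by
    rw [← hT.add_apply (sub_nonneg.2 hr) (sub_nonneg.2 hts)]; congr 2; ring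
  rw [ht, hs, hadd _ _ hsb, hadd _ _ hsb, ← intervalIntegral.integral_add_adjacent_intervals
    (hi t s) (hi s b), add_comm (∫ r in t..s, _), ← add_assoc]
  congr 2
  refine intervalIntegral.integral_congr fun r hr => ?_
  rw [uIcc_of_le hsb] at hr
  simp only [hadd _ r hr.1]

/-- A constant in the domain solves `x' = L x + v` with `v = -L x`. This lets the energy identity
handle fixed test vectors. -/
theorem IsGenerator.hasForcing_const {L : H →ₗ.[𝕜] H} (hL : IsGenerator L T) (x : L.domain)
    (s : ℝ) : HasForcing T (fun _ => (x : H)) (-L x) s := by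
  have := ((hL x (L x)).2 ⟨x.2, rfl⟩).neg
  refine this.congr fun h => ?_
  rw [← smul_neg, neg_sub]

theorem IsGenerator.mem_domain (hT : IsHalfLineSemigroup T) {L : H →ₗ.[𝕜] H}
    (hL : IsGenerator L T) (x : L.domain) {s : ℝ} (hs : 0 ≤ s) :
    ∃ h : T s x ∈ L.domain, L ⟨T s x, h⟩ = T s (L x) := by
  refine (hL (T s x) (T s (L x))).1 ?_
  refine (((T s).continuous.tendsto _).comp ((hL x (L x)).2 ⟨x.2, rfl⟩)).congr' ?_
  filter_upwards [self_mem_nhdsWithin] with h hh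
  simp only [Function.comp, map_smul, map_sub]
  rw [← hT.add_apply hs (le_of_lt hh), add_comm, hT.add_apply (le_of_lt hh) hs]

/-- A weak solution of the Lyapunov equation, tested on the domain of the generator, is a mild
solution. -/
theorem isMildLyapunov_of_weak (hT : IsHalfLineSemigroup T) {L : H →ₗ.[𝕜] H}
    (hL : IsGenerator L T) (hdense : Dense (L.domain : Set H)) {P M : ℝ → H →L[𝕜] H}
    (hP : StrongCont P) (hM : StrongCont M) {a b : ℝ}
    (hd : ∀ y x : L.domain, ∀ t ∈ Ioo a b, HasDerivAt (fun t => inner 𝕜 (y : H) (P t x))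
      (-inner 𝕜 (y : H) (M t x) - inner 𝕜 (L y) (P t x) - inner 𝕜 (y : H) (P t (L x))) t)
    {t s : ℝ} (hat : a ≤ t) (hts : t ≤ s) (hsb : s ≤ b) : IsMildLyapunov T P M t s := by
  rw [isMildLyapunov_iff hT hM hts]
  set R := (T (s - t))† ∘L P s ∘L T (s - t) + strongInt _ (hT.strongCont_sandwich hM t) t s
    with hR
  have hc : ∀ z, Continuous fun r => T (r - t) z := fun z =>
    hT.strongCont.comp_continuous (τ := fun r => r - t) (by fun_prop) z
  have key : ∀ y x : L.domain, inner 𝕜 (y : H) (P t x) = inner 𝕜 (y : H) (R x) := by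
    intro y x
    -- Orbits that start in the domain stay there. In the derivative of `⟨T(r - t) y, P(r) T(r - t)
    -- x⟩` the generator terms from the two orbits cancel those of the weak equation, and only `M`
    -- survives.
    have ftc : ∫ r in t..s, -inner 𝕜 (T (r - t) y) (M r (T (r - t) x)) =
        inner 𝕜 (T (s - t) y) (P s (T (s - t) x)) -
          inner 𝕜 (T (t - t) y) (P t (T (t - t) x)) := by
      refine intervalIntegral.integral_eq_sub_of_hasDeriv_right
        (f := fun r => inner 𝕜 (T (r - t) y) (P r (T (r - t) x))) ?_ ?_ ?_
      · exact ((hc y).inner (hP.continuous_apply continuous_id (hc x))).continuousOn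
      · intro r hr
        rw [min_eq_left hts, max_eq_right hts] at hr
        refine hasDerivWithinAt_Ioi_of_tendsto ?_
        obtain ⟨hxD, hLx⟩ := hL.mem_domain hT x (sub_nonneg.2 hr.1.le)
        obtain ⟨hyD, hLy⟩ := hL.mem_domain hT y (sub_nonneg.2 hr.1.le)
        have hs := tendsto_add_nhdsGT r
        set xr : L.domain := ⟨_, hxD⟩
        set yr : L.domain := ⟨_, hyD⟩
        have h1 : Tendsto (fun h : ℝ => inner 𝕜 (T h yr)
            (P (r + h) (((h : 𝕜)⁻¹) • (T h xr - xr)))) (𝓝[>] 0)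
            (𝓝 (inner 𝕜 (yr : H) (P r (L xr)))) :=
          (hT.tendsto_zero _).inner (hP.tendsto_apply hs ((hL xr (L xr)).2 ⟨xr.2, rfl⟩))
        have h2 : Tendsto (fun h : ℝ => inner 𝕜 (((h : 𝕜)⁻¹) • (T h yr - yr))
            (P (r + h) xr)) (𝓝[>] 0) (𝓝 (inner 𝕜 (L yr) (P r xr))) :=
          ((hL yr (L yr)).2 ⟨yr.2, rfl⟩).inner (hP.tendsto_apply hs tendsto_const_nhds)
        have h3 := ((hd yr xr r ⟨hat.trans_lt hr.1, hr.2.trans_le hsb⟩).tendsto_slope_zero_right)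
        have h4 := (h1.add h2).add h3
        have e : -inner 𝕜 (T (r - t) y) (M r (T (r - t) x)) =
            inner 𝕜 (yr : H) (P r (L xr)) + inner 𝕜 (L yr) (P r xr) +
            (-inner 𝕜 (yr : H) (M r xr) - inner 𝕜 (L yr) (P r xr) -
              inner 𝕜 (yr : H) (P r (L xr))) := by ring
        rw [e]
        refine h4.congr' ?_
        filter_upwards [self_mem_nhdsWithin] with h hh
        have hadd : ∀ z, T (r + h - t) z = T h (T (r - t) z) := fun z => by
          rw [← hT.add_apply (le_of_lt hh) (sub_nonneg.2 hr.1.le)]; congr 2; ring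
        rw [hadd, hadd]
        simp only [map_smul, inner_smul_left, inner_smul_right, map_sub, inner_sub_left,
          inner_sub_right, map_inv₀, RCLike.conj_ofReal, RCLike.real_smul_eq_coe_mul,
          xr, yr]
        ring
      · exact (((hc y).inner (hM.continuous_apply continuous_id (hc x))).neg).intervalIntegrable
          _ _
    rw [intervalIntegral.integral_neg, sub_self, hT.zero] at ftc
    rw [hR, _root_.add_apply, inner_add_right, inner_strongInt _ hts]
    simp only [ContinuousLinearMap.comp_apply, ContinuousLinearMap.adjoint_inner_right]
    simp only [ContinuousLinearMap.id_apply] at ftc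
    linear_combination ftc
  have h1 : ∀ x : L.domain, P t x = R x := fun x =>
    hdense.eq_of_inner_right (𝕜 := 𝕜) fun y hy => key ⟨y, hy⟩ x
  exact ContinuousLinearMap.ext_on (hdense.mono Submodule.subset_span) fun x hx => h1 ⟨x, hx⟩

end MildStates

/-! ### Perturbation by a time-dependent bounded feedback. -/

section Volterra

variable {𝕜 H : Type*} [RCLike 𝕜] [NormedAddCommGroup H] [InnerProductSpace 𝕜 H]
  [CompleteSpace H] [NormedSpace ℝ H] [IsScalarTower ℝ 𝕜 H] {T : ℝ → H →L[𝕜] H}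

/-- The terms of the Neumann series for `x' = L x + C x`, `x(t) = a`. -/
noncomputable def neumannTerm (T C : ℝ → H →L[𝕜] H) (t : ℝ) (a : H) : ℕ → ℝ → H
  | 0 => fun s => T (s - t) a
  | n + 1 => fun s => ∫ r in t..s, T (s - r) (C r (neumannTerm T C t a n r))

theorem continuous_neumannTerm (hT : IsHalfLineSemigroup T) {C : ℝ → H →L[𝕜] H}
    (hC : StrongCont C) (t : ℝ) (a : H) (n : ℕ) : Continuous (neumannTerm T C t a n) := by
  induction n with
  | zero => exact hT.strongCont.continuous_apply (by fun_prop) continuous_const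
  | succ n ih =>
    have := continuous_mildState hT t 0 (hC.continuous_apply continuous_id ih)
    refine this.congr fun s => ?_
    simp [mildState, neumannTerm]

/-- Each integration contributes a factor `M N` and one more power of `s - t` over the factorial.
The Neumann series thus converges like an exponential, whatever the length of the interval. -/
theorem norm_neumannTerm_le {C : ℝ → H →L[𝕜] H} {t b : ℝ} (a : H) {M N : ℝ} (hM0 : 0 ≤ M) (hN0 : 0 ≤ N)
    (hM : ∀ s ≤ b - t, ‖T s‖ ≤ M) (hN : ∀ s ∈ Icc t b, ‖C s‖ ≤ N) (n : ℕ) :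
    ∀ s ∈ Icc t b, ‖neumannTerm T C t a n s‖ ≤
      M * ‖a‖ * (M * N) ^ n * ((s - t) ^ n / n.factorial) := by
  induction n with
  | zero =>
    intro s hs
    simpa [neumannTerm] using (T (s - t)).le_of_opNorm_le (hM _ (by linarith [hs.2])) a
  | succ n ih =>
    intro s hs
    set K := M * ‖a‖ * (M * N) ^ n with hK
    have hb : ‖neumannTerm T C t a (n + 1) s‖ ≤
        ∫ r in t..s, M * N * K * ((r - t) ^ n / n.factorial) := by
      refine intervalIntegral.norm_integral_le_of_norm_le hs.1
        (Eventually.of_forall fun r hr => ?_) ?_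
      · have h1 := ih r ⟨hr.1.le, hr.2.trans hs.2⟩
        have h2 := (C r).le_of_opNorm_le (hN r ⟨hr.1.le, hr.2.trans hs.2⟩)
          (neumannTerm T C t a n r)
        have h3 := (T (s - r)).le_of_opNorm_le (hM _ (by linarith [hr.1, hs.2]))
          (C r (neumannTerm T C t a n r))
        calc _ ≤ M * (N * (K * ((r - t) ^ n / n.factorial))) := by
              refine h3.trans ?_; gcongr; refine h2.trans ?_; gcongr
          _ = _ := by ring
      · exact Continuous.intervalIntegrable (by fun_prop) _ _
    refine hb.trans_eq ?_
    rw [intervalIntegral.integral_const_mul, intervalIntegral.integral_div,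
      intervalIntegral.integral_comp_sub_right (fun r => r ^ n), integral_pow, hK,
      Nat.factorial_succ]
    push_cast
    simp only [sub_self]
    have : (n.factorial : ℝ) ≠ 0 := by positivity
    have : (n : ℝ) + 1 ≠ 0 := by positivity
    field_simp
    ring

/-- The linear evolution equation `x' = L x + C x` with a strongly continuous perturbation has
mild solutions. -/
theorem exists_mildState_feedback (hT : IsHalfLineSemigroup T) {C : ℝ → H →L[𝕜] H}
    (hC : StrongCont C) {t b : ℝ} (htb : t ≤ b) (a : H) : ∃ x : ℝ → H, Continuous x ∧
      ∀ s ∈ Icc t b, x s = mildState T t a (fun r => C r (x r)) s := by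
  obtain ⟨M, hM1, hM⟩ := hT.exists_bound (b - t)
  obtain ⟨N, hN0, hN⟩ := hC.exists_bound t b
  have hM0 : 0 ≤ M := zero_le_one.trans hM1
  have hd := norm_neumannTerm_le a hM0 hN0 hM hN
  have hcont := continuous_neumannTerm hT hC t a
  set d := neumannTerm T C t a
  -- Freezing time outside `[t, b]` makes the bounds valid on the whole line, so that the sum is
  -- continuous there.
  set clamp : ℝ → ℝ := fun s => max t (min s b) with hclamp
  have hcl : ∀ s, clamp s ∈ Icc t b := fun s => ⟨le_max_left _ _, max_le htb (min_le_right _ _)⟩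
  have hcl' : ∀ s ∈ Icc t b, clamp s = s := fun s hs => by
    simp only [hclamp]; rw [min_eq_left hs.2, max_eq_right hs.1]
  have hclc : Continuous clamp := by fun_prop
  set u : ℕ → ℝ := fun n => M * ‖a‖ * ((M * N * (b - t)) ^ n / n.factorial) with hu
  have husum : Summable u := (Real.summable_pow_div_factorial _).mul_left _
  have hdu : ∀ n s, s ∈ Icc t b → ‖d n s‖ ≤ u n := fun n s hs => by
    refine (hd n s hs).trans ?_
    have h0 := sub_nonneg.2 hs.1
    have h1 : s - t ≤ b - t := by linarith [hs.2]
    calc _ ≤ M * ‖a‖ * (M * N) ^ n * ((b - t) ^ n / n.factorial) := by gcongr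
      _ = u n := by simp only [hu]; rw [mul_pow (M * N)]; ring
  have hsum : ∀ s, HasSum (fun n => d n (clamp s)) (∑' n, d n (clamp s)) := fun s =>
    (Summable.of_norm_bounded husum fun n => hdu n _ (hcl s)).hasSum
  refine ⟨fun s => ∑' n, d n (clamp s), ?_, fun s hs => ?_⟩
  · exact continuous_tsum (fun n => (hcont n).comp hclc) husum fun n s => hdu n _ (hcl s)
  · have h1 : HasSum (fun n => ∫ r in t..s, T (s - r) (C r (d n r)))
        (∫ r in t..s, T (s - r) (C r (∑' n, d n (clamp r)))) := by
      refine intervalIntegral.hasSum_integral_of_dominated_convergence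
        (fun n _ => M * (N * u n)) (fun n => ?_) (fun n => ?_) ?_ ?_ ?_
      · exact (continuous_convolution_integrand hT
          (hC.continuous_apply continuous_id (hcont n)) s).aestronglyMeasurable
      · refine Eventually.of_forall fun r hr => ?_
        rw [uIoc_of_le hs.1] at hr
        have hr' : r ∈ Icc t b := ⟨hr.1.le, hr.2.trans hs.2⟩
        refine ((T (s - r)).le_of_opNorm_le (hM _ (by linarith [hr.1, hs.2])) _).trans ?_
        gcongr
        refine ((C r).le_of_opNorm_le (hN r hr') _).trans ?_
        gcongr
        exact hdu n r hr'
      · exact Eventually.of_forall fun _ _ => (husum.mul_left _).mul_left _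
      · exact continuous_const.intervalIntegrable _ _
      · refine Eventually.of_forall fun r hr => ?_
        rw [uIoc_of_le hs.1] at hr
        have := hsum r
        rw [hcl' r ⟨hr.1.le, hr.2.trans hs.2⟩] at this ⊢
        exact (T (s - r)).hasSum ((C r).hasSum this)
    have h2 := hsum s
    simp only [hcl' s hs] at h2
    -- Integrating the series term by term shifts its index by one. Restoring the term of index `0`,
    -- which is `T(s - t) a`, gives the fixed point equation.
    have h3 : HasSum (fun n => d (n + 1) s) _ := h1
    have h4 := (hasSum_nat_add_iff (f := fun n => d n s) 1).1 h3
    simp only [hcl' s hs]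
    rw [h4.tsum_eq, Finset.sum_range_one, add_comm]
    rfl

end Volterra

/-! ### Norm estimates for mild Lyapunov equations. -/

section LyapunovEstimates

variable {𝕜 H : Type*} [RCLike 𝕜] [NormedAddCommGroup H] [InnerProductSpace 𝕜 H]
  [CompleteSpace H] {T : ℝ → H →L[𝕜] H}

theorem IsSelfAdjoint.inner_left {A : H →L[𝕜] H} (hA : IsSelfAdjoint A) (x y : H) :
    inner 𝕜 (A x) y = inner 𝕜 x (A y) := by
  rw [← ContinuousLinearMap.adjoint_inner_right, hA.adjoint_eq]

/-- The norm of a self-adjoint operator is the supremum of its absolute Rayleigh quotients. This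
turns bounds on the form of `P` into the norm bound needed for continuation. -/
theorem IsSelfAdjoint.norm_le_of_quadratic_form {A : H →L[𝕜] H} (hA : IsSelfAdjoint A) {K : ℝ}
    (hK : 0 ≤ K) (h0 : ∀ x, 0 ≤ RCLike.re (inner 𝕜 x (A x)))
    (h1 : ∀ x, RCLike.re (inner 𝕜 x (A x)) ≤ K * ‖x‖ ^ 2) : ‖A‖ ≤ K := by
  rw [A.norm_eq_iSup_rayleighQuotient hA.isSymmetric]
  refine ciSup_le fun x => ?_
  rw [ContinuousLinearMap.rayleighQuotient, ContinuousLinearMap.reApplyInnerSelf_apply,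
    hA.inner_left, abs_of_nonneg (div_nonneg (h0 x) (sq_nonneg _))]
  exact div_le_of_le_mul₀ (sq_nonneg _) hK (h1 x)

theorem norm_le_of_inner_le {A : H →L[𝕜] H} {K : ℝ} (hK : 0 ≤ K)
    (h : ∀ y x, ‖inner 𝕜 y (A x)‖ ≤ K * ‖y‖ * ‖x‖) : ‖A‖ ≤ K := by
  refine A.opNorm_le_bound hK fun x => ?_
  have := h (A x) x
  rw [inner_self_eq_norm_sq_to_K, norm_pow, RCLike.norm_ofReal, abs_norm] at this
  rcases eq_or_lt_of_le (norm_nonneg (A x)) with h0 | h0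
  · rw [← h0]; positivity
  · nlinarith

theorem norm_inner_apply_le {A L L' : H →L[𝕜] H} {m M : ℝ} (hA : ‖A‖ ≤ m) (hL : ‖L‖ ≤ M)
    (hL' : ‖L'‖ ≤ M) (y x : H) : ‖inner 𝕜 (L y) (A (L' x))‖ ≤ M ^ 2 * m * (‖y‖ * ‖x‖) := by
  have hM := (norm_nonneg L).trans hL
  have hm := (norm_nonneg A).trans hA
  calc _ ≤ ‖L y‖ * ‖A (L' x)‖ := norm_inner_le_norm _ _
    _ ≤ (M * ‖y‖) * (m * (M * ‖x‖)) := by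
        gcongr
        · exact L.le_of_opNorm_le hL y
        · refine (A.le_of_opNorm_le hA _).trans ?_
          gcongr
          exact L'.le_of_opNorm_le hL' x
    _ = _ := by ring

/-- The semigroup enters on both sides of the form, hence `b ^ 2`. Applied to a Picard iterate this
keeps the iterates bounded; applied to a difference of iterates it gives the contraction. -/
theorem IsMildLyapunov.norm_le {P M : ℝ → H →L[𝕜] H} {t s b m : ℝ} (hts : t ≤ s)
    (h : IsMildLyapunov T P M t s) (hb : ∀ r ≤ s - t, ‖T r‖ ≤ b) (hm : ∀ r ∈ Icc t s, ‖M r‖ ≤ m) :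
    ‖P t‖ ≤ b ^ 2 * (‖P s‖ + m * (s - t)) := by
  have hm0 : 0 ≤ m := (norm_nonneg _).trans (hm t ⟨le_rfl, hts⟩)
  have hst : 0 ≤ s - t := sub_nonneg.2 hts
  refine norm_le_of_inner_le (by positivity) fun y x => ?_
  rw [h]
  refine (norm_add_le _ _).trans ?_
  have h1 := norm_inner_apply_le (le_refl ‖P s‖) (hb (s - t) le_rfl) (hb (s - t) le_rfl) y x
  have h2 : ‖∫ r in t..s, inner 𝕜 (T (r - t) y) (M r (T (r - t) x))‖ ≤
      b ^ 2 * m * (‖y‖ * ‖x‖) * |s - t| := by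
    refine intervalIntegral.norm_integral_le_of_norm_le_const fun r hr => ?_
    rw [uIoc_of_le hts] at hr
    exact norm_inner_apply_le (hm r ⟨hr.1.le, hr.2⟩) (hb _ (by linarith [hr.2]))
      (hb _ (by linarith [hr.2])) y x
  rw [abs_of_nonneg hst] at h2
  linarith

theorem IsMildLyapunov.sub (hT : IsHalfLineSemigroup T) {P P' M M' : ℝ → H →L[𝕜] H}
    (hM : StrongCont M) (hM' : StrongCont M') {t s : ℝ} (h : IsMildLyapunov T P M t s)
    (h' : IsMildLyapunov T P' M' t s) :
    IsMildLyapunov T (fun r => P r - P' r) (fun r => M r - M' r) t s := by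
  intro y x
  have hc : ∀ z, Continuous fun r => T (r - t) z := fun z =>
    hT.strongCont.comp_continuous (τ := fun r => r - t) (by fun_prop) z
  have hi : ∀ {N : ℝ → H →L[𝕜] H}, StrongCont N →
      IntervalIntegrable (fun r => inner 𝕜 (T (r - t) y) (N r (T (r - t) x))) volume t s :=
    fun hN => ((hc y).inner (hN.continuous_apply continuous_id (hc x))).intervalIntegrable _ _
  simp only [_root_.sub_apply, inner_sub_right]
  rw [intervalIntegral.integral_sub (hi hM) (hi hM'), h, h']
  ring

theorem norm_conj_sub_conj_le {p q S : H →L[𝕜] H} {K ε : ℝ} (hp : ‖p‖ ≤ K) (hq : ‖q‖ ≤ K)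
    (hpq : ‖p - q‖ ≤ ε) : ‖p ∘L S ∘L p - q ∘L S ∘L q‖ ≤ 2 * K * ‖S‖ * ε := by
  have hK := (norm_nonneg p).trans hp
  have hε := (norm_nonneg _).trans hpq
  have : p ∘L S ∘L p - q ∘L S ∘L q = p ∘L S ∘L (p - q) + (p - q) ∘L S ∘L q := by
    ext x; simp
  rw [this]
  refine (norm_add_le _ _).trans ?_
  have h : ∀ a b : H →L[𝕜] H, ‖a ∘L S ∘L b‖ ≤ ‖a‖ * (‖S‖ * ‖b‖) := fun a b =>
    (a.opNorm_comp_le _).trans (by gcongr; exact S.opNorm_comp_le b)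
  have h1 : ‖p ∘L S ∘L (p - q)‖ ≤ K * (‖S‖ * ε) := (h _ _).trans (by gcongr)
  have h2 : ‖(p - q) ∘L S ∘L q‖ ≤ ε * (‖S‖ * K) := (h _ _).trans (by gcongr)
  linarith

end LyapunovEstimates

/-! ### The mild Riccati equation: Picard iteration and local extension. -/

section Riccati

variable {𝕜 H : Type*} [RCLike 𝕜] [NormedAddCommGroup H] [InnerProductSpace 𝕜 H]
  [CompleteSpace H] {T : ℝ → H →L[𝕜] H} {S Q G : H →L[𝕜] H} {tf : ℝ}

/-- The inhomogeneity `Q - P S P` of the Riccati equation. -/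
def riccatiRhs (S Q : H →L[𝕜] H) (P : ℝ → H →L[𝕜] H) (r : ℝ) : H →L[𝕜] H :=
  Q - P r ∘L S ∘L P r

theorem StrongCont.riccatiRhs {P : ℝ → H →L[𝕜] H} (hP : StrongCont P) (S Q : H →L[𝕜] H) :
    StrongCont (riccatiRhs S Q P) :=
  (StrongCont.const Q).sub (hP.comp ((StrongCont.const S).comp hP))

theorem norm_riccatiRhs_le {P : ℝ → H →L[𝕜] H} {r K : ℝ} (h : ‖P r‖ ≤ K) :
    ‖riccatiRhs S Q P r‖ ≤ ‖Q‖ + K ^ 2 * ‖S‖ := by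
  have hK := (norm_nonneg _).trans h
  refine (norm_sub_le _ _).trans ?_
  have : ‖P r ∘L S ∘L P r‖ ≤ K * (‖S‖ * K) :=
    ((P r).opNorm_comp_le _).trans (by gcongr; exact (S.opNorm_comp_le _).trans (by gcongr))
  linarith

theorem norm_riccatiRhs_sub_le {P P' : ℝ → H →L[𝕜] H} {r K ε : ℝ} (h : ‖P r‖ ≤ K)
    (h' : ‖P' r‖ ≤ K) (hε : ‖P r - P' r‖ ≤ ε) :
    ‖riccatiRhs S Q P r - riccatiRhs S Q P' r‖ ≤ 2 * K * ‖S‖ * ε := by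
  rw [riccatiRhs, riccatiRhs, sub_sub_sub_cancel_left, norm_sub_rev]
  exact norm_conj_sub_conj_le h h' hε

/-- `P` is a self-adjoint mild solution on `[c, tf]` of the Riccati equation
`P' + L* P + P L - P S P + Q = 0`, `P(tf) = G`. -/
structure IsRiccatiFlow (T : ℝ → H →L[𝕜] H) (S Q G : H →L[𝕜] H) (c tf : ℝ)
    (P : ℝ → H →L[𝕜] H) : Prop where
  strongCont : StrongCont P
  selfAdjoint : ∀ t, IsSelfAdjoint (P t)
  mild : ∀ t ∈ Icc c tf, IsMildLyapunov T P (riccatiRhs S Q P) t tf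
  final : P tf = G

variable [NormedSpace ℝ H] [IsScalarTower ℝ 𝕜 H]

theorem IsRiccatiFlow.mild_of_le {c : ℝ} {P : ℝ → H →L[𝕜] H} (hT : IsHalfLineSemigroup T)
    (h : IsRiccatiFlow T S Q G c tf P) {t s : ℝ} (hct : c ≤ t) (hts : t ≤ s) (hs : s ≤ tf) :
    IsMildLyapunov T P (riccatiRhs S Q P) t s :=
  isMildLyapunov_of_final hT (h.strongCont.riccatiRhs S Q) hts hs
    (h.mild t ⟨hct, hts.trans hs⟩) (h.mild s ⟨hct.trans hts, hs⟩)

/-- Strongly continuous families of self-adjoint operators. -/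
def SelfAdjointFamily (𝕜 H : Type*) [RCLike 𝕜] [NormedAddCommGroup H] [InnerProductSpace 𝕜 H]
    [CompleteSpace H] : Type _ :=
  {P : ℝ → H →L[𝕜] H // StrongCont P ∧ ∀ t, IsSelfAdjoint (P t)}

theorem isSelfAdjoint_sandwich {A : H →L[𝕜] H} (hA : IsSelfAdjoint A) (L : H →L[𝕜] H) :
    IsSelfAdjoint (L† ∘L A ∘L L) := hA.adjoint_conj L

theorem isSelfAdjoint_riccatiRhs (hS : IsSelfAdjoint S) (hQ : IsSelfAdjoint Q)
    {P : ℝ → H →L[𝕜] H} {r : ℝ} (hP : IsSelfAdjoint (P r)) :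
    IsSelfAdjoint (riccatiRhs S Q P r) := by
  have := isSelfAdjoint_sandwich hS (P r)
  rw [hP.adjoint_eq] at this
  exact hQ.sub this

theorem isSelfAdjoint_strongInt {W : ℝ → H →L[𝕜] H} (hW : StrongCont W)
    (hs : ∀ r, IsSelfAdjoint (W r)) {a b : ℝ} : IsSelfAdjoint (strongInt W hW a b) := by
  wlog hab : a ≤ b generalizing a b
  · have h : strongInt W hW a b = -strongInt W hW b a := by
      ext x
      rw [_root_.neg_apply, strongInt_apply, strongInt_apply, intervalIntegral.integral_symm]
    rw [h]
    exact (this (le_of_not_ge hab)).neg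
  rw [ContinuousLinearMap.isSelfAdjoint_iff_isSymmetric]
  intro x y
  change inner 𝕜 (strongInt W hW a b x) y = inner 𝕜 x (strongInt W hW a b y)
  rw [inner_strongInt hW hab, ← inner_conj_symm, inner_strongInt hW hab,
    intervalIntegral.integral_of_le hab, intervalIntegral.integral_of_le hab, ← integral_conj]
  refine integral_congr_ae (Eventually.of_forall fun r => ?_)
  simp only [inner_conj_symm]
  exact (hs r).inner_left x y

/-- The fixed point map of the mild Riccati equation. -/
noncomputable def riccatiMap (hT : IsHalfLineSemigroup T) (hS : IsSelfAdjoint S)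
    (hQ : IsSelfAdjoint Q) (hG : IsSelfAdjoint G) (tf : ℝ) (P : SelfAdjointFamily 𝕜 H) :
    SelfAdjointFamily 𝕜 H :=
  ⟨fun t => (T (tf - t))† ∘L G ∘L T (tf - t) +
      strongInt _ (hT.strongCont_sandwich (P.2.1.riccatiRhs S Q) t) t tf, by
    constructor
    · have hc : Continuous fun t : ℝ => tf - t := by fun_prop
      refine StrongCont.add ?_ fun x => ?_
      · exact (hT.adjoint.strongCont.comp_continuous hc).comp
          ((StrongCont.const G).comp (hT.strongCont.comp_continuous hc))
      · refine continuous_integral_triangle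
          (f := fun t r => ((T (r - t))†) (riccatiRhs S Q P.1 r (T (r - t) x))) ?_ tf
        have h1 : Continuous fun p : ℝ × ℝ => p.2 - p.1 := by fun_prop
        exact hT.adjoint.strongCont.continuous_apply h1
          ((P.2.1.riccatiRhs S Q).continuous_apply continuous_snd
            (hT.strongCont.continuous_apply h1 continuous_const))
    · intro t
      exact (isSelfAdjoint_sandwich hG _).add (isSelfAdjoint_strongInt _ fun r =>
        isSelfAdjoint_sandwich (isSelfAdjoint_riccatiRhs hS hQ (P.2.2 r)) _)⟩

variable {hT : IsHalfLineSemigroup T} {hS : IsSelfAdjoint S} {hQ : IsSelfAdjoint Q}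
  {hG : IsSelfAdjoint G}

theorem riccatiMap_final (P : SelfAdjointFamily 𝕜 H) :
    (riccatiMap hT hS hQ hG tf P).1 tf = G := by
  ext x
  simp [riccatiMap, hT.zero, strongInt_apply, ContinuousLinearMap.adjoint_id]

/-- The inhomogeneity is formed with the old family and the solution is the new one, so fixed points
are the solutions of the Riccati equation. -/
theorem riccatiMap_mild (P : SelfAdjointFamily 𝕜 H) {t : ℝ} (ht : t ≤ tf) :
    IsMildLyapunov T (riccatiMap hT hS hQ hG tf P).1 (riccatiRhs S Q P.1) t tf := by
  rw [isMildLyapunov_iff hT (P.2.1.riccatiRhs S Q) ht, riccatiMap_final]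
  rfl

theorem riccatiMap_mild_of_le (P : SelfAdjointFamily 𝕜 H) {t s : ℝ} (hts : t ≤ s) (hs : s ≤ tf) :
    IsMildLyapunov T (riccatiMap hT hS hQ hG tf P).1 (riccatiRhs S Q P.1) t s :=
  isMildLyapunov_of_final hT (P.2.1.riccatiRhs S Q) hts hs (riccatiMap_mild P (hts.trans hs))
    (riccatiMap_mild P hs)

/-- The map at time `t` sees only the times in `[t, tf]`, so a solution already known near `tf` is
left unchanged by the iteration. -/
theorem riccatiMap_eq_of_mild (P : SelfAdjointFamily 𝕜 H) {P' : ℝ → H →L[𝕜] H} {t : ℝ}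
    (ht : t ≤ tf) (h : IsMildLyapunov T P' (riccatiRhs S Q P') t tf) (hf : P' tf = G)
    (heq : ∀ r ∈ Icc t tf, P.1 r = P' r) : (riccatiMap hT hS hQ hG tf P).1 t = P' t := by
  ext x
  refine ext_inner_left 𝕜 fun y => ?_
  rw [riccatiMap_mild P ht, h, riccatiMap_final, hf]
  congr 1
  refine intervalIntegral.integral_congr fun r hr => ?_
  rw [uIcc_of_le ht] at hr
  simp only [riccatiRhs, heq r hr]

theorem norm_riccatiMap_sub_le {p q : SelfAdjointFamily 𝕜 H} {t s K ε b : ℝ} (hts : t ≤ s)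
    (hs : s ≤ tf) (hb : ∀ r ≤ s - t, ‖T r‖ ≤ b) (hp : ∀ r ∈ Icc t s, ‖p.1 r‖ ≤ K)
    (hq : ∀ r ∈ Icc t s, ‖q.1 r‖ ≤ K) (hpq : ∀ r ∈ Icc t s, ‖p.1 r - q.1 r‖ ≤ ε) :
    ‖(riccatiMap hT hS hQ hG tf p).1 t - (riccatiMap hT hS hQ hG tf q).1 t‖ ≤
      b ^ 2 * (‖(riccatiMap hT hS hQ hG tf p).1 s - (riccatiMap hT hS hQ hG tf q).1 s‖ +
        2 * K * ‖S‖ * ε * (s - t)) :=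
  IsMildLyapunov.norm_le (m := 2 * K * ‖S‖ * ε)
    (P := fun r => (riccatiMap hT hS hQ hG tf p).1 r - (riccatiMap hT hS hQ hG tf q).1 r) hts
    ((riccatiMap_mild_of_le p hts hs).sub hT (p.2.1.riccatiRhs S Q) (q.2.1.riccatiRhs S Q)
      (riccatiMap_mild_of_le q hts hs)) hb fun r hr =>
      norm_riccatiRhs_sub_le (hp r hr) (hq r hr) (hpq r hr)

/-- A solution of the mild Riccati equation on `[c, tf]` extends to the left, by a time that only
depends on a bound for it. -/
theorem IsRiccatiFlow.exists_extension (hT : IsHalfLineSemigroup T) (hS : IsSelfAdjoint S)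
    (hQ : IsSelfAdjoint Q) (hG : IsSelfAdjoint G) {P : ℝ → H →L[𝕜] H} {c c' b K₀ K : ℝ}
    (h : IsRiccatiFlow T S Q G c tf P) (hc : c ≤ tf) (hc' : c' ≤ c)
    (hb1 : 1 ≤ b) (hb : ∀ t ≤ tf - c', ‖T t‖ ≤ b) (hK₀ : ∀ t ∈ Icc c tf, ‖P t‖ ≤ K₀)
    (hK : K = b ^ 2 * K₀ + 1) (h1 : b ^ 2 * ((‖Q‖ + K ^ 2 * ‖S‖) * (c - c')) ≤ 1)
    (h2 : b ^ 2 * (2 * K * ‖S‖ * (c - c')) ≤ 1 / 2) :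
    ∃ P', IsRiccatiFlow T S Q G c' tf P' := by
  have hK₀0 : 0 ≤ K₀ := (norm_nonneg _).trans (hK₀ c ⟨le_rfl, hc⟩)
  have hb2 : 1 ≤ b ^ 2 := one_le_pow₀ hb1
  have hK0 : 0 ≤ K := by rw [hK]; positivity
  have hK₀K : K₀ ≤ K := by rw [hK]; nlinarith
  set F := riccatiMap hT hS hQ hG tf with hF
  have hcl : Continuous fun t => max c (min t tf) := by fun_prop
  -- The iteration starts from `P` frozen at its value at `c`. All iterates agree with `P` on `[c,
  -- tf]`, and only `[c', c]` has to be estimated.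
  let p₀ : SelfAdjointFamily 𝕜 H :=
    ⟨fun t => P (max c (min t tf)), h.strongCont.comp_continuous hcl, fun t => h.selfAdjoint _⟩
  let p : ℕ → SelfAdjointFamily 𝕜 H := fun n => F^[n] p₀
  have hp_succ : ∀ n, p (n + 1) = F (p n) := fun n => Function.iterate_succ_apply' F n p₀
  have hpc : ∀ n, ∀ t ∈ Icc c tf, (p n).1 t = P t := by
    intro n
    induction n with
    | zero =>
      intro t ht
      change P (max c (min t tf)) = P t
      rw [min_eq_left ht.2, max_eq_right ht.1]
    | succ n ih =>
      intro t ht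
      rw [hp_succ]
      exact riccatiMap_eq_of_mild _ ht.2 (h.mild t ht) h.final
        fun r hr => ih r ⟨ht.1.trans hr.1, hr.2⟩
  -- Going back from time `c`, where the norm is at most `K₀`, the homogeneous part gives `b² K₀`,
  -- and by `h1` the inhomogeneity adds at most `1`. This is the reason for the choice of `K`.
  have hbound : ∀ n, ∀ t ∈ Icc c' tf, ‖(p n).1 t‖ ≤ K := by
    intro n
    induction n with
    | zero =>
      intro t ht
      exact (hK₀ _ ⟨le_max_left _ _, max_le hc (min_le_right _ _)⟩).trans hK₀K
    | succ n ih =>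
      intro t ht
      rcases le_total c t with hct | htc
      · rw [hpc _ t ⟨hct, ht.2⟩]
        exact (hK₀ t ⟨hct, ht.2⟩).trans hK₀K
      · have := (riccatiMap_mild_of_le (hT := hT) (hS := hS) (hQ := hQ) (hG := hG) (p n) htc
          hc).norm_le htc (fun r hr => hb r (by linarith [ht.1]))
          (fun r hr => norm_riccatiRhs_le (ih r ⟨ht.1.trans hr.1, hr.2.trans hc⟩))
        rw [← hF, ← hp_succ, hpc _ c ⟨le_rfl, hc⟩] at this
        have h3 := hK₀ c ⟨le_rfl, hc⟩
        have h4 : (‖Q‖ + K ^ 2 * ‖S‖) * (c - t) ≤ (‖Q‖ + K ^ 2 * ‖S‖) * (c - c') := by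
          gcongr; exact ht.1
        refine this.trans ?_
        rw [hK] at *
        nlinarith
  -- The initial gap `2 K` is the sum of two norm bounds, and `h2` makes each further step a
  -- contraction by `1 / 2`.
  have hdiff : ∀ n, ∀ t ∈ Icc c' tf, ‖(p n).1 t - (p (n + 1)).1 t‖ ≤ 2 * K * (1 / 2) ^ n := by
    intro n
    induction n with
    | zero =>
      intro t ht
      refine (norm_sub_le _ _).trans ?_
      linarith [hbound 0 t ht, hbound 1 t ht]
    | succ n ih =>
      intro t ht
      rcases le_total c t with hct | htc
      · rw [hpc _ t ⟨hct, ht.2⟩, hpc _ t ⟨hct, ht.2⟩, sub_self, norm_zero]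
        positivity
      · have := norm_riccatiMap_sub_le (hT := hT) (hS := hS) (hQ := hQ) (hG := hG)
          (p := p n) (q := p (n + 1)) htc hc
          (fun r hr => hb r (by linarith [ht.1]))
          (fun r hr => hbound n r ⟨ht.1.trans hr.1, hr.2.trans hc⟩)
          (fun r hr => hbound (n + 1) r ⟨ht.1.trans hr.1, hr.2.trans hc⟩)
          (fun r hr => ih r ⟨ht.1.trans hr.1, hr.2.trans hc⟩)
        rw [← hF, ← hp_succ, ← hp_succ, hpc _ c ⟨le_rfl, hc⟩, hpc _ c ⟨le_rfl, hc⟩, sub_self,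
          norm_zero, zero_add] at this
        refine this.trans ?_
        have h4 : b ^ 2 * (2 * K * ‖S‖ * (c - t)) ≤ 1 / 2 := by
          refine le_trans ?_ h2; gcongr; exact ht.1
        calc _ = (b ^ 2 * (2 * K * ‖S‖ * (c - t))) * (2 * K * (1 / 2) ^ n) := by ring
          _ ≤ (1 / 2) * (2 * K * (1 / 2) ^ n) := by gcongr
          _ = _ := by rw [pow_succ]; ring
  set cl : ℝ → ℝ := fun t => max c' (min t tf) with hcldef
  have hcltf : ∀ t, cl t ∈ Icc c' tf := fun t =>
    ⟨le_max_left _ _, max_le (hc'.trans hc) (min_le_right _ _)⟩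
  have hcl' : ∀ t ∈ Icc c' tf, cl t = t := fun t ht => by
    simp only [hcldef]; rw [min_eq_left ht.2, max_eq_right ht.1]
  have hclc : Continuous cl := by fun_prop
  have hlim : ∀ t, ∃ L, Tendsto (fun n => (p n).1 (cl t)) atTop (𝓝 L) := fun t =>
    cauchySeq_tendsto_of_complete (cauchySeq_of_le_geometric (1 / 2) (2 * K) (by norm_num)
      fun n => by rw [dist_eq_norm]; exact hdiff n _ (hcltf t))
  choose P' hP' using hlim
  have herr : ∀ n t, ‖(p n).1 (cl t) - P' t‖ ≤ 4 * K * (1 / 2) ^ n := by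
    intro n t
    have := dist_le_of_le_geometric_of_tendsto (1 / 2) (2 * K) (by norm_num)
      (fun n => by rw [dist_eq_norm]; exact hdiff n _ (hcltf t)) (hP' t) n
    rw [dist_eq_norm] at this
    refine this.trans_eq (by ring)
  have herr0 : ∀ C : ℝ, Tendsto (fun n : ℕ => C * (1 / 2 : ℝ) ^ n) atTop (𝓝 0) := fun C => by
    simpa using (tendsto_pow_atTop_nhds_zero_of_lt_one (by norm_num : (0:ℝ) ≤ 1 / 2)
      (by norm_num)).const_mul C
  have hP'c : StrongCont P' := by
    intro x
    have hu : TendstoUniformly (fun (n : ℕ) t => (p n).1 (cl t) x) (fun t => P' t x) atTop := by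
      rw [Metric.tendstoUniformly_iff]
      intro ε hε
      filter_upwards [(herr0 (4 * K * ‖x‖)).eventually_lt_const hε] with n hn t
      rw [dist_eq_norm, norm_sub_rev, ← _root_.sub_apply]
      refine lt_of_le_of_lt (ContinuousLinearMap.le_of_opNorm_le _ (herr n t) x) ?_
      linarith
    exact hu.continuous (Frequently.of_forall fun n => ((p n).2.1 x).comp hclc)
  have hP's : ∀ t, IsSelfAdjoint (P' t) := fun t =>
    tendsto_nhds_unique ((hP' t).star.congr fun n => (p n).2.2 _) (hP' t)
  let p' : SelfAdjointFamily 𝕜 H := ⟨P', hP'c, hP's⟩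
  have hP'b : ∀ t, ‖P' t‖ ≤ K := fun t =>
    le_of_tendsto (hP' t).norm (Eventually.of_forall fun n => hbound n _ (hcltf t))
  have hfix : ∀ t ∈ Icc c' tf, (F p').1 t = P' t := by
    intro t ht
    have hl := hP' t
    rw [hcl' t ht] at hl
    have hl1 := hl.comp (tendsto_add_atTop_nat 1)
    refine tendsto_nhds_unique ?_ hl1
    rw [tendsto_iff_norm_sub_tendsto_zero]
    have hz := herr0 (b ^ 2 * (2 * K * ‖S‖ * (4 * K) * (tf - t)))
    refine squeeze_zero (fun _ => norm_nonneg _) (fun n => ?_) hz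
    -- Here the comparison runs from `tf`, where all images equal `G`. The errors `4 K (1 / 2) ^ n`
    -- already tend to `0` uniformly, so no smallness of the interval is required.
    have := norm_riccatiMap_sub_le (hT := hT) (hS := hS) (hQ := hQ) (hG := hG)
      (p := p n) (q := p') ht.2 le_rfl (fun r hr => hb r (by linarith [ht.1]))
      (fun r hr => hbound n r ⟨ht.1.trans hr.1, hr.2⟩) (fun r hr => hP'b r)
      (ε := 4 * K * (1 / 2) ^ n)
      (fun r hr => by
        have := herr n r
        rwa [hcl' r ⟨ht.1.trans hr.1, hr.2⟩] at this)
    rw [riccatiMap_final, riccatiMap_final, sub_self, norm_zero, zero_add, ← hF, ← hp_succ] at this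
    exact this.trans_eq (by ring)
  refine ⟨P', hP'c, hP's, fun t ht => ?_, ?_⟩
  · have := riccatiMap_mild (hT := hT) (hS := hS) (hQ := hQ) (hG := hG) p' ht.2
    intro y x
    have h3 := this y x
    rw [← hF, hfix t ht, hfix tf ⟨hc'.trans hc, le_rfl⟩] at h3
    exact h3
  · rw [← hfix tf ⟨hc'.trans hc, le_rfl⟩]
    exact riccatiMap_final _

end Riccati

/-! ### A priori bounds, global existence and uniqueness for the Riccati equation. -/

section RiccatiGlobal

variable {𝕜 H : Type*} [RCLike 𝕜] [NormedAddCommGroup H] [InnerProductSpace 𝕜 H]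
  [CompleteSpace H] [NormedSpace ℝ H] [IsScalarTower ℝ 𝕜 H]
  {T : ℝ → H →L[𝕜] H} {S Q G : H →L[𝕜] H} {tf : ℝ}

theorem re_intervalIntegral {f : ℝ → 𝕜} (hf : Continuous f) (a b : ℝ) :
    RCLike.re (∫ s in a..b, f s) = ∫ s in a..b, RCLike.re (f s) :=
  ((RCLike.reCLM (K := 𝕜)).intervalIntegral_comp_comm (hf.intervalIntegrable a b)).symm

theorem hasForcing_of_eq_mildState (hT : IsHalfLineSemigroup T) {x f : ℝ → H} {t b : ℝ} {a : H}
    (hf : Continuous f) (hx : ∀ s ∈ Icc t b, x s = mildState T t a f s) {s : ℝ}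
    (hs : s ∈ Ioo t b) : HasForcing T x (f s) s := by
  refine (hasForcing_mildState hT hs.1.le a hf).congr' ?_
  filter_upwards [Ioo_mem_nhdsGT (sub_pos.2 hs.2)] with h hh
  rw [hx s ⟨hs.1.le, hs.2.le⟩, hx (s + h) ⟨by linarith [hs.1, hh.1], by linarith [hh.2]⟩]

theorem exists_hasForcing_feedback (hT : IsHalfLineSemigroup T) {C : ℝ → H →L[𝕜] H}
    (hC : StrongCont C) {t b : ℝ} (htb : t ≤ b) (a : H) : ∃ x : ℝ → H, Continuous x ∧
      x t = a ∧ ∀ s ∈ Ioo t b, HasForcing T x (C s (x s)) s := by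
  obtain ⟨x, hx, hxe⟩ := exists_mildState_feedback hT hC htb a
  exact ⟨x, hx, by rw [hxe t ⟨le_rfl, htb⟩, mildState_self hT],
    fun s hs => hasForcing_of_eq_mildState hT (hC.continuous_apply continuous_id hx) hxe hs⟩

/-- Along the closed loop `x' = L x - S P x`, `x(t) = a`, the form `⟨x, P x⟩` decreases at the rate
`⟨x, Q x⟩ + ⟨P x, S P x⟩` and ends at `⟨x, G x⟩`; all of these have non-negative real part. -/
theorem IsRiccatiFlow.re_inner_nonneg (hT : IsHalfLineSemigroup T) (hS : S.IsPositive)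
    (hQ : Q.IsPositive) (hG : G.IsPositive) {P : ℝ → H →L[𝕜] H} {c : ℝ}
    (h : IsRiccatiFlow T S Q G c tf P) {t : ℝ} (ht : t ∈ Icc c tf) (a : H) :
    0 ≤ RCLike.re (inner 𝕜 a (P t a)) := by
  have hC : StrongCont fun r => -(S ∘L P r) := fun z => (S.continuous.comp (h.strongCont z)).neg
  obtain ⟨x, hx, hxt, hxf⟩ := exists_hasForcing_feedback hT hC ht.2 a
  have hf : Continuous fun r => (-(S ∘L P r)) (x r) := hC.continuous_apply continuous_id hx
  have key := inner_sub_eq_integral hT h.strongCont (h.strongCont.riccatiRhs S Q) hx hx hf hf ht.2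
    hxf hxf fun s hs s' hs' => h.mild_of_le hT (ht.1.trans hs.1) hs'.1 hs'.2
  have hPx : Continuous fun r => P r (x r) := h.strongCont.continuous_apply continuous_id hx
  have e : ∀ s, -inner 𝕜 (x s) (riccatiRhs S Q P s (x s)) +
      inner 𝕜 ((-(S ∘L P s)) (x s)) (P s (x s)) + inner 𝕜 (x s) (P s ((-(S ∘L P s)) (x s))) =
      -(inner 𝕜 (x s) (Q (x s)) + inner 𝕜 (P s (x s)) (S (P s (x s)))) := by
    intro s
    simp only [riccatiRhs, _root_.sub_apply, _root_.neg_apply, ContinuousLinearMap.comp_apply,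
      inner_sub_right, inner_neg_left, inner_neg_right, map_neg]
    rw [hS.isSelfAdjoint.inner_left, ← (h.selfAdjoint s).inner_left (x s) (S _)]
    ring
  simp only [e] at key
  rw [intervalIntegral.integral_neg, h.final, hxt] at key
  have hre := congrArg RCLike.re key
  have hcont : Continuous fun s =>
      inner 𝕜 (x s) (Q (x s)) + inner 𝕜 (P s (x s)) (S (P s (x s))) :=
    (hx.inner (Q.continuous.comp hx)).add (hPx.inner (S.continuous.comp hPx))
  rw [map_neg, map_sub, re_intervalIntegral hcont] at hre
  have h1 : 0 ≤ ∫ s in t..tf, RCLike.re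
      (inner 𝕜 (x s) (Q (x s)) + inner 𝕜 (P s (x s)) (S (P s (x s)))) := by
    refine intervalIntegral.integral_nonneg ht.2 fun s _ => ?_
    rw [map_add]
    exact add_nonneg (hQ.re_inner_nonneg_right _) (hS.re_inner_nonneg_right _)
  have h2 := hG.re_inner_nonneg_right (x tf)
  linarith

/-- Dropping the non-negative form of `P S P` from the mild equation leaves the cost of the
uncontrolled trajectory, which is bounded independently of `P`. -/
theorem IsRiccatiFlow.re_inner_le (hT : IsHalfLineSemigroup T) (hS : S.IsPositive)
    {P : ℝ → H →L[𝕜] H} {c : ℝ} (h : IsRiccatiFlow T S Q G c tf P) {t b : ℝ}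
    (ht : t ∈ Icc c tf) (hb : ∀ s ≤ tf - c, ‖T s‖ ≤ b) (a : H) :
    RCLike.re (inner 𝕜 a (P t a)) ≤ b ^ 2 * (‖G‖ + ‖Q‖ * (tf - c)) * ‖a‖ ^ 2 := by
  have hc : Continuous fun r => T (r - t) a :=
    hT.strongCont.comp_continuous (τ := fun r => r - t) (by fun_prop) a
  have hb' : ∀ s ≤ tf, ‖T (s - t)‖ ≤ b := fun s hs => hb _ (by linarith [ht.1])
  have hb0 : 0 ≤ b := (norm_nonneg _).trans (hb 0 (by linarith [ht.1, ht.2]))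
  have hcont : Continuous fun r => inner 𝕜 (T (r - t) a) (riccatiRhs S Q P r (T (r - t) a)) :=
    hc.inner ((h.strongCont.riccatiRhs S Q).continuous_apply continuous_id hc)
  rw [h.mild t ht, map_add, h.final, re_intervalIntegral hcont]
  have h1 : RCLike.re (inner 𝕜 (T (tf - t) a) (G (T (tf - t) a))) ≤ b ^ 2 * ‖G‖ * (‖a‖ * ‖a‖) :=
    (RCLike.re_le_norm _).trans
      (norm_inner_apply_le le_rfl (hb' tf le_rfl) (hb' tf le_rfl) a a)
  have h2 : ∫ r in t..tf, RCLike.re (inner 𝕜 (T (r - t) a) (riccatiRhs S Q P r (T (r - t) a))) ≤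
      ∫ r in t..tf, b ^ 2 * ‖Q‖ * (‖a‖ * ‖a‖) := by
    refine intervalIntegral.integral_mono_on ht.2 ?_ (continuous_const.intervalIntegrable _ _) ?_
    · exact (RCLike.continuous_re.comp hcont).intervalIntegrable _ _
    · intro r hr
      have h3 : RCLike.re (inner 𝕜 (T (r - t) a) (Q (T (r - t) a))) ≤
          b ^ 2 * ‖Q‖ * (‖a‖ * ‖a‖) :=
        (RCLike.re_le_norm _).trans
          (norm_inner_apply_le le_rfl (hb' r hr.2) (hb' r hr.2) a a)
      have h4 := hS.re_inner_nonneg_right (P r (T (r - t) a))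
      simp only [riccatiRhs, _root_.sub_apply, ContinuousLinearMap.comp_apply, inner_sub_right,
        map_sub]
      rw [← (h.selfAdjoint r).inner_left _ (S _)]
      linarith
  rw [intervalIntegral.integral_const, smul_eq_mul] at h2
  have h5 : (tf - t) * (b ^ 2 * ‖Q‖ * (‖a‖ * ‖a‖)) ≤ (tf - c) * (b ^ 2 * ‖Q‖ * (‖a‖ * ‖a‖)) := by
    gcongr; exact ht.1
  nlinarith

/-- The mild Riccati equation with non-negative coefficients has a global solution. -/
theorem exists_isRiccatiFlow (hT : IsHalfLineSemigroup T) (hS : S.IsPositive)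
    (hQ : Q.IsPositive) (hG : G.IsPositive) (htf : 0 ≤ tf) :
    ∃ P, IsRiccatiFlow T S Q G 0 tf P := by
  obtain ⟨b, hb1, hb⟩ := hT.exists_bound tf
  have hb0 : 0 ≤ b := zero_le_one.trans hb1
  set K₀ := b ^ 2 * (‖G‖ + ‖Q‖ * tf) with hK₀
  have hK₀0 : 0 ≤ K₀ := by positivity
  set K := b ^ 2 * K₀ + 1 with hK
  have hK0 : 0 ≤ K := by positivity
  -- A step of length `D⁻¹` meets both smallness conditions of `exists_extension`. Since `K₀` is an
  -- a priori bound on all of `[0, tf]`, the same step works at every stage, and finitely many steps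
  -- reach time `0`.
  set D := b ^ 2 * (‖Q‖ + K ^ 2 * ‖S‖) + 4 * (b ^ 2 * (K * ‖S‖)) + 1 with hD
  have hD0 : 0 < D := by positivity
  have hD1 : b ^ 2 * (‖Q‖ + K ^ 2 * ‖S‖) ≤ D := by
    have : 0 ≤ 4 * (b ^ 2 * (K * ‖S‖)) := by positivity
    linarith
  have hD2 : 4 * (b ^ 2 * (K * ‖S‖)) ≤ D := by
    have : 0 ≤ b ^ 2 * (‖Q‖ + K ^ 2 * ‖S‖) := by positivity
    linarith
  have step : ∀ n : ℕ, ∃ P, IsRiccatiFlow T S Q G (max 0 (tf - n * D⁻¹)) tf P := by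
    intro n
    induction n with
    | zero =>
      refine ⟨fun _ => G, StrongCont.const G, fun _ => hG.isSelfAdjoint, fun t ht => ?_, rfl⟩
      have : t = tf := by
        have := ht.1
        simp only [Nat.cast_zero, zero_mul, sub_zero, max_eq_right htf] at this
        exact le_antisymm ht.2 this
      intro y x
      simp [this, hT.zero]
    | succ n ih =>
      obtain ⟨P, hP⟩ := ih
      have hDi : 0 ≤ D⁻¹ := (inv_pos.2 hD0).le
      set c := max 0 (tf - n * D⁻¹) with hc
      set c' := max 0 (tf - (n + 1 : ℕ) * D⁻¹) with hc'
      have hctf : c ≤ tf := max_le htf (by linarith [mul_nonneg (Nat.cast_nonneg (α := ℝ) n) hDi])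
      have hcc' : c' ≤ c := by
        refine max_le_max_left _ ?_
        push_cast; linarith
      have hsub : c - c' ≤ D⁻¹ := by
        have h1 : tf - n * D⁻¹ ≤ c' + D⁻¹ := by
          have : tf - (n + 1 : ℕ) * D⁻¹ ≤ c' := le_max_right _ _
          push_cast at this
          linarith
        have h2 : 0 ≤ c' + D⁻¹ := add_nonneg (le_max_left _ _) hDi
        linarith [max_le h2 h1]
      have hc0 : 0 ≤ c := le_max_left _ _
      have hc'0 : 0 ≤ c' := le_max_left _ _
      refine hP.exists_extension hT hS.isSelfAdjoint hQ.isSelfAdjoint hG.isSelfAdjoint hctf hcc'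
        hb1 (fun t ht => hb t (by linarith)) (K₀ := K₀) (fun t ht => ?_) hK ?_ ?_
      · refine (hP.selfAdjoint t).norm_le_of_quadratic_form hK₀0
          (fun x => hP.re_inner_nonneg hT hS hQ hG ht x) fun x => ?_
        refine (hP.re_inner_le hT hS ht (fun s hs => hb s (by linarith)) x).trans ?_
        rw [hK₀]
        gcongr
        linarith
      · calc _ = b ^ 2 * (‖Q‖ + K ^ 2 * ‖S‖) * (c - c') := by ring
          _ ≤ D * D⁻¹ := mul_le_mul hD1 hsub (sub_nonneg.2 hcc') hD0.le
          _ = 1 := mul_inv_cancel₀ hD0.ne'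
      · calc _ = 1 / 2 * (4 * (b ^ 2 * (K * ‖S‖)) * (c - c')) := by ring
          _ ≤ 1 / 2 * (D * D⁻¹) := by
            gcongr
          _ = 1 / 2 := by rw [mul_inv_cancel₀ hD0.ne', mul_one]
  obtain ⟨n, hn⟩ := exists_nat_ge (tf * D)
  obtain ⟨P, hP⟩ := step n
  have : tf ≤ n * D⁻¹ := by
    rw [← div_eq_mul_inv]
    exact (le_div_iff₀ hD0).2 hn
  rw [max_eq_left (by linarith)] at hP
  exact ⟨P, hP⟩

/-- Uniqueness for the mild Riccati equation among all strongly continuous families. -/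
theorem IsRiccatiFlow.eq_of_mild (hT : IsHalfLineSemigroup T) (hS : IsSelfAdjoint S)
    {P P' : ℝ → H →L[𝕜] H} {c : ℝ} (h : IsRiccatiFlow T S Q G c tf P) (hP' : StrongCont P')
    (hm : ∀ t ∈ Icc c tf, IsMildLyapunov T P' (riccatiRhs S Q P') t tf) (hf : P' tf = G) :
    ∀ t ∈ Icc c tf, P' t = P t := by
  intro t ht
  ext a
  refine ext_inner_left 𝕜 fun b => ?_
  have hP := h.strongCont
  have hC : ∀ {W : ℝ → H →L[𝕜] H}, StrongCont W → StrongCont fun r => -(S ∘L W r) :=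
    fun hW z => (S.continuous.comp (hW z)).neg
  -- With `x` driven by the feedback of `P'` and `y` by that of `P`, the derivative of `⟨y, (P - P')
  -- x⟩` vanishes identically. Only the self-adjointness of `S` and `P` is used, so `P'` may be an
  -- arbitrary strongly continuous solution.
  obtain ⟨x, hx, hxt, hxf⟩ := exists_hasForcing_feedback hT (hC hP') ht.2 a
  obtain ⟨y, hy, hyt, hyf⟩ := exists_hasForcing_feedback hT (hC hP) ht.2 b
  have hM := hP.riccatiRhs S Q
  have hM' := hP'.riccatiRhs S Q
  have key := inner_sub_eq_integral hT (hP.sub hP') (hM.sub hM') hx hy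
    ((hC hP').continuous_apply continuous_id hx) ((hC hP).continuous_apply continuous_id hy) ht.2
    hxf hyf fun s hs s' hs' => (h.mild_of_le hT (ht.1.trans hs.1) hs'.1 hs'.2).sub hT hM hM'
      (isMildLyapunov_of_final hT hM' hs'.1 hs'.2 (hm s ⟨ht.1.trans hs.1, hs.2⟩)
        (hm s' ⟨ht.1.trans (hs.1.trans hs'.1), hs'.2⟩))
  have e : ∀ s, -inner 𝕜 (y s) ((riccatiRhs S Q P s - riccatiRhs S Q P' s) (x s)) +
      inner 𝕜 ((-(S ∘L P s)) (y s)) ((P s - P' s) (x s)) +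
      inner 𝕜 (y s) ((P s - P' s) ((-(S ∘L P' s)) (x s))) = 0 := by
    intro s
    simp only [riccatiRhs, _root_.sub_apply, _root_.neg_apply, ContinuousLinearMap.comp_apply,
      inner_sub_right, inner_neg_left, inner_neg_right, map_neg]
    rw [hS.inner_left, hS.inner_left, (h.selfAdjoint s).inner_left, (h.selfAdjoint s).inner_left]
    ring
  simp only [id_eq] at key
  simp only [e] at key
  rw [intervalIntegral.integral_zero, h.final, hf, hxt, hyt] at key
  simp only [_root_.sub_apply, sub_self, inner_sub_right, _root_.zero_apply, inner_zero_right] at key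
  linear_combination -key

end RiccatiGlobal

/-! ### The linear-quadratic regulator: completion of the square and optimal feedback. -/

/-- A linear-quadratic regulator `x' = L x + B u` on `[0, tf]`, where `L` generates `T`, with
bounded weights `Q`, `G` on the state and a coercive weight `R`, with inverse `Ri`, on the
control. -/
structure Regulator (𝕜 H U : Type*) [RCLike 𝕜] [NormedAddCommGroup H] [InnerProductSpace 𝕜 H]
    [CompleteSpace H] [NormedAddCommGroup U] [InnerProductSpace 𝕜 U] [CompleteSpace U] where
  T : ℝ → H →L[𝕜] H
  semigroup : IsHalfLineSemigroup T
  B : U →L[𝕜] H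
  Q : H →L[𝕜] H
  G : H →L[𝕜] H
  R : U →L[𝕜] U
  Ri : U →L[𝕜] U
  tf : ℝ
  tf_nonneg : 0 ≤ tf
  Q_pos : Q.IsPositive
  G_pos : G.IsPositive
  R_selfAdjoint : IsSelfAdjoint R
  R_coercive : ∃ ε : ℝ, 0 < ε ∧ ∀ u : U, ε * ‖u‖ ^ 2 ≤ RCLike.re (inner 𝕜 u (R u))
  R_Ri : ∀ u, R (Ri u) = u
  Ri_R : ∀ u, Ri (R u) = u

/-- This is the Lax–Milgram argument; it guarantees that `R.inverse` is the true inverse and not the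
default value for a non-invertible operator. -/
theorem exists_inverse_of_coercive {𝕜 U : Type*} [RCLike 𝕜] [NormedAddCommGroup U]
    [InnerProductSpace 𝕜 U] [CompleteSpace U] {R : U →L[𝕜] U}
    (h : ∃ ε : ℝ, 0 < ε ∧ ∀ u : U, ε * ‖u‖ ^ 2 ≤ RCLike.re (inner 𝕜 u (R u))) :
    (∀ u, R (R.inverse u) = u) ∧ ∀ u, R.inverse (R u) = u := by
  obtain ⟨ε, hε, h⟩ := h
  have hu : IsUnit R := by
    refine R.isUnit_of_forall_le_norm_inner_map (c := ⟨ε, hε.le⟩) hε fun x => ?_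
    rw [← inner_conj_symm, RCLike.norm_conj]
    refine le_trans ?_ ((h x).trans (RCLike.re_le_norm _))
    rw [mul_comm]; rfl
  obtain ⟨e, rfl⟩ := hu
  have he : ((e : U →L[𝕜] U)) = (ContinuousLinearEquiv.unitsEquiv 𝕜 U e : U →L[𝕜] U) := rfl
  rw [he, ContinuousLinearMap.inverse_equiv]
  exact ⟨fun u => ContinuousLinearEquiv.apply_symm_apply _ u,
    fun u => ContinuousLinearEquiv.symm_apply_apply _ u⟩

namespace Regulator

variable {𝕜 H U : Type*} [RCLike 𝕜] [NormedAddCommGroup H] [InnerProductSpace 𝕜 H]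
  [CompleteSpace H] [NormedAddCommGroup U] [InnerProductSpace 𝕜 U] [CompleteSpace U]
  (D : Regulator 𝕜 H U)

/-- The quadratic coefficient `B R⁻¹ B*` of the Riccati equation. -/
noncomputable def S : H →L[𝕜] H := D.B ∘L D.Ri ∘L (D.B)†

theorem inner_R_left (u v : U) : inner 𝕜 (D.R u) v = inner 𝕜 u (D.R v) :=
  D.R_selfAdjoint.inner_left u v

theorem inner_Ri_left (u v : U) : inner 𝕜 (D.Ri u) v = inner 𝕜 u (D.Ri v) := by
  conv_lhs => rw [← D.R_Ri v]
  rw [← D.inner_R_left, D.R_Ri]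

theorem re_inner_R_nonneg (u : U) : 0 ≤ RCLike.re (inner 𝕜 u (D.R u)) := by
  obtain ⟨ε, hε, h⟩ := D.R_coercive
  exact (by positivity : 0 ≤ ε * ‖u‖ ^ 2).trans (h u)

theorem eq_zero_of_re_inner_R {u : U} (h : RCLike.re (inner 𝕜 u (D.R u)) ≤ 0) : u = 0 := by
  obtain ⟨ε, hε, hR⟩ := D.R_coercive
  have h1 := (hR u).trans h
  have h2 : ‖u‖ ^ 2 ≤ 0 := by
    by_contra hc
    have := mul_pos hε (not_le.1 hc)
    linarith
  exact norm_eq_zero.1 (pow_eq_zero_iff two_ne_zero |>.1 (le_antisymm h2 (sq_nonneg _)))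

theorem Ri_isPositive : D.Ri.IsPositive := by
  refine ⟨fun u v => D.inner_Ri_left u v, fun u => ?_⟩
  have := D.re_inner_R_nonneg (D.Ri u)
  rwa [D.R_Ri] at this

theorem S_isPositive : D.S.IsPositive := D.Ri_isPositive.conj_adjoint D.B

/-- The operator-valued function `P` solves the Riccati equation of the regulator. -/
def IsFlow (P : ℝ → H →L[𝕜] H) : Prop := IsRiccatiFlow D.T D.S D.Q D.G 0 D.tf P

/-- The feedback operator `R⁻¹ B* P(s)`. -/
noncomputable def gain (P : ℝ → H →L[𝕜] H) (s : ℝ) : H →L[𝕜] U := D.Ri ∘L (D.B)† ∘L P s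

variable {D} in
theorem IsFlow.strongCont_gain {P : ℝ → H →L[𝕜] H} (h : D.IsFlow P) : StrongCont (D.gain P) :=
  fun x => (D.Ri ∘L (D.B)†).continuous.comp (h.strongCont x)

variable [NormedSpace ℝ H] [IsScalarTower ℝ 𝕜 H]

/-- The state of the regulator for the control `u` and the state `a` at time `t`. -/
noncomputable def state (t : ℝ) (a : H) (u : ℝ → U) : ℝ → H :=
  mildState D.T t a fun r => D.B (u r)

/-- The cost of the regulator for the control `u` and the state `a` at time `t`. -/
noncomputable def cost (t : ℝ) (a : H) (u : ℝ → U) : ℝ :=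
  RCLike.re (inner 𝕜 (D.state t a u D.tf) (D.G (D.state t a u D.tf))) +
    ∫ s in t..D.tf, (RCLike.re (inner 𝕜 (D.state t a u s) (D.Q (D.state t a u s))) +
      RCLike.re (inner 𝕜 (u s) (D.R (u s))))

/-- The deviation of the control `u` from the optimal feedback. -/
noncomputable def defect (P : ℝ → H →L[𝕜] H) (t : ℝ) (a : H) (u : ℝ → U) (s : ℝ) : U :=
  u s + D.gain P s (D.state t a u s)

theorem exists_isFlow : ∃ P, D.IsFlow P :=
  exists_isRiccatiFlow D.semigroup D.S_isPositive D.Q_pos D.G_pos D.tf_nonneg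

theorem continuous_state (t : ℝ) (a : H) {u : ℝ → U} (hu : Continuous u) :
    Continuous (D.state t a u) :=
  continuous_mildState D.semigroup t a (D.B.continuous.comp hu)

theorem state_self (t : ℝ) (a : H) (u : ℝ → U) : D.state t a u t = a :=
  mildState_self D.semigroup t a _

theorem state_add (t s : ℝ) (a b : H) {u v : ℝ → U} (hu : Continuous u) (hv : Continuous v) :
    D.state t (a + b) (fun r => u r + v r) s = D.state t a u s + D.state t b v s := by
  simp only [state, map_add]
  exact mildState_add_add D.semigroup t s a b (D.B.continuous.comp hu) (D.B.continuous.comp hv)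

theorem hasForcing_state {t s : ℝ} (hs : t ≤ s) (a : H) {u : ℝ → U} (hu : Continuous u) :
    HasForcing D.T (D.state t a u) (D.B (u s)) s :=
  hasForcing_mildState D.semigroup hs a (D.B.continuous.comp hu)

theorem continuous_re_quadratic {E : Type*} [NormedAddCommGroup E] [InnerProductSpace 𝕜 E]
    (A : E →L[𝕜] E) {x : ℝ → E} (hx : Continuous x) :
    Continuous fun s => RCLike.re (inner 𝕜 (x s) (A (x s))) :=
  RCLike.continuous_re.comp (hx.inner (A.continuous.comp hx))

variable {D} {P : ℝ → H →L[𝕜] H} {t : ℝ}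

theorem IsFlow.continuous_defect (h : D.IsFlow P) (t : ℝ) (a : H) {u : ℝ → U}
    (hu : Continuous u) : Continuous (D.defect P t a u) :=
  hu.add (h.strongCont_gain.continuous_apply continuous_id (D.continuous_state t a hu))

/-- Completion of the square. -/
theorem IsFlow.cost_eq (h : D.IsFlow P) (ht : t ∈ Icc 0 D.tf) (a : H) {u : ℝ → U}
    (hu : Continuous u) : D.cost t a u = RCLike.re (inner 𝕜 a (P t a)) +
      ∫ s in t..D.tf, RCLike.re (inner 𝕜 (D.defect P t a u s) (D.R (D.defect P t a u s))) := by
  have hx := D.continuous_state t a hu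
  have hw := h.continuous_defect t a hu
  have key := inner_sub_eq_integral D.semigroup h.strongCont (h.strongCont.riccatiRhs D.S D.Q)
    hx hx (D.B.continuous.comp hu) (D.B.continuous.comp hu) ht.2
    (fun s hs => D.hasForcing_state hs.1.le a hu) (fun s hs => D.hasForcing_state hs.1.le a hu)
    (fun s hs s' hs' => h.mild_of_le D.semigroup (ht.1.trans hs.1) hs'.1 hs'.2)
  rw [D.state_self, h.final] at key
  unfold cost
  set x := D.state t a u with hxdef
  set w := D.defect P t a u with hwdef
  -- With `v = B* P x` and `w = u + R⁻¹ v`, expanding `⟨w, R w⟩` produces `⟨u, R u⟩`, the two cross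
  -- terms and `⟨v, R⁻¹ v⟩`; the last is the quadratic term of the Riccati equation.
  have e : ∀ s, -inner 𝕜 (x s) (riccatiRhs D.S D.Q P s (x s)) +
      inner 𝕜 (D.B (u s)) (P s (x s)) + inner 𝕜 (x s) (P s (D.B (u s))) =
      inner 𝕜 (w s) (D.R (w s)) -
        (inner 𝕜 (x s) (D.Q (x s)) + inner 𝕜 (u s) (D.R (u s))) := by
    intro s
    have hw' : w s = u s + D.Ri (((D.B)†) (P s (x s))) := rfl
    have h1 : inner 𝕜 (x s) (P s (D.B (u s))) = inner 𝕜 (((D.B)†) (P s (x s))) (u s) := by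
      rw [← (h.selfAdjoint s).inner_left, ContinuousLinearMap.adjoint_inner_left]
    have h2 : inner 𝕜 (D.B (u s)) (P s (x s)) = inner 𝕜 (u s) (((D.B)†) (P s (x s))) := by
      rw [ContinuousLinearMap.adjoint_inner_right]
    have h3 : inner 𝕜 (x s) (P s (D.S (P s (x s)))) =
        inner 𝕜 (((D.B)†) (P s (x s))) (D.Ri (((D.B)†) (P s (x s)))) := by
      rw [← (h.selfAdjoint s).inner_left, ContinuousLinearMap.adjoint_inner_left]; rfl
    simp only [riccatiRhs, _root_.sub_apply, ContinuousLinearMap.comp_apply, inner_sub_right]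
    rw [h1, h2, h3, hw']
    set v := ((D.B)†) (P s (x s))
    rw [map_add, D.R_Ri, inner_add_left, inner_add_right, inner_add_right, D.inner_Ri_left,
      D.Ri_R, D.inner_Ri_left]
    ring
  simp only [Function.comp_apply, e] at key
  have c1 : Continuous fun s => inner 𝕜 (w s) (D.R (w s)) := hw.inner (D.R.continuous.comp hw)
  have c2 : Continuous fun s => inner 𝕜 (x s) (D.Q (x s)) + inner 𝕜 (u s) (D.R (u s)) :=
    (hx.inner (D.Q.continuous.comp hx)).add (hu.inner (D.R.continuous.comp hu))
  rw [intervalIntegral.integral_sub (c1.intervalIntegrable _ _) (c2.intervalIntegrable _ _)]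
    at key
  have hre := congrArg RCLike.re key
  rw [map_sub, map_sub, re_intervalIntegral c1, re_intervalIntegral c2] at hre
  simp only [map_add] at hre ⊢
  linarith

theorem IsFlow.le_cost (h : D.IsFlow P) (ht : t ∈ Icc 0 D.tf) (a : H) {u : ℝ → U}
    (hu : Continuous u) : RCLike.re (inner 𝕜 a (P t a)) ≤ D.cost t a u := by
  rw [h.cost_eq ht a hu]
  exact le_add_of_nonneg_right
    (intervalIntegral.integral_nonneg ht.2 fun s _ => D.re_inner_R_nonneg _)

theorem IsFlow.cost_eq_of_defect (h : D.IsFlow P) (ht : t ∈ Icc 0 D.tf) (a : H) {u : ℝ → U}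
    (hu : Continuous u) (hw : ∀ s ∈ Icc t D.tf, D.defect P t a u s = 0) :
    D.cost t a u = RCLike.re (inner 𝕜 a (P t a)) := by
  rw [h.cost_eq ht a hu, intervalIntegral.integral_congr (g := fun _ => 0) fun s hs => by
    rw [uIcc_of_le ht.2] at hs
    simp [hw s hs], intervalIntegral.integral_zero, add_zero]

/-- A continuous non-negative integrand with non-positive integral vanishes everywhere on the
interval, and coercivity then kills `w`. On a degenerate interval the integral carries no
information, hence `a < b`. -/
theorem eq_zero_of_integral_nonpos {w : ℝ → U} (hw : Continuous w) {a b : ℝ} (hab : a < b)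
    (h : ∫ s in a..b, RCLike.re (inner 𝕜 (w s) (D.R (w s))) ≤ 0) : ∀ s ∈ Icc a b, w s = 0 := by
  intro s hs
  by_contra hne
  have := intervalIntegral.integral_pos hab (continuous_re_quadratic D.R hw).continuousOn
    (fun r _ => D.re_inner_R_nonneg (w r))
    ⟨s, hs, not_le.1 fun hle => hne (D.eq_zero_of_re_inner_R hle)⟩
  linarith

theorem IsFlow.defect_eq_zero (h : D.IsFlow P) (ht : t ∈ Ico 0 D.tf) (a : H) {u : ℝ → U}
    (hu : Continuous u) (hc : D.cost t a u ≤ RCLike.re (inner 𝕜 a (P t a))) :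
    ∀ s ∈ Icc t D.tf, D.defect P t a u s = 0 := by
  rw [h.cost_eq ⟨ht.1, ht.2.le⟩ a hu] at hc
  exact eq_zero_of_integral_nonpos (h.continuous_defect t a hu) ht.2 (by linarith)

/-- The optimal feedback is realized by a continuous control. -/
theorem IsFlow.exists_feedback_control (h : D.IsFlow P) (ht : t ∈ Icc 0 D.tf) (a : H) :
    ∃ u : ℝ → U, Continuous u ∧ ∀ s ∈ Icc t D.tf, D.defect P t a u s = 0 := by
  -- The closed-loop trajectory is constructed first; the control is read off from it, and `x` is
  -- then the state belonging to that control.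
  obtain ⟨x, hx, hxe⟩ := exists_mildState_feedback D.semigroup
    (C := fun r => -(D.B ∘L D.gain P r))
    (fun z => (D.B.continuous.comp (h.strongCont_gain z)).neg) ht.2 a
  refine ⟨fun r => -(D.gain P r (x r)),
    (h.strongCont_gain.continuous_apply continuous_id hx).neg, fun s hs => ?_⟩
  have : D.state t a (fun r => -(D.gain P r (x r))) s = x s := by
    rw [hxe s hs, state]
    simp
  rw [defect, this, neg_add_cancel]

/-- The costate of an optimally controlled trajectory is `P(t) a`. -/
theorem IsFlow.costate_eq (h : D.IsFlow P) (ht : t ∈ Icc 0 D.tf) (a : H) {u : ℝ → U}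
    (hu : Continuous u) (hw : t < D.tf → ∀ s ∈ Icc t D.tf, D.defect P t a u s = 0) :
    P t a = ((D.T (D.tf - t))†) (D.G (D.state t a u D.tf)) +
      ∫ r in t..D.tf, ((D.T (r - t))†) (D.Q (D.state t a u r)) := by
  have hx := D.continuous_state t a hu
  refine ext_inner_left 𝕜 fun y => ?_
  -- The energy identity is applied to the pair formed by the controlled state and the free orbit
  -- `T(r - t) y`; moving `T(r - t)` to the other side produces the adjoint semigroup of the costate
  -- formula.
  have hy : Continuous fun r => D.T (r - t) y :=
    D.semigroup.strongCont.comp_continuous (τ := fun r => r - t) (by fun_prop) y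
  have hyf : ∀ s ∈ Ioo t D.tf, HasForcing D.T (fun r => D.T (r - t) y) (0 : H) s := fun s hs =>
    hasForcing_of_eq_mildState D.semigroup (a := y) (f := fun _ => 0) continuous_const
      (fun r _ => by simp [mildState]) hs
  have key := inner_sub_eq_integral D.semigroup h.strongCont (h.strongCont.riccatiRhs D.S D.Q)
    hx hy (D.B.continuous.comp hu) continuous_const ht.2
    (fun s hs => D.hasForcing_state hs.1.le a hu) hyf
    (fun s hs s' hs' => h.mild_of_le D.semigroup (ht.1.trans hs.1) hs'.1 hs'.2)
  have hc : Continuous fun r => ((D.T (r - t))†) (D.Q (D.state t a u r)) :=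
    D.semigroup.adjoint.strongCont.continuous_apply (by fun_prop) (D.Q.continuous.comp hx)
  rw [inner_add_right, intervalIntegral.integral_of_le ht.2,
    ← integral_inner (hc.intervalIntegrable t D.tf).1, ← intervalIntegral.integral_of_le ht.2]
  simp only [ContinuousLinearMap.adjoint_inner_right]
  have e : ∫ s in t..D.tf, (-inner 𝕜 (D.T (s - t) y)
        (riccatiRhs D.S D.Q P s (D.state t a u s)) +
      inner 𝕜 (0 : H) (P s (D.state t a u s)) +
      inner 𝕜 (D.T (s - t) y) (P s ((D.B ∘ u) s))) =
      ∫ s in t..D.tf, -inner 𝕜 (D.T (s - t) y) (D.Q (D.state t a u s)) := by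
    -- A vanishing defect turns `P B u` into `-P S P x`, which cancels the quadratic part of the
    -- equation. If `t = tf` there is nothing to check, which is why `hw` is assumed only for `t <
    -- tf`.
    refine intervalIntegral.integral_congr_ae (Eventually.of_forall fun s hs => ?_)
    rw [uIoc_of_le ht.2] at hs
    have hd := hw (hs.1.trans_le hs.2) s ⟨hs.1.le, hs.2⟩
    rw [defect, add_eq_zero_iff_eq_neg] at hd
    simp only [riccatiRhs, _root_.sub_apply, ContinuousLinearMap.comp_apply, inner_sub_right,
      inner_zero_left, Function.comp_apply, hd, map_neg, inner_neg_right, gain, S]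
    ring
  rw [e, intervalIntegral.integral_neg, h.final, sub_self, D.semigroup.zero, D.state_self] at key
  simp only [ContinuousLinearMap.id_apply] at key
  linear_combination key

theorem defect_add (t : ℝ) (a b : H) {u v : ℝ → U} (hu : Continuous u) (hv : Continuous v)
    (s : ℝ) : D.defect P t (a + b) (fun r => u r + v r) s =
      D.defect P t a u s + D.defect P t b v s := by
  rw [defect, D.state_add t s a b hu hv, map_add, defect, defect]
  abel

/-- The difference of the two controls has zero defect for the initial state `0`, so its cost is
`0`. All terms of the cost are non-negative, and coercivity of `R` forces the difference to vanish.
-/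
theorem IsFlow.control_unique (h : D.IsFlow P) (ht : t ∈ Ico 0 D.tf) (a : H) {u v : ℝ → U}
    (hu : Continuous u) (hv : Continuous v) (hwu : ∀ s ∈ Icc t D.tf, D.defect P t a u s = 0)
    (hwv : ∀ s ∈ Icc t D.tf, D.defect P t a v s = 0) : EqOn u v (Icc t D.tf) := by
  have htI : t ∈ Icc 0 D.tf := ⟨ht.1, ht.2.le⟩
  have hd : Continuous fun s => u s - v s := hu.sub hv
  have h0 : ∀ s ∈ Icc t D.tf, D.defect P t 0 (fun r => u r - v r) s = 0 := by
    intro s hs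
    have := defect_add (D := D) (P := P) t a 0 hv hd s
    simp only [add_zero, add_sub_cancel] at this
    rw [show D.defect P t a (fun r => u r) s = 0 from hwu s hs, hwv s hs, zero_add] at this
    exact this.symm
  have hcost := h.cost_eq_of_defect htI 0 hd h0
  rw [inner_zero_left, map_zero, cost] at hcost
  have hx := D.continuous_state t 0 hd
  rw [intervalIntegral.integral_add ((continuous_re_quadratic D.Q hx).intervalIntegrable _ _)
    ((continuous_re_quadratic D.R hd).intervalIntegrable _ _)] at hcost
  have h1 := D.G_pos.re_inner_nonneg_right (D.state t 0 (fun r => u r - v r) D.tf)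
  have h2 : 0 ≤ ∫ s in t..D.tf, RCLike.re (inner 𝕜 (D.state t 0 (fun r => u r - v r) s)
      (D.Q (D.state t 0 (fun r => u r - v r) s))) :=
    intervalIntegral.integral_nonneg ht.2.le fun s _ => D.Q_pos.re_inner_nonneg_right _
  have := eq_zero_of_integral_nonpos (D := D) hd ht.2 (by linarith)
  exact fun s hs => sub_eq_zero.1 (this s hs)

theorem integral_exp_neg_mul_le {n t s : ℝ} (hn : 0 < n) :
    ∫ r in t..s, Real.exp (-(n * (r - t))) ≤ n⁻¹ := by
  have hd : ∀ r ∈ uIcc t s, HasDerivAt (fun r => -(n⁻¹ * Real.exp (-(n * (r - t)))))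
      (Real.exp (-(n * (r - t)))) r := by
    intro r _
    have h1 : HasDerivAt (fun r => -(n * (r - t))) (-(n * 1)) r :=
      (((hasDerivAt_id r).sub_const t).const_mul n).neg
    refine (h1.exp.const_mul n⁻¹).neg.congr_deriv ?_
    have := hn.ne'
    field_simp
  rw [intervalIntegral.integral_eq_sub_of_hasDerivAt hd
    (Continuous.intervalIntegrable (by fun_prop) _ _)]
  simp only [sub_self, mul_zero, neg_zero, Real.exp_zero]
  have : 0 ≤ n⁻¹ * Real.exp (-(n * (s - t))) := by positivity
  linarith

/-- Every initial value of the control can be combined with an almost optimal cost. -/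
theorem IsFlow.exists_almost_optimal (h : D.IsFlow P) (ht : t ∈ Icc 0 D.tf) (a : H) (u₀ : U)
    {ε : ℝ} (hε : 0 < ε) : ∃ u : ℝ → U, Continuous u ∧ u t = u₀ ∧
      D.cost t a u ≤ RCLike.re (inner 𝕜 a (P t a)) + ε := by
  obtain ⟨v, hv, hwv⟩ := h.exists_feedback_control ht a
  obtain ⟨M, hM1, hM⟩ := D.semigroup.exists_bound (D.tf - t)
  obtain ⟨N, hN0, hN⟩ := h.strongCont_gain.exists_bound t D.tf
  have hM0 : 0 ≤ M := zero_le_one.trans hM1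
  -- The feedback control `v` misses the prescribed value by `d`. The correction `exp(-n (s - t)) d`
  -- has integral of order `1 / n`; it changes the state by `O(1 / n)` and the integral of the
  -- squared defect by `O(1 / n)`.
  set d := u₀ - v t with hd
  set c : ℝ := N * (M * ‖D.B‖ * ‖d‖) with hc
  have hc0 : 0 ≤ c := by positivity
  -- The extra cost is at most `K / n`; the factor `2` comes from `(p + q)² ≤ 2 (p² + q²)`, applied
  -- to the direct part of the defect and to its part through the state, which is at most `c / n`.
  set K : ℝ := 2 * ‖D.R‖ * (‖d‖ ^ 2 + c ^ 2 * (D.tf - t)) with hK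
  have hK0 : 0 ≤ K := by have := sub_nonneg.2 ht.2; positivity
  obtain ⟨n, hn1, hnK⟩ : ∃ n : ℝ, 1 ≤ n ∧ K * n⁻¹ ≤ ε := by
    refine ⟨max 1 (K / ε), le_max_left _ _, ?_⟩
    have h0 : 0 < max 1 (K / ε) := lt_max_of_lt_left one_pos
    rw [← div_eq_mul_inv, div_le_iff₀ h0]
    have := (div_le_iff₀ hε).1 (le_max_right 1 (K / ε))
    linarith
  have hn0 : 0 < n := by linarith
  set θ : ℝ → ℝ := fun s => Real.exp (-(n * (s - t))) with hθ
  have hθc : Continuous θ := by fun_prop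
  have hθ0 : ∀ s, 0 ≤ θ s := fun s => (Real.exp_pos _).le
  have hθ1 : ∀ s, t ≤ s → θ s ≤ 1 := fun s hs => by
    rw [hθ]; exact Real.exp_le_one_iff.2 (by have := sub_nonneg.2 hs; nlinarith)
  have hθi : ∀ s, ∫ r in t..s, θ r ≤ n⁻¹ := fun s => integral_exp_neg_mul_le hn0
  set e : ℝ → U := fun s => ((θ s : ℝ) : 𝕜) • d with he
  have hec : Continuous e := (RCLike.continuous_ofReal.comp hθc).smul continuous_const
  have hen : ∀ s, ‖e s‖ = θ s * ‖d‖ := fun s => by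
    rw [he, norm_smul, RCLike.norm_ofReal, abs_of_nonneg (hθ0 s)]
  have huc : Continuous fun s => v s + e s := hv.add hec
  refine ⟨fun s => v s + e s, huc, by simp [he, hθ, hd], ?_⟩
  rw [h.cost_eq ht a huc]
  -- The defect is linear in the pair of initial state and control, and it vanishes for `(a, v)`.
  have hdef : ∀ s ∈ Icc t D.tf, D.defect P t a (fun s => v s + e s) s = D.defect P t 0 e s := by
    intro s hs
    have := defect_add (D := D) (P := P) t a 0 hv hec s
    rw [add_zero, hwv s hs, zero_add] at this
    exact this
  have hstate : ∀ s ∈ Icc t D.tf, ‖D.state t 0 e s‖ ≤ M * ‖D.B‖ * ‖d‖ * n⁻¹ := by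
    intro s hs
    rw [state, mildState, map_zero, zero_add]
    have : ‖∫ r in t..s, D.T (s - r) (D.B (e r))‖ ≤ ∫ r in t..s, M * ‖D.B‖ * ‖d‖ * θ r := by
      refine intervalIntegral.norm_integral_le_of_norm_le hs.1
        (Eventually.of_forall fun r hr => ?_) ((hθc.const_mul _).intervalIntegrable _ _)
      refine ((D.T (s - r)).le_of_opNorm_le (hM _ (by linarith [hr.1, hs.2])) _).trans ?_
      calc M * ‖D.B (e r)‖ ≤ M * (‖D.B‖ * ‖e r‖) := by gcongr; exact D.B.le_opNorm _
        _ = _ := by rw [hen]; ring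
    refine this.trans ?_
    rw [intervalIntegral.integral_const_mul]
    gcongr
    exact hθi s
  have hdn : ∀ s ∈ Icc t D.tf, ‖D.defect P t 0 e s‖ ≤ θ s * ‖d‖ + c * n⁻¹ := by
    intro s hs
    refine (norm_add_le _ _).trans ?_
    rw [hen]
    gcongr
    refine ((D.gain P s).le_of_opNorm_le (hN s hs) _).trans ?_
    calc _ ≤ N * (M * ‖D.B‖ * ‖d‖ * n⁻¹) := by gcongr; exact hstate s hs
      _ = _ := by rw [hc]; ring
  have hin : n⁻¹ ≤ 1 := inv_le_one_of_one_le₀ hn1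
  have hin0 : 0 ≤ n⁻¹ := (inv_pos.2 hn0).le
  have hbound : ∫ s in t..D.tf, RCLike.re (inner 𝕜 (D.defect P t a (fun s => v s + e s) s)
      (D.R (D.defect P t a (fun s => v s + e s) s))) ≤
      ∫ s in t..D.tf, (2 * ‖D.R‖ * ‖d‖ ^ 2 * θ s + 2 * ‖D.R‖ * c ^ 2 * n⁻¹) := by
    refine intervalIntegral.integral_mono_on ht.2 ?_
      (Continuous.intervalIntegrable (by fun_prop) _ _) fun s hs => ?_
    · exact (continuous_re_quadratic D.R (h.continuous_defect t a huc)).intervalIntegrable _ _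
    · rw [hdef s hs]
      set w := D.defect P t 0 e s
      have h1 : RCLike.re (inner 𝕜 w (D.R w)) ≤ ‖D.R‖ * ‖w‖ ^ 2 := by
        refine (RCLike.re_le_norm _).trans ((norm_inner_le_norm _ _).trans ?_)
        have := D.R.le_opNorm w
        nlinarith [norm_nonneg w]
      have h2 : ‖w‖ ^ 2 ≤ (θ s * ‖d‖ + c * n⁻¹) ^ 2 := by gcongr; exact hdn s hs
      have h3 : (θ s * ‖d‖ + c * n⁻¹) ^ 2 ≤ 2 * ((θ s * ‖d‖) ^ 2 + (c * n⁻¹) ^ 2) := add_sq_le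
      have h4 : (θ s * ‖d‖) ^ 2 ≤ ‖d‖ ^ 2 * θ s := by
        have : θ s * θ s ≤ 1 * θ s := by gcongr; exacts [hθ1 s hs.1]
        calc _ = ‖d‖ ^ 2 * (θ s * θ s) := by ring
          _ ≤ _ := by gcongr; linarith
      have h5 : (c * n⁻¹) ^ 2 ≤ c ^ 2 * n⁻¹ := by
        have : n⁻¹ * n⁻¹ ≤ 1 * n⁻¹ := by gcongr
        calc _ = c ^ 2 * (n⁻¹ * n⁻¹) := by ring
          _ ≤ _ := by gcongr; linarith
      calc _ ≤ ‖D.R‖ * ‖w‖ ^ 2 := h1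
        _ ≤ ‖D.R‖ * (2 * (‖d‖ ^ 2 * θ s + c ^ 2 * n⁻¹)) := by gcongr; linarith
        _ = _ := by ring
  rw [intervalIntegral.integral_add ((hθc.const_mul _).intervalIntegrable _ _)
    (continuous_const.intervalIntegrable _ _), intervalIntegral.integral_const_mul,
    intervalIntegral.integral_const, smul_eq_mul] at hbound
  have h6 : 2 * ‖D.R‖ * ‖d‖ ^ 2 * ∫ r in t..D.tf, θ r ≤ 2 * ‖D.R‖ * ‖d‖ ^ 2 * n⁻¹ := by
    gcongr; exact hθi _
  have h7 : K * n⁻¹ = 2 * ‖D.R‖ * ‖d‖ ^ 2 * n⁻¹ + (D.tf - t) * (2 * ‖D.R‖ * c ^ 2 * n⁻¹) := by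
    rw [hK]; ring
  linarith

end Regulator

/-! ### The differential Riccati equation on the domain of the generator. -/

namespace Regulator

variable {𝕜 H U : Type*} [RCLike 𝕜] [NormedAddCommGroup H] [InnerProductSpace 𝕜 H]
  [CompleteSpace H] [NormedAddCommGroup U] [InnerProductSpace 𝕜 U] [CompleteSpace U]
  [NormedSpace ℝ H] [IsScalarTower ℝ 𝕜 H]
  {D : Regulator 𝕜 H U} {P : ℝ → H →L[𝕜] H} {L : H →ₗ.[𝕜] H}

/-- The differential Riccati equation, tested on the domain of the generator. -/
theorem IsFlow.hasDerivAt (h : D.IsFlow P) (hL : IsGenerator L D.T) (y x : L.domain) {t : ℝ}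
    (ht : t ∈ Ioo 0 D.tf) : HasDerivAt (fun t => inner 𝕜 (y : H) (P t x))
      (-inner 𝕜 (y : H) (riccatiRhs D.S D.Q P t x) - inner 𝕜 (L y) (P t x) -
        inner 𝕜 (y : H) (P t (L x))) t := by
  set φ : ℝ → 𝕜 := fun s => -inner 𝕜 (y : H) (riccatiRhs D.S D.Q P s x) +
    inner 𝕜 (-L y) (P s x) + inner 𝕜 (y : H) (P s (-L x)) with hφ
  have hφc : Continuous φ := by
    have h1 : Continuous fun s => inner 𝕜 (y : H) (riccatiRhs D.S D.Q P s x) :=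
      continuous_const.inner (h.strongCont.riccatiRhs D.S D.Q x)
    have h2 : Continuous fun s => inner 𝕜 (-L y) (P s x) :=
      continuous_const.inner (h.strongCont x)
    have h3 : Continuous fun s => inner 𝕜 (y : H) (P s (-L x)) :=
      continuous_const.inner (h.strongCont _)
    exact (h1.neg.add h2).add h3
  -- The energy identity for constant trajectories writes the form as the integral of the continuous
  -- function `φ`. This upgrades the one-sided derivative to a two-sided one.
  have hint : ∀ s ∈ Ioo 0 D.tf, inner 𝕜 (y : H) (P s x) =
      (∫ r in (0:ℝ)..s, φ r) + inner 𝕜 (y : H) (P 0 x) := by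
    intro s hs
    have key := inner_sub_eq_integral D.semigroup h.strongCont
      (h.strongCont.riccatiRhs D.S D.Q) (x := fun _ => (x : H)) (y := fun _ => (y : H))
      (f := fun _ => -L x) (g := fun _ => -L y) continuous_const continuous_const
      continuous_const continuous_const hs.1.le (fun r _ => hL.hasForcing_const x r)
      (fun r _ => hL.hasForcing_const y r)
      (fun r hr r' hr' => h.mild_of_le D.semigroup hr.1 hr'.1 (hr'.2.trans hs.2.le))
    rw [key]; ring
  have hd : HasDerivAt (fun s => (∫ r in (0:ℝ)..s, φ r) + inner 𝕜 (y : H) (P 0 x)) (φ t) t :=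
    (intervalIntegral.integral_hasDerivAt_right (hφc.intervalIntegrable _ _)
      (hφc.stronglyMeasurableAtFilter _ _) hφc.continuousAt).add_const _
  refine (hd.congr_of_eventuallyEq ?_).congr_deriv ?_
  · filter_upwards [Ioo_mem_nhds ht.1 ht.2] with s hs using hint s hs
  · simp only [hφ, inner_neg_left, inner_neg_right, map_neg]
    ring

/-- Uniqueness for the differential Riccati equation, tested on the domain of the generator. -/
theorem IsFlow.eq_of_weak (h : D.IsFlow P) (hL : IsGenerator L D.T)
    (hdense : Dense (L.domain : Set H)) {P' : ℝ → H →L[𝕜] H} (hP' : StrongCont P')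
    (hd : ∀ y x : L.domain, ∀ t ∈ Ioo 0 D.tf, HasDerivAt (fun t => inner 𝕜 (y : H) (P' t x))
      (-inner 𝕜 (y : H) (riccatiRhs D.S D.Q P' t x) - inner 𝕜 (L y) (P' t x) -
        inner 𝕜 (y : H) (P' t (L x))) t) (hf : P' D.tf = D.G) :
    ∀ t ∈ Icc 0 D.tf, P' t = P t :=
  IsRiccatiFlow.eq_of_mild D.semigroup D.S_isPositive.isSelfAdjoint h hP'
    (fun _ ht => isMildLyapunov_of_weak D.semigroup hL hdense hP' (hP'.riccatiRhs D.S D.Q) hd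
      ht.1 ht.2 le_rfl) hf

theorem state_congr {t s : ℝ} (hts : t ≤ s) (a : H) {u v : ℝ → U} (h : EqOn u v (Icc t s)) :
    D.state t a u s = D.state t a v s :=
  mildState_congr hts a fun _ hr => congrArg D.B (h hr)

theorem defect_congr {t s : ℝ} (hts : t ≤ s) (a : H) {u v : ℝ → U} (h : EqOn u v (Icc t s)) :
    D.defect P t a u s = D.defect P t a v s := by
  rw [defect, defect, state_congr hts a h, h ⟨hts, le_rfl⟩]

theorem cost_congr {t : ℝ} (ht : t ≤ D.tf) (a : H) {u v : ℝ → U} (h : EqOn u v (Icc t D.tf)) :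
    D.cost t a u = D.cost t a v := by
  rw [cost, cost, state_congr ht a h]
  congr 1
  refine intervalIntegral.integral_congr fun s hs => ?_
  rw [uIcc_of_le ht] at hs
  rw [state_congr hs.1 a (h.mono (Icc_subset_Icc_right hs.2)), h hs]

end Regulator

/-! ### Calculus with the projections and with the blocks of `E` and `A`. -/

namespace ProjectedPDAE

variable {𝕜 X Z U : Type*} [RCLike 𝕜]
  [NormedAddCommGroup X] [InnerProductSpace 𝕜 X]
  [NormedAddCommGroup Z] [InnerProductSpace 𝕜 Z]
  [NormedAddCommGroup U] [InnerProductSpace 𝕜 U]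
  (S : ProjectedPDAE 𝕜 X Z U)

theorem coe_projX₁ (x : X) : (S.projX₁ x : X) = S.PX x := rfl

theorem coe_projX₀ (x : X) : (S.projX₀ x : X) = x - S.PX x := rfl

theorem projX₁_add_projX₀ (x : X) : (S.projX₁ x : X) + S.projX₀ x = x := by
  rw [coe_projX₁, coe_projX₀, add_sub_cancel]

theorem projZ₁_add_projZ₀ (z : Z) : (S.projZ₁ z : Z) + S.projZ₀ z = z := add_sub_cancel _ _

theorem projX₁_coe (x : S.X₁) : S.projX₁ x = x := Subtype.ext (S.mem_X₁.1 x.2)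

theorem projX₁_coe_X₀ (x : S.X₀) : S.projX₁ x = 0 := Subtype.ext (S.mem_X₀.1 x.2)

theorem projX₀_coe (x : S.X₀) : S.projX₀ x = x := by
  refine Subtype.ext ?_
  rw [coe_projX₀, S.mem_X₀.1 x.2, sub_zero]

theorem projX₀_coe_X₁ (x : S.X₁) : S.projX₀ x = 0 := by
  refine Subtype.ext ?_
  rw [coe_projX₀, S.mem_X₁.1 x.2, sub_self]; rfl

theorem projZ₁_coe (z : S.Z₁) : S.projZ₁ z = z := Subtype.ext (S.mem_Z₁.1 z.2)

theorem projZ₀_coe_Z₁ (z : S.Z₁) : S.projZ₀ z = 0 := by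
  refine Subtype.ext ?_
  change (z : Z) - S.PZ z = 0
  rw [S.mem_Z₁.1 z.2, sub_self]

theorem projX₁_mem (x : S.A.domain) : S.projX₁ x ∈ S.A₁.domain := S.PX_mem x x.2

theorem projX₀_mem (x : S.A.domain) : S.projX₀ x ∈ S.A₀.domain :=
  S.A.domain.sub_mem x.2 (S.PX_mem x x.2)

theorem projZ₁_A (x : S.A.domain) : S.projZ₁ (S.A x) = S.A₁ ⟨_, S.projX₁_mem x⟩ :=
  Subtype.ext (S.PZ_A x x.2)

theorem projZ₀_A (x : S.A.domain) : S.projZ₀ (S.A x) = S.A₀ ⟨_, S.projX₀_mem x⟩ := by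
  refine Subtype.ext ?_
  change S.A x - S.PZ (S.A x) = S.A (x - ⟨S.PX x, S.PX_mem x x.2⟩)
  rw [S.PZ_A x x.2, LinearPMap.map_sub]

end ProjectedPDAE

namespace RadialPDAE

variable {𝕜 X Z U : Type*} [RCLike 𝕜]
  [NormedAddCommGroup X] [InnerProductSpace 𝕜 X]
  [NormedAddCommGroup Z] [InnerProductSpace 𝕜 Z]
  [NormedAddCommGroup U] [InnerProductSpace 𝕜 U]
  (S : RadialPDAE 𝕜 X Z U)

theorem E_eq (x : X) : S.E x = S.E₁ (S.projX₁ x) := by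
  conv_lhs => rw [← S.projX₁_add_projX₀ x, map_add, S.E_X₀ _ (S.projX₀ x).2, add_zero]
  rfl

theorem projZ₁_E (x : X) : S.projZ₁ (S.E x) = S.E₁ (S.projX₁ x) := by
  rw [S.E_eq, S.projZ₁_coe]

theorem projZ₀_E (x : X) : S.projZ₀ (S.E x) = 0 := by
  rw [S.E_eq, S.projZ₀_coe_Z₁]

/-- The generator `E₁⁻¹ A₁` of the semigroup. -/
def generator : S.X₁ →ₗ.[𝕜] S.X₁ := (S.E₁inv : S.Z₁ →ₗ[𝕜] S.X₁).compPMap S.A₁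

theorem isGenerator_extension : IsGenerator S.generator fun t => S.T (max t 0) := by
  intro x y
  rw [← show _ ↔ ∃ hx : x ∈ S.generator.domain, S.generator ⟨x, hx⟩ = y from S.T_generator x y]
  refine tendsto_congr' ?_
  filter_upwards [self_mem_nhdsWithin] with h hh
  rw [max_eq_left (le_of_lt hh)]

end RadialPDAE

/-! ### Reduction to a regulator on `X₁`, and identification of `Π₁`. -/

namespace LQProblem

variable {𝕜 X Z U : Type*} [RCLike 𝕜]
  [NormedAddCommGroup X] [InnerProductSpace 𝕜 X] [CompleteSpace X]
  [NormedAddCommGroup Z] [InnerProductSpace 𝕜 Z] [CompleteSpace Z]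
  [NormedAddCommGroup U] [InnerProductSpace 𝕜 U] [CompleteSpace U]
  (S : LQProblem 𝕜 X Z U)

/-- This is the real structure used in `hilbertIntegral`, so both kinds of integral agree by
definition. -/
noncomputable instance : NormedSpace ℝ S.X₁ := NormedSpace.restrictScalars ℝ 𝕜 S.X₁

instance : IsScalarTower ℝ 𝕜 S.X₁ :=
  ⟨fun r k x => by
    rw [RCLike.real_smul_eq_coe_mul, mul_smul]; rfl⟩

/-- The control weight `R + B̃₀* Q₀ B̃₀` of the reduced problem. -/
noncomputable def Rt : U →L[𝕜] U := S.R + (S.Bt₀)† ∘L S.Q₀ ∘L S.Bt₀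

theorem Q₀_isPositive : S.Q₀.IsPositive := S.Q_nonneg.adjoint_conj _

theorem Rt_coercive :
    ∃ ε : ℝ, 0 < ε ∧ ∀ u : U, ε * ‖u‖ ^ 2 ≤ RCLike.re (inner 𝕜 u (S.Rt u)) := by
  obtain ⟨ε, hε, h⟩ := S.R_coercive
  refine ⟨ε, hε, fun u => ?_⟩
  have h1 := (S.Q₀_isPositive.adjoint_conj S.Bt₀).re_inner_nonneg_right u
  rw [Rt, _root_.add_apply, inner_add_right, map_add]
  linarith [h u]

/-- The regulator on `X₁` to which the problem reduces. -/
noncomputable def regulator : Regulator 𝕜 S.X₁ U where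
  T t := S.T (max t 0)
  semigroup := S.T_semigroup.isHalfLineSemigroup
  B := S.Bt₁
  Q := S.Q₁
  G := S.G₁
  R := S.Rt
  Ri := S.Rt.inverse
  tf := S.tf
  tf_nonneg := S.tf_pos.le
  Q_pos := S.Q_nonneg.adjoint_conj _
  G_pos := S.G_nonneg.adjoint_conj _
  R_selfAdjoint := S.R_selfAdjoint.add (S.Q₀_isPositive.adjoint_conj S.Bt₀).isSelfAdjoint
  R_coercive := S.Rt_coercive
  R_Ri := (exists_inverse_of_coercive S.Rt_coercive).1
  Ri_R := (exists_inverse_of_coercive S.Rt_coercive).2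

theorem inner_G_X₁_X₀ (a : S.X₁) (b : S.X₀) : inner 𝕜 (a : X) (S.G b) = 0 := by
  have h := congrArg (fun L : X →L[𝕜] X => inner 𝕜 (a : X) (L b)) S.G₁₀
  simp only [ContinuousLinearMap.comp_apply, ContinuousLinearMap.adjoint_inner_right] at h
  simpa [S.mem_X₁.1 a.2, S.mem_X₀.1 b.2] using h

theorem inner_G_X₀_X₁ (a : S.X₀) (b : S.X₁) : inner 𝕜 (a : X) (S.G b) = 0 := by
  have h := congrArg (fun L : X →L[𝕜] X => inner 𝕜 (a : X) (L b)) S.G₀₁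
  simp only [ContinuousLinearMap.comp_apply, ContinuousLinearMap.adjoint_inner_right] at h
  simpa [S.mem_X₀.1 a.2, S.mem_X₁.1 b.2] using h

theorem inner_G_X₀_X₀ (a b : S.X₀) : inner 𝕜 (a : X) (S.G b) = 0 := by
  have h := congrArg (fun L : X →L[𝕜] X => inner 𝕜 (a : X) (L b)) S.G₀₀
  simp only [ContinuousLinearMap.comp_apply, ContinuousLinearMap.adjoint_inner_right] at h
  simpa [S.mem_X₀.1 a.2, S.mem_X₀.1 b.2] using h

theorem inner_Q_X₁_X₀ (a : S.X₁) (b : S.X₀) : inner 𝕜 (a : X) (S.Q b) = 0 := by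
  have h := congrArg (fun L : X →L[𝕜] X => inner 𝕜 (a : X) (L b)) S.Q₁₀
  simp only [ContinuousLinearMap.comp_apply, ContinuousLinearMap.adjoint_inner_right] at h
  simpa [S.mem_X₁.1 a.2, S.mem_X₀.1 b.2] using h

theorem inner_Q_X₀_X₁ (a : S.X₀) (b : S.X₁) : inner 𝕜 (a : X) (S.Q b) = 0 := by
  have h := congrArg (fun L : X →L[𝕜] X => inner 𝕜 (a : X) (L b)) S.Q₀₁
  simp only [ContinuousLinearMap.comp_apply, ContinuousLinearMap.adjoint_inner_right] at h
  simpa [S.mem_X₀.1 a.2, S.mem_X₁.1 b.2] using h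

theorem inner_G₁ (a b : S.X₁) : inner 𝕜 a (S.G₁ b) = inner 𝕜 (a : X) (S.G b) := by
  rw [G₁, ContinuousLinearMap.comp_apply, ContinuousLinearMap.adjoint_inner_right]
  rfl

theorem inner_Q₁ (a b : S.X₁) : inner 𝕜 a (S.Q₁ b) = inner 𝕜 (a : X) (S.Q b) := by
  rw [Q₁, ContinuousLinearMap.comp_apply, ContinuousLinearMap.adjoint_inner_right]
  rfl

theorem inner_Q₀ (a b : S.X₀) : inner 𝕜 a (S.Q₀ b) = inner 𝕜 (a : X) (S.Q b) := by
  rw [Q₀, ContinuousLinearMap.comp_apply, ContinuousLinearMap.adjoint_inner_right]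
  rfl

theorem inner_G_eq (y x : X) :
    inner 𝕜 y (S.G x) = inner 𝕜 (S.projX₁ y) (S.G₁ (S.projX₁ x)) := by
  conv_lhs => rw [← S.projX₁_add_projX₀ x, ← S.projX₁_add_projX₀ y]
  rw [map_add, inner_add_left, inner_add_right, inner_add_right, S.inner_G_X₁_X₀,
    S.inner_G_X₀_X₁, S.inner_G_X₀_X₀, S.inner_G₁]
  ring

theorem inner_Q_eq (y x : X) :
    inner 𝕜 y (S.Q x) = inner 𝕜 (S.projX₁ y) (S.Q₁ (S.projX₁ x)) +
      inner 𝕜 (S.projX₀ y) (S.Q₀ (S.projX₀ x)) := by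
  conv_lhs => rw [← S.projX₁_add_projX₀ x, ← S.projX₁_add_projX₀ y]
  rw [map_add, inner_add_left, inner_add_right, inner_add_right, S.inner_Q_X₁_X₀,
    S.inner_Q_X₀_X₁, S.inner_Q₁, S.inner_Q₀]
  ring

/-- The extension of a control on `[t₀, tf]` by constants. -/
def extendControl (t₀ : ℝ) (u : ℝ → U) (s : ℝ) : U := u (max t₀ (min s S.tf))

variable {S} {t₀ : ℝ} {x : X} {u : ℝ → U}

theorem eqOn_extendControl : EqOn (S.extendControl t₀ u) u (Icc t₀ S.tf) := fun s hs => by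
  rw [extendControl, min_eq_left hs.2, max_eq_right hs.1]

theorem continuous_extendControl (ht : t₀ ≤ S.tf) (hu : ContinuousOn u (Icc t₀ S.tf)) :
    Continuous (S.extendControl t₀ u) :=
  hu.comp_continuous (by fun_prop) fun _ => ⟨le_max_left _ _, max_le ht (min_le_right _ _)⟩

theorem state₁_eq {s : ℝ} (hs : t₀ ≤ s) :
    S.state₁ t₀ x u s = S.regulator.state t₀ (S.projX₁ x) u s := by
  rw [state₁, Regulator.state, mildState]
  congr 1
  · change S.T (s - t₀) _ = S.T (max (s - t₀) 0) _
    rw [max_eq_left (sub_nonneg.2 hs)]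
  · refine intervalIntegral.integral_congr fun r hr => ?_
    rw [uIcc_of_le hs] at hr
    change S.T (s - r) (S.Bt₁ (u r)) = S.T (max (s - r) 0) (S.Bt₁ (u r))
    rw [max_eq_left (sub_nonneg.2 hr.2)]

theorem projX₁_state (s : ℝ) : S.projX₁ (S.state t₀ x u s) = S.state₁ t₀ x u s := by
  rw [state, map_sub, S.projX₁_coe, S.projX₁_coe_X₀, sub_zero]

theorem projX₀_state (s : ℝ) : S.projX₀ (S.state t₀ x u s) = -S.Bt₀ (u s) := by
  rw [state, map_sub, S.projX₀_coe, S.projX₀_coe_X₁, zero_sub]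

theorem inner_Rt (v : U) : inner 𝕜 v (S.Rt v) =
    inner 𝕜 (S.Bt₀ v) (S.Q₀ (S.Bt₀ v)) + inner 𝕜 v (S.R v) := by
  rw [Rt, _root_.add_apply, inner_add_right, add_comm]
  simp only [ContinuousLinearMap.comp_apply, ContinuousLinearMap.adjoint_inner_right]

/-- Since `x₀ = -B̃₀ u`, the cost of the algebraic sub-state is quadratic in `u` and is absorbed
into `Rt`. The missing cross terms of `Q` and the vanishing of `G` on `X₀` leave nothing else. -/
theorem cost_eq (ht : t₀ ≤ S.tf) :
    S.cost t₀ x u = S.regulator.cost t₀ (S.projX₁ x) u := by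
  rw [cost, Regulator.cost, S.inner_G_eq, projX₁_state, state₁_eq ht]
  congr 1
  refine intervalIntegral.integral_congr fun s hs => ?_
  rw [uIcc_of_le ht] at hs
  change _ = RCLike.re (inner 𝕜 (S.regulator.state t₀ (S.projX₁ x) u s)
    (S.Q₁ (S.regulator.state t₀ (S.projX₁ x) u s))) + RCLike.re (inner 𝕜 (u s) (S.Rt (u s)))
  rw [inner_Rt, ← state₁_eq hs.1]
  rw [S.inner_Q_eq, projX₁_state, projX₀_state, map_neg, inner_neg_neg, map_add, map_add,
    add_assoc]

theorem cost_eq_extendControl (ht : t₀ ≤ S.tf) :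
    S.cost t₀ x u = S.regulator.cost t₀ (S.projX₁ x) (S.extendControl t₀ u) := by
  rw [cost_eq ht]
  exact (Regulator.cost_congr ht _ eqOn_extendControl).symm

theorem defect_extendControl {P : ℝ → S.X₁ →L[𝕜] S.X₁} (a : S.X₁) {s : ℝ}
    (hs : s ∈ Icc t₀ S.tf) : S.regulator.defect P t₀ a (S.extendControl t₀ u) s =
      S.regulator.defect P t₀ a u s :=
  Regulator.defect_congr hs.1 a (eqOn_extendControl.mono (Icc_subset_Icc_right hs.2))

variable {P : ℝ → S.X₁ →L[𝕜] S.X₁}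

theorem mem_admissible_of_eq {v : ℝ → U} (hv : Continuous v) (hu : u ∈ S.admissible t₀ x)
    (h : v t₀ = u t₀) : v ∈ S.admissible t₀ x :=
  ⟨hv.continuousOn, by rw [h]; exact hu.2⟩

theorem le_cost (hP : S.regulator.IsFlow P) (ht : t₀ ∈ Icc 0 S.tf)
    (hu : u ∈ S.admissible t₀ x) :
    RCLike.re (inner 𝕜 (S.projX₁ x) (P t₀ (S.projX₁ x))) ≤ S.cost t₀ x u := by
  rw [cost_eq_extendControl ht.2]
  exact hP.le_cost ht _ (continuous_extendControl ht.2 hu.1)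

/-- Consistency constrains the control only through its value at `t₀`. Keeping the value of some
admissible control makes any continuous control admissible, at an arbitrarily small extra cost. -/
theorem exists_cost_le (hP : S.regulator.IsFlow P) (ht : t₀ ∈ Icc 0 S.tf)
    (hu : u ∈ S.admissible t₀ x) {ε : ℝ} (hε : 0 < ε) : ∃ v ∈ S.admissible t₀ x,
      S.cost t₀ x v ≤ RCLike.re (inner 𝕜 (S.projX₁ x) (P t₀ (S.projX₁ x))) + ε := by
  obtain ⟨v, hv, hvt, hvc⟩ := hP.exists_almost_optimal ht (S.projX₁ x) (u t₀) hε
  exact ⟨v, mem_admissible_of_eq hv hu hvt, (cost_eq ht.2).trans_le hvc⟩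

/-- The unconstrained minimum is still the infimum under the consistency condition, so an optimal
control has to attain it exactly. -/
theorem isOptimal_iff_cost_le (hP : S.regulator.IsFlow P) (ht : t₀ ∈ Icc 0 S.tf)
    (hu : u ∈ S.admissible t₀ x) : S.IsOptimal t₀ x u ↔
      S.cost t₀ x u ≤ RCLike.re (inner 𝕜 (S.projX₁ x) (P t₀ (S.projX₁ x))) := by
  refine ⟨fun h => le_of_forall_pos_le_add fun ε hε => ?_,
    fun h => ⟨hu, fun v hv => h.trans (le_cost hP ht hv)⟩⟩
  obtain ⟨v, hv, hvc⟩ := exists_cost_le hP ht hu hε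
  exact (h.2 v hv).trans hvc

theorem IsOptimal.defect_eq_zero (hP : S.regulator.IsFlow P) (ht : t₀ ∈ Ico 0 S.tf)
    (h : S.IsOptimal t₀ x u) : ∀ s ∈ Icc t₀ S.tf,
      S.regulator.defect P t₀ (S.projX₁ x) u s = 0 := by
  intro s hs
  have ht' : t₀ ∈ Icc 0 S.tf := ⟨ht.1, ht.2.le⟩
  rw [← defect_extendControl _ hs]
  refine hP.defect_eq_zero ht _ (continuous_extendControl ht'.2 h.1.1) ?_ s hs
  rw [← cost_eq_extendControl ht'.2]
  exact (isOptimal_iff_cost_le hP ht' h.1).1 h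

theorem isOptimal_of_defect (hP : S.regulator.IsFlow P) (ht : t₀ ∈ Icc 0 S.tf)
    (hu : u ∈ S.admissible t₀ x) (h : ∀ s ∈ Icc t₀ S.tf,
      S.regulator.defect P t₀ (S.projX₁ x) u s = 0) : S.IsOptimal t₀ x u := by
  rw [isOptimal_iff_cost_le hP ht hu, cost_eq_extendControl ht.2]
  refine (hP.cost_eq_of_defect ht _ (continuous_extendControl ht.2 hu.1) fun s hs => ?_).le
  exact (defect_extendControl _ hs).trans (h s hs)

/-- Every dynamical sub-state is the dynamical part of an initial state with an optimal
control. -/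
theorem exists_isOptimal (hP : S.regulator.IsFlow P) (ht : t₀ ∈ Icc 0 S.tf) (a : S.X₁) :
    ∃ (x : X) (u : ℝ → U), S.projX₁ x = a ∧ S.IsOptimal t₀ x u := by
  obtain ⟨u, hu, hd⟩ := hP.exists_feedback_control ht a
  -- The `X₀`-component is chosen so that the initial state is consistent with the feedback control.
  set x : X := (a : X) - (S.Bt₀ (u t₀) : X) with hx
  have h1 : S.projX₁ x = a := by
    rw [hx, map_sub, S.projX₁_coe, S.projX₁_coe_X₀, sub_zero]
  have hadm : u ∈ S.admissible t₀ x := ⟨hu.continuousOn, by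
    rw [hx, map_sub, S.projX₀_coe, S.projX₀_coe_X₁, zero_sub]⟩
  exact ⟨x, u, h1, isOptimal_of_defect hP ht hadm fun s hs => by rw [h1]; exact hd s hs⟩

/-- For `t₀ < tf` every optimal control has zero defect, so the costate formula yields the same
vector `P(t₀) a` for all of them. For `t₀ = tf` the integral is empty and the control plays no role.
-/
theorem isPi₁Value_iff (hP : S.regulator.IsFlow P) (ht : t₀ ∈ Icc 0 S.tf) (a b : S.X₁) :
    S.IsPi₁Value t₀ a b ↔ b = P t₀ a := by
  have key : ∀ (x : X) (u : ℝ → U), S.projX₁ x = a → S.IsOptimal t₀ x u →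
      P t₀ a = ((S.T (S.tf - t₀))†) (S.G₁ (S.state₁ t₀ x u S.tf)) +
        hilbertIntegral 𝕜 (fun r => ((S.T (r - t₀))†) (S.Q₁ (S.state₁ t₀ x u r))) t₀ S.tf := by
    intro x u hx hu
    subst hx
    have hs : ∀ s ∈ Icc t₀ S.tf, S.regulator.state t₀ (S.projX₁ x) (S.extendControl t₀ u) s =
        S.state₁ t₀ x u s := fun s hs => by
      rw [state₁_eq hs.1]
      exact Regulator.state_congr hs.1 _ (eqOn_extendControl.mono (Icc_subset_Icc_right hs.2))
    rw [hP.costate_eq ht _ (continuous_extendControl ht.2 hu.1.1)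
      fun hlt s hs => (defect_extendControl _ hs).trans (hu.defect_eq_zero hP ⟨ht.1, hlt⟩ s hs)]
    congr 1
    · change ((S.T (max (S.tf - t₀) 0))†) (S.G₁ (S.regulator.state _ _ _ S.tf)) = _
      rw [max_eq_left (sub_nonneg.2 ht.2), hs _ ⟨ht.2, le_rfl⟩]
    · refine intervalIntegral.integral_congr fun r hr => ?_
      replace hr : r ∈ uIcc t₀ S.tf := hr
      rw [uIcc_of_le ht.2] at hr
      change ((S.T (max (r - t₀) 0))†) (S.Q₁ (S.regulator.state _ _ _ r)) =
        ((S.T (r - t₀))†) (S.Q₁ (S.state₁ t₀ x u r))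
      rw [max_eq_left (sub_nonneg.2 hr.1), hs _ hr]
  constructor
  · rintro ⟨x, u, hx, hu, rfl⟩
    exact (key x u hx hu).symm
  · rintro rfl
    obtain ⟨x, u, hx, hu⟩ := exists_isOptimal hP ht a
    exact ⟨x, u, hx, hu, key x u hx hu⟩

theorem Pi₁_eq (hP : S.regulator.IsFlow P) (ht : t₀ ∈ Icc 0 S.tf) : S.Pi₁ t₀ = P t₀ := by
  have h : ∃ L : S.X₁ →L[𝕜] S.X₁, ∀ a, S.IsPi₁Value t₀ a (L a) :=
    ⟨P t₀, fun a => (isPi₁Value_iff hP ht a _).2 rfl⟩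
  rw [Pi₁, dif_pos h]
  ext1 a
  exact (isPi₁Value_iff hP ht a _).1 (h.choose_spec a)

end LQProblem

/-! ### Block analysis of the operator Riccati equation on `Z`. -/

namespace LQProblem

variable {𝕜 X Z U : Type*} [RCLike 𝕜]
  [NormedAddCommGroup X] [InnerProductSpace 𝕜 X] [CompleteSpace X]
  [NormedAddCommGroup Z] [InnerProductSpace 𝕜 Z] [CompleteSpace Z]
  [NormedAddCommGroup U] [InnerProductSpace 𝕜 U] [CompleteSpace U]
  (S : LQProblem 𝕜 X Z U)

theorem projX₁_mem_generator (x : S.A.domain) : S.projX₁ x ∈ S.generator.domain :=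
  S.projX₁_mem x

theorem R_Rinv (u : U) : S.R (S.Rinv u) = u := (exists_inverse_of_coercive S.R_coercive).1 u

theorem Rinv_R (u : U) : S.Rinv (S.R u) = u := (exists_inverse_of_coercive S.R_coercive).2 u

/-- The inverse of the reduced control weight. -/
noncomputable def Rtinv : U →L[𝕜] U := S.Rt.inverse

theorem Rt_Rtinv (u : U) : S.Rt (S.Rtinv u) = u := S.regulator.R_Ri u

theorem Rtinv_Rt (u : U) : S.Rtinv (S.Rt u) = u := S.regulator.Ri_R u

theorem E₁_Bt₁ (u : U) : S.E₁ (S.Bt₁ u) = S.B₁ u := S.E₁_E₁inv _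

theorem eq_zero_of_adjoint_E₁ {v : S.Z₁} (h : ((S.E₁)†) v = 0) : v = 0 := by
  have : inner 𝕜 (S.E₁inv v) (((S.E₁)†) v) = 0 := by rw [h, inner_zero_right]
  rw [ContinuousLinearMap.adjoint_inner_right, S.E₁_E₁inv] at this
  exact inner_self_eq_zero.1 this

theorem adjoint_B₀_apply (w : S.Z₀) : ((S.B₀)†) w = (S.B†) (((S.projZ₀)†) w) := by
  rw [ProjectedPDAE.B₀, ContinuousLinearMap.adjoint_comp]; rfl

theorem adjoint_B_PiTilde₀ (x : X) :
    (S.B†) (S.PiTilde₀ x) = ((S.B₀)†) (S.Pi₀ (S.projX₀ x)) := by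
  rw [adjoint_B₀_apply]; rfl

theorem adjoint_B₀_Pi₀ (x : S.X₀) : ((S.B₀)†) (S.Pi₀ x) = -((S.Bt₀)†) (S.Q₀ x) := by
  rw [Bt₀, ContinuousLinearMap.adjoint_comp, Pi₀, _root_.neg_apply, map_neg]; rfl

/-- This identity and `adjoint_B₀_Pi₀` are the mechanism by which `Π̃₀` accounts for the difference
between the weights `R` and `Rt`. -/
theorem adjoint_Bt₀_Q₀_Bt₀ (u : U) : ((S.Bt₀)†) (S.Q₀ (S.Bt₀ u)) = S.Rt u - S.R u := by
  rw [Rt, _root_.add_apply, add_sub_cancel_left]; rfl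

/-- The block operators on `Z = Z₁ ⊕ Z₀` that map `Z₁` to functionals vanishing on `Z₀`. -/
noncomputable def upperBlock (a : S.Z₁ →L[𝕜] S.Z₁) (b : S.Z₀ →L[𝕜] S.Z₁) (d : S.Z₀ →L[𝕜] S.Z₀) :
    Z →L[𝕜] Z :=
  (S.projZ₁)† ∘L a ∘L S.projZ₁ + (S.projZ₁)† ∘L b ∘L S.projZ₀ + (S.projZ₀)† ∘L d ∘L S.projZ₀

variable {S} {a : S.Z₁ →L[𝕜] S.Z₁} {b : S.Z₀ →L[𝕜] S.Z₁} {d : S.Z₀ →L[𝕜] S.Z₀}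

theorem inner_upperBlock (z z' : Z) : inner 𝕜 z (S.upperBlock a b d z') =
    inner 𝕜 (S.projZ₁ z) (a (S.projZ₁ z')) + inner 𝕜 (S.projZ₁ z) (b (S.projZ₀ z')) +
      inner 𝕜 (S.projZ₀ z) (d (S.projZ₀ z')) := by
  simp only [upperBlock, _root_.add_apply, ContinuousLinearMap.comp_apply, inner_add_right,
    ContinuousLinearMap.adjoint_inner_right]

theorem inner_compress {V V' : Submodule 𝕜 Z} [CompleteSpace V] [CompleteSpace V']
    (W : Z →L[𝕜] Z) (z : V) (z' : V') :
    inner 𝕜 z (((V.subtypeL)† ∘L W ∘L V'.subtypeL) z') = inner 𝕜 (z : Z) (W z') := by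
  rw [ContinuousLinearMap.comp_apply, ContinuousLinearMap.adjoint_inner_right]; rfl

/-- The form `⟨z, W z'⟩` splits along the two direct sum decompositions, and the blocks are its
restrictions. Orthogonality is not needed, since the adjoints of the projections appear on the
outside. -/
theorem eq_upperBlock {W : Z →L[𝕜] Z} (h : ∀ (w : S.Z₀) (z : S.Z₁), inner 𝕜 (w : Z) (W z) = 0) :
    W = S.upperBlock ((S.Z₁.subtypeL)† ∘L W ∘L S.Z₁.subtypeL)
      ((S.Z₁.subtypeL)† ∘L W ∘L S.Z₀.subtypeL) ((S.Z₀.subtypeL)† ∘L W ∘L S.Z₀.subtypeL) := by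
  ext z'
  refine ext_inner_left 𝕜 fun z => ?_
  rw [inner_upperBlock, inner_compress, inner_compress, inner_compress]
  conv_lhs => rw [← S.projZ₁_add_projZ₀ z', ← S.projZ₁_add_projZ₀ z]
  rw [map_add, inner_add_left, inner_add_right, inner_add_right, h]
  ring

theorem upperBlock_E (x : X) :
    S.upperBlock a b d (S.E x) = ((S.projZ₁)†) (a (S.E₁ (S.projX₁ x))) := by
  simp only [upperBlock, _root_.add_apply, ContinuousLinearMap.comp_apply, S.projZ₁_E,
    S.projZ₀_E, map_zero, add_zero]

/-- As `E` annihilates `X₀` and takes values in `Z₁`, only the block `a` is visible; transported to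
`X₁` it is the candidate for the Riccati operator. -/
theorem inner_E_upperBlock_E (y x : X) : inner 𝕜 (S.E y) (S.upperBlock a b d (S.E x)) =
    inner 𝕜 (S.projX₁ y) (((S.E₁)† ∘L a ∘L S.E₁) (S.projX₁ x)) := by
  rw [upperBlock_E, ContinuousLinearMap.adjoint_inner_right, S.projZ₁_E,
    ContinuousLinearMap.comp_apply, ContinuousLinearMap.adjoint_inner_right]
  rfl

theorem adjoint_B_upperBlock_E (x : X) : (S.B†) (S.upperBlock a b d (S.E x)) =
    ((S.Bt₁)†) (((S.E₁)† ∘L a ∘L S.E₁) (S.projX₁ x)) := by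
  refine ext_inner_left 𝕜 fun v => ?_
  rw [upperBlock_E, ContinuousLinearMap.adjoint_inner_right,
    ContinuousLinearMap.adjoint_inner_right, ContinuousLinearMap.adjoint_inner_right,
    ContinuousLinearMap.comp_apply, ContinuousLinearMap.adjoint_inner_right, E₁_Bt₁]
  rfl

/-- The terms of the Riccati equation for a block operator. -/
theorem riccati_terms (y x : S.A.domain) :
    inner 𝕜 (S.E y) (S.upperBlock a b d (S.A x))
      + inner 𝕜 (S.A y) (S.upperBlock a b d (S.E x))
      - inner 𝕜 (S.E y) (S.upperBlock a b d (S.B (S.Rinv ((S.B†) (S.upperBlock a b d (S.E x))))))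
      - inner 𝕜 (S.E y) (S.upperBlock a b d (S.B (S.Rinv ((S.B†) (S.PiTilde₀ x)))))
      + inner 𝕜 (y : X) (S.Q (S.PX x)) =
    inner 𝕜 (S.E₁ (S.projX₁ y)) (a (S.A₁ ⟨_, S.projX₁_mem x⟩))
      + inner 𝕜 (S.A₁ ⟨_, S.projX₁_mem y⟩) (a (S.E₁ (S.projX₁ x)))
      - inner 𝕜 (S.E₁ (S.projX₁ y))
        (a (S.B₁ (S.Rinv (((S.Bt₁)†) (((S.E₁)† ∘L a ∘L S.E₁) (S.projX₁ x)))))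
          + b (S.B₀ (S.Rinv (((S.Bt₁)†) (((S.E₁)† ∘L a ∘L S.E₁) (S.projX₁ x))))))
      + inner 𝕜 (S.projX₁ y) (S.Q₁ (S.projX₁ x))
      + inner 𝕜 (S.E₁ (S.projX₁ y))
        (b (S.A₀ ⟨_, S.projX₀_mem x⟩ - S.B₀ (S.Rinv (((S.B₀)†) (S.Pi₀ (S.projX₀ x)))))
          - a (S.B₁ (S.Rinv (((S.B₀)†) (S.Pi₀ (S.projX₀ x)))))) := by
  have hQ : inner 𝕜 (y : X) (S.Q (S.PX x)) = inner 𝕜 (S.projX₁ y) (S.Q₁ (S.projX₁ x)) := by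
    rw [S.inner_Q_eq, ← S.coe_projX₁, S.projX₁_coe, S.projX₀_coe_X₁, map_zero, inner_zero_right,
      add_zero]
  have hB₁ : ∀ v, S.projZ₁ (S.B v) = S.B₁ v := fun _ => rfl
  have hB₀ : ∀ v, S.projZ₀ (S.B v) = S.B₀ v := fun _ => rfl
  rw [hQ, adjoint_B_upperBlock_E, adjoint_B_PiTilde₀]
  simp only [inner_upperBlock, S.projZ₁_E, S.projZ₀_E, S.projZ₁_A, S.projZ₀_A, hB₁, hB₀,
    inner_zero_left, map_zero, inner_zero_right, add_zero, inner_add_right, inner_sub_right,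
    map_sub]
  ring

/-- The algebraic equation at a fixed time determines the coefficient of the feedback. -/
theorem feedback_coefficient_of_algebraic
    (h : ∀ x : S.A₀.domain, b (S.A₀ x - S.B₀ (S.Rinv (((S.B₀)†) (S.Pi₀ x)))) =
      a (S.B₁ (S.Rinv (((S.B₀)†) (S.Pi₀ x))))) (v : U) :
    a (S.B₁ (S.Rinv v)) + b (S.B₀ (S.Rinv v)) = a (S.B₁ (S.Rtinv v)) := by
  -- The vector `x = B̃₀ Rt⁻¹ v` is chosen because `B̃₀* Q₀ B̃₀ = Rt - R` gives `R⁻¹ B₀* Π₀ x = Rt⁻¹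
  -- v - R⁻¹ v`. The terms `B₀ Rt⁻¹ v` then cancel in the argument of `b`.
  have h1 := h ⟨_, S.A₀inv_mem (S.B₀ (S.Rtinv v))⟩
  rw [S.A₀_A₀inv] at h1
  have h2 : S.Rinv (((S.B₀)†) (S.Pi₀ (S.A₀inv (S.B₀ (S.Rtinv v))))) =
      S.Rtinv v - S.Rinv v := by
    change S.Rinv (((S.B₀)†) (S.Pi₀ (S.Bt₀ (S.Rtinv v)))) = _
    rw [adjoint_B₀_Pi₀, adjoint_Bt₀_Q₀_Bt₀, Rt_Rtinv, neg_sub, map_sub, Rinv_R]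
  simp only [h2, map_sub, sub_sub_cancel] at h1
  rw [h1]
  abel

/-- The right-hand side of the Riccati equation of the regulator, in terms of the blocks. -/
theorem riccati_terms_of_algebraic
    (h : ∀ x : S.A₀.domain, b (S.A₀ x - S.B₀ (S.Rinv (((S.B₀)†) (S.Pi₀ x)))) =
      a (S.B₁ (S.Rinv (((S.B₀)†) (S.Pi₀ x))))) (y x : S.A.domain)
    {P : ℝ → S.X₁ →L[𝕜] S.X₁} {t : ℝ} (hP : P t = (S.E₁)† ∘L a ∘L S.E₁) :
    inner 𝕜 (S.E y) (S.upperBlock a b d (S.A x))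
      + inner 𝕜 (S.A y) (S.upperBlock a b d (S.E x))
      - inner 𝕜 (S.E y) (S.upperBlock a b d (S.B (S.Rinv ((S.B†) (S.upperBlock a b d (S.E x))))))
      - inner 𝕜 (S.E y) (S.upperBlock a b d (S.B (S.Rinv ((S.B†) (S.PiTilde₀ x)))))
      + inner 𝕜 (y : X) (S.Q (S.PX x)) =
    inner 𝕜 (S.projX₁ y) (riccatiRhs S.regulator.S S.regulator.Q P t (S.projX₁ x))
      + inner 𝕜 (S.generator ⟨_, S.projX₁_mem_generator y⟩) (P t (S.projX₁ x))
      + inner 𝕜 (S.projX₁ y) (P t (S.generator ⟨_, S.projX₁_mem_generator x⟩)) := by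
  have hE : ∀ (z : S.X₁) (w : S.Z₁), inner 𝕜 (S.E₁ z) (a w) = inner 𝕜 z (((S.E₁)†) (a w)) :=
    fun z w => (ContinuousLinearMap.adjoint_inner_right _ _ _).symm
  have hA : ∀ x : S.A.domain, S.E₁ (S.generator ⟨_, S.projX₁_mem_generator x⟩) =
      S.A₁ ⟨_, S.projX₁_mem x⟩ := fun x => S.E₁_E₁inv _
  rw [riccati_terms, feedback_coefficient_of_algebraic h, h, sub_self, inner_zero_right, add_zero,
    ← hA x, ← hA y, ← E₁_Bt₁, hE, hE, hE]
  have hS : P t (S.regulator.S (P t (S.projX₁ x))) = ((S.E₁)†) (a (S.E₁ (S.Bt₁ (S.Rtinv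
      (((S.Bt₁)†) (((S.E₁)† ∘L a ∘L S.E₁) (S.projX₁ x))))))) := by rw [hP]; rfl
  simp only [riccatiRhs, _root_.sub_apply, ContinuousLinearMap.comp_apply, inner_sub_right, hS]
  rw [hP]
  simp only [ContinuousLinearMap.comp_apply]
  change _ = inner 𝕜 _ (S.Q₁ _) - _ + _ + _
  ring

theorem block_coefficient {L : S.X₁ →L[𝕜] S.X₁} :
    (S.E₁)† ∘L ((S.E₁inv)† ∘L L ∘L S.E₁inv) ∘L S.E₁ = L := by
  ext1 x
  refine ext_inner_left 𝕜 fun y => ?_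
  simp only [ContinuousLinearMap.comp_apply, ContinuousLinearMap.adjoint_inner_right, S.E₁inv_E₁]

theorem coefficient_block {L : S.Z₁ →L[𝕜] S.Z₁} :
    (S.E₁inv)† ∘L ((S.E₁)† ∘L L ∘L S.E₁) ∘L S.E₁inv = L := by
  ext1 x
  refine ext_inner_left 𝕜 fun y => ?_
  simp only [ContinuousLinearMap.comp_apply, ContinuousLinearMap.adjoint_inner_right, S.E₁_E₁inv]

variable {P : ℝ → S.X₁ →L[𝕜] S.X₁} {W : ℝ → Z →L[𝕜] Z}

theorem block₁_eq (hP : S.regulator.IsFlow P) {t : ℝ} (ht : t ∈ Icc 0 S.tf) :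
    S.block₁ t = (S.E₁inv)† ∘L P t ∘L S.E₁inv := by
  rw [block₁, Pi₁_eq hP ht]

theorem coefficient_block₁ (hP : S.regulator.IsFlow P) {t : ℝ} (ht : t ∈ Icc 0 S.tf) :
    (S.E₁)† ∘L S.block₁ t ∘L S.E₁ = P t := by
  rw [block₁_eq hP ht, block_coefficient]

theorem stronglyContinuous_block₁ (hP : S.regulator.IsFlow P) :
    S.StronglyContinuous S.block₁ := by
  intro z
  have : Continuous fun t => ((S.E₁inv)†) (P t (S.E₁inv z)) :=
    ((S.E₁inv)†).continuous.comp (hP.strongCont _)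
  refine this.continuousOn.congr fun t ht => ?_
  rw [block₁_eq hP ht]; rfl

theorem stronglyContinuous_PiTilde₁ (hP : S.regulator.IsFlow P) :
    S.StronglyContinuous S.PiTilde₁ := fun _ =>
  ((S.projZ₁)†).continuous.comp_continuousOn (stronglyContinuous_block₁ hP _)

theorem hasDerivAt_of_coefficient (hP : S.regulator.IsFlow P) (y x : S.A.domain) {t : ℝ}
    (ht : t ∈ Ioo 0 S.tf)
    (hW : ∀ t ∈ Icc 0 S.tf, ∃ b d, W t = S.upperBlock (S.block₁ t) b d) :
    HasDerivAt (fun t => inner 𝕜 (S.E y) (W t (S.E x)))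
      (-inner 𝕜 (S.projX₁ y) (riccatiRhs S.regulator.S S.regulator.Q P t (S.projX₁ x))
        - inner 𝕜 (S.generator ⟨_, S.projX₁_mem_generator y⟩) (P t (S.projX₁ x))
        - inner 𝕜 (S.projX₁ y) (P t (S.generator ⟨_, S.projX₁_mem_generator x⟩))) t := by
  refine (hP.hasDerivAt S.isGenerator_extension ⟨_, S.projX₁_mem y⟩ ⟨_, S.projX₁_mem x⟩
    ht).congr_of_eventuallyEq ?_
  filter_upwards [Ioo_mem_nhds ht.1 ht.2] with s hs
  have hs' : s ∈ Icc 0 S.tf := ⟨hs.1.le, hs.2.le⟩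
  obtain ⟨b, d, h⟩ := hW s hs'
  rw [h, inner_E_upperBlock_E, coefficient_block₁ hP hs']

theorem PiTilde₁_eq_upperBlock (t : ℝ) : S.PiTilde₁ t = S.upperBlock (S.block₁ t) 0 0 := by
  rw [upperBlock, PiTilde₁]
  simp only [ContinuousLinearMap.zero_comp, ContinuousLinearMap.comp_zero, add_zero]

theorem final_iff {a : S.Z₁ →L[𝕜] S.Z₁} {b : S.Z₀ →L[𝕜] S.Z₁} {d : S.Z₀ →L[𝕜] S.Z₀} :
    (∀ x : X, (S.E†) (S.upperBlock a b d (S.E x)) = S.G x) ↔ (S.E₁)† ∘L a ∘L S.E₁ = S.G₁ := by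
  constructor
  · intro h
    ext1 x
    refine ext_inner_left 𝕜 fun y => ?_
    have h1 := congrArg (inner 𝕜 (y : X)) (h x)
    rw [ContinuousLinearMap.adjoint_inner_right, inner_E_upperBlock_E, S.inner_G_eq,
      S.projX₁_coe, S.projX₁_coe] at h1
    exact h1
  · intro h x
    refine ext_inner_left 𝕜 fun y => ?_
    rw [ContinuousLinearMap.adjoint_inner_right, inner_E_upperBlock_E, S.inner_G_eq, h]

theorem isRiccatiSolution_of_blocks (hP : S.regulator.IsFlow P) {Z₂ : ℝ → S.Z₀ →L[𝕜] S.Z₁}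
    {Z₄ : ℝ → S.Z₀ →L[𝕜] S.Z₀} (h₂ : S.StronglyContinuous Z₂) (h₄ : S.StronglyContinuous Z₄)
    (halg : S.SolvesAlgebraic Z₂)
    (hW : ∀ t ∈ Icc 0 S.tf, W t = S.upperBlock (S.block₁ t) (Z₂ t) (Z₄ t)) :
    S.IsRiccatiSolution W := by
  have hd := fun (y x : S.A.domain) (t : ℝ) (ht : t ∈ Ioo 0 S.tf) =>
    hasDerivAt_of_coefficient hP y x ht fun t ht => ⟨_, _, hW t ht⟩
  refine ⟨fun z => ?_, fun y x t ht => (hd y x t ht).differentiableAt, fun y x t ht => ?_,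
    ?_⟩
  · have h1 := ((S.projZ₁)†).continuous.comp_continuousOn
      (stronglyContinuous_block₁ hP (S.projZ₁ z))
    have h2 := ((S.projZ₁)†).continuous.comp_continuousOn (h₂ (S.projZ₀ z))
    have h3 := ((S.projZ₀)†).continuous.comp_continuousOn (h₄ (S.projZ₀ z))
    refine ((h1.add h2).add h3).congr fun t ht => ?_
    rw [hW t ht]; rfl
  · have ht' : t ∈ Icc 0 S.tf := ⟨ht.1.le, ht.2.le⟩
    have := riccati_terms_of_algebraic (d := Z₄ t) (halg t ht') y x
      (coefficient_block₁ hP ht').symm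
    rw [(hd y x t ht).deriv, hW t ht']
    linear_combination this
  · have htf : S.tf ∈ Icc 0 S.tf := ⟨S.tf_pos.le, le_rfl⟩
    rw [hW _ htf, final_iff, coefficient_block₁ hP htf]
    exact hP.final

/-- A continuous solution of the algebraic equation. -/
theorem exists_solvesAlgebraic (hP : S.regulator.IsFlow P) :
    ∃ Z₂ : ℝ → S.Z₀ →L[𝕜] S.Z₁, S.StronglyContinuous Z₂ ∧ S.SolvesAlgebraic Z₂ := by
  -- With `q = B̃₀* Q₀ x`, applying `B̃₀* Q₀ A₀⁻¹` to `A₀ x - B₀ R⁻¹ B₀* Π₀ x` gives `q + (Rt - R)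
  -- R⁻¹ q = Rt R⁻¹ q`, so a factor `Rt⁻¹` leaves exactly `R⁻¹ q = -R⁻¹ B₀* Π₀ x`.
  refine ⟨fun t => -(S.block₁ t ∘L S.B₁ ∘L S.Rtinv ∘L (S.Bt₀)† ∘L S.Q₀ ∘L S.A₀inv),
    fun z => (stronglyContinuous_block₁ hP _).neg, fun t _ x => ?_⟩
  have h1 : ∀ v, S.A₀inv (S.B₀ v) = S.Bt₀ v := fun _ => rfl
  simp only [_root_.neg_apply, ContinuousLinearMap.comp_apply, map_sub, S.A₀inv_A₀, h1,
    adjoint_Bt₀_Q₀_Bt₀, Rtinv_Rt, R_Rinv]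
  rw [adjoint_B₀_Pi₀]
  simp only [map_neg]
  abel

/-- The differential equation speaks only about interior times; strong continuity carries its
consequences to the endpoints. -/
theorem eqOn_Icc_of_Ioo {E : Type*} [TopologicalSpace E] [T2Space E] {f g : ℝ → E}
    (hf : ContinuousOn f (Icc 0 S.tf)) (hg : ContinuousOn g (Icc 0 S.tf))
    (h : EqOn f g (Ioo 0 S.tf)) : EqOn f g (Icc 0 S.tf) :=
  h.of_subset_closure hf hg Ioo_subset_Icc_self (closure_Ioo S.tf_pos.ne).ge

/-- Testing with `y = A₀⁻¹ w` gives `E y = 0` and `A y = w`. For `x ∈ X₁` the weight `Q` has no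
cross term, so the equation reduces to `⟨w, W E x⟩ = 0`; density of the domain of `A₁` and
surjectivity of `E₁` finish. -/
theorem IsRiccatiSolution.inner_Z₀_Z₁ (hW : S.IsRiccatiSolution W) (w : S.Z₀) (z : S.Z₁) :
    ∀ t ∈ Icc 0 S.tf, inner 𝕜 (w : Z) (W t z) = 0 := by
  refine eqOn_Icc_of_Ioo (continuousOn_const.inner (hW.continuous z)) continuousOn_const
    fun t ht => ?_
  let y : S.A.domain := ⟨S.A₀inv w, S.A₀inv_mem w⟩
  have hyE : S.E y = 0 := S.E_X₀ _ (S.A₀inv w).2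
  have hyA : S.A y = w := congrArg Subtype.val (S.A₀_A₀inv w)
  have key : ∀ x ∈ S.A₁.domain, inner 𝕜 x (((S.E₁)† ∘L (S.Z₁.subtypeL)† ∘L ((W t)†)) w) = 0 := by
    intro x hx
    have := hW.equation y ⟨x, hx⟩ t ht
    simp only [hyE, hyA, inner_zero_left, deriv_const] at this
    rw [show S.PX x = x from S.mem_X₁.1 x.2, S.inner_Q_X₀_X₁] at this
    simp only [zero_add, sub_zero, add_zero] at this
    rw [← inner_conj_symm] at this
    simp only [ContinuousLinearMap.comp_apply, ContinuousLinearMap.adjoint_inner_right]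
    exact (map_eq_zero _).1 this
  have h0 : ((S.E₁)† ∘L (S.Z₁.subtypeL)† ∘L ((W t)†)) w = 0 :=
    S.A₁_dense.eq_zero_of_inner_right (𝕜 := 𝕜) fun x hx => key x hx
  have h1 := S.eq_zero_of_adjoint_E₁ h0
  have h2 : inner 𝕜 z (((S.Z₁.subtypeL)†) (((W t)†) w)) = 0 :=
    (congrArg (inner 𝕜 z) h1).trans (inner_zero_right _)
  rw [ContinuousLinearMap.adjoint_inner_right, ContinuousLinearMap.adjoint_inner_right,
    ← inner_conj_symm] at h2
  exact (map_eq_zero _).1 h2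

theorem stronglyContinuous_compress (hW : S.StronglyContinuous W) (V V' : Submodule 𝕜 Z)
    [CompleteSpace V] [CompleteSpace V'] :
    S.StronglyContinuous fun t => (V.subtypeL)† ∘L W t ∘L V'.subtypeL := fun z =>
  ((V.subtypeL)†).continuous.comp_continuousOn (hW (z : Z))

theorem IsRiccatiSolution.exists_blocks (hP : S.regulator.IsFlow P)
    (hW : S.IsRiccatiSolution W) :
    ∃ (Z₂ : ℝ → S.Z₀ →L[𝕜] S.Z₁) (Z₄ : ℝ → S.Z₀ →L[𝕜] S.Z₀), S.StronglyContinuous Z₂ ∧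
      S.StronglyContinuous Z₄ ∧ S.SolvesAlgebraic Z₂ ∧
      ∀ t ∈ Icc 0 S.tf, W t = S.upperBlock (S.block₁ t) (Z₂ t) (Z₄ t) := by
  have hac := stronglyContinuous_compress hW.continuous S.Z₁ S.Z₁
  have hbc := stronglyContinuous_compress hW.continuous S.Z₁ S.Z₀
  have hdc := stronglyContinuous_compress hW.continuous S.Z₀ S.Z₀
  have hWt : ∀ t ∈ Icc 0 S.tf, W t = S.upperBlock _ _ _ := fun t ht =>
    eq_upperBlock fun w z => hW.inner_Z₀_Z₁ w z t ht
  set a : ℝ → S.Z₁ →L[𝕜] S.Z₁ := fun t => (S.Z₁.subtypeL)† ∘L W t ∘L S.Z₁.subtypeL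
  set b : ℝ → S.Z₀ →L[𝕜] S.Z₁ := fun t => (S.Z₁.subtypeL)† ∘L W t ∘L S.Z₀.subtypeL
  set d : ℝ → S.Z₀ →L[𝕜] S.Z₀ := fun t => (S.Z₀.subtypeL)† ∘L W t ∘L S.Z₀.subtypeL
  replace hWt : ∀ t ∈ Icc 0 S.tf, W t = S.upperBlock (a t) (b t) (d t) := hWt
  -- For `x ∈ X₀` all terms with `E x` or `P^{X₁} x` vanish, including the derivative and the
  -- quadratic term. What remains is the algebraic equation, tested with `E₁ y`.
  have halg : ∀ x : S.A₀.domain, ∀ t ∈ Icc 0 S.tf,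
      b t (S.A₀ x - S.B₀ (S.Rinv (((S.B₀)†) (S.Pi₀ x)))) =
        a t (S.B₁ (S.Rinv (((S.B₀)†) (S.Pi₀ x)))) := by
    intro x
    refine eqOn_Icc_of_Ioo (hbc _) (hac _) fun t ht => ?_
    let x' : S.A.domain := ⟨x.1, x.2⟩
    have hx'E : S.E x' = 0 := S.E_X₀ _ x.1.2
    rw [← sub_eq_zero]
    refine S.eq_zero_of_adjoint_E₁ (S.A₁_dense.eq_zero_of_inner_right (𝕜 := 𝕜) fun y hy => ?_)
    have h1 := hW.equation ⟨y, hy⟩ x' t ht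
    have h2 := riccati_terms (a := a t) (b := b t) (d := d t) ⟨y, hy⟩ x'
    rw [← hWt t ⟨ht.1.le, ht.2.le⟩] at h2
    have hp1 : (⟨S.projX₁ x', S.projX₁_mem x'⟩ : S.A₁.domain) = 0 :=
      Subtype.ext (S.projX₁_coe_X₀ x.1)
    have hp0 : (⟨S.projX₀ x', S.projX₀_mem x'⟩ : S.A₀.domain) = x :=
      Subtype.ext (S.projX₀_coe x.1)
    have hp1' : S.projX₁ (x' : X) = 0 := S.projX₁_coe_X₀ x.1
    have hp0' : S.projX₀ (x' : X) = x := S.projX₀_coe x.1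
    simp only [hx'E, map_zero, inner_zero_right, deriv_const] at h1
    rw [hp1, hp0, hp1', hp0'] at h2
    simp only [hx'E, LinearPMap.map_zero, map_zero, inner_zero_right, add_zero, sub_zero,
      zero_add] at h1 h2
    rw [S.projX₁_coe] at h2
    rw [ContinuousLinearMap.adjoint_inner_right]
    exact h2.symm.trans h1
  have hcl : ∀ s, max 0 (min s S.tf) ∈ Icc 0 S.tf := fun s =>
    ⟨le_max_left _ _, max_le S.tf_pos.le (min_le_right _ _)⟩
  have hcl' : ∀ s ∈ Icc 0 S.tf, max 0 (min s S.tf) = s := fun s hs => by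
    rw [min_eq_left hs.2, max_eq_right hs.1]
  set P' : ℝ → S.X₁ →L[𝕜] S.X₁ := fun s => (S.E₁)† ∘L a (max 0 (min s S.tf)) ∘L S.E₁ with hP'
  have hP't : ∀ t ∈ Icc 0 S.tf, P' t = (S.E₁)† ∘L a t ∘L S.E₁ := fun t ht => by
    rw [hP']; simp only [hcl' t ht]
  have hP'c : StrongCont P' := fun z => ((S.E₁)†).continuous.comp
    ((hac (S.E₁ z)).comp_continuous (by fun_prop) hcl)
  -- On `X₁` the equation is now the weak Riccati equation of the regulator. Self-adjointness of the
  -- block `a` is not known beforehand, and the uniqueness theorem does not ask for it.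
  have hPP' : ∀ t ∈ Icc 0 S.tf, P' t = P t := by
    refine hP.eq_of_weak S.isGenerator_extension S.A₁_dense hP'c (fun y x t ht => ?_) ?_
    · have ht' : t ∈ Icc 0 S.tf := ⟨ht.1.le, ht.2.le⟩
      let y' : S.A.domain := ⟨y.1, y.2⟩
      let x' : S.A.domain := ⟨x.1, x.2⟩
      have hy : (⟨S.projX₁ y', S.projX₁_mem_generator y'⟩ : S.generator.domain) = y :=
        Subtype.ext (S.projX₁_coe y.1)
      have hx : (⟨S.projX₁ x', S.projX₁_mem_generator x'⟩ : S.generator.domain) = x :=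
        Subtype.ext (S.projX₁_coe x.1)
      have hy' : S.projX₁ (y' : X) = y := S.projX₁_coe y.1
      have hx' : S.projX₁ (x' : X) = x := S.projX₁_coe x.1
      have h1 := hW.equation y' x' t ht
      have h2 := riccati_terms_of_algebraic (d := d t) (fun x => halg x t ht') y' x' (hP't t ht')
      rw [← hWt t ht', hy, hx, hy', hx'] at h2
      have h3 := (hW.differentiable y' x' t ht).hasDerivAt
      refine (h3.congr_of_eventuallyEq ?_).congr_deriv ?_
      · filter_upwards [Ioo_mem_nhds ht.1 ht.2] with s hs
        have hs' : s ∈ Icc 0 S.tf := ⟨hs.1.le, hs.2.le⟩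
        rw [hWt s hs', inner_E_upperBlock_E, hP't s hs', hy', hx']
      · linear_combination h1 - h2
    · have htf : S.tf ∈ Icc 0 S.tf := ⟨S.tf_pos.le, le_rfl⟩
      have := hW.final
      rw [hWt _ htf, final_iff] at this
      exact (hP't S.tf htf).trans this
  have hblock : ∀ t ∈ Icc 0 S.tf, a t = S.block₁ t := fun t ht => by
    rw [block₁_eq hP ht, ← hPP' t ht, hP't t ht, coefficient_block]
  refine ⟨b, d, hbc, hdc, fun t ht x => ?_, fun t ht => ?_⟩
  · rw [← hblock t ht]
    exact halg x t ht
  · rw [← hblock t ht]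
    exact hWt t ht

theorem IsRiccatiSolution.apply_E (hP : S.regulator.IsFlow P) (hW : S.IsRiccatiSolution W)
    {t : ℝ} (ht : t ∈ Icc 0 S.tf) : W t ∘L S.E = S.PiTilde₁ t ∘L S.E := by
  obtain ⟨Z₂, Z₄, -, -, -, h⟩ := hW.exists_blocks hP
  ext x
  rw [ContinuousLinearMap.comp_apply, ContinuousLinearMap.comp_apply, h t ht,
    PiTilde₁_eq_upperBlock, upperBlock_E, upperBlock_E]

theorem IsRiccatiSolution.inner_E (hP : S.regulator.IsFlow P) (hW : S.IsRiccatiSolution W)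
    {t : ℝ} (ht : t ∈ Icc 0 S.tf) (x : X) :
    inner 𝕜 (S.E x) (W t (S.E x)) = inner 𝕜 (S.projX₁ x) (P t (S.projX₁ x)) := by
  obtain ⟨Z₂, Z₄, -, -, -, h⟩ := hW.exists_blocks hP
  rw [h t ht, inner_E_upperBlock_E, coefficient_block₁ hP ht]

/-- The feedback law in terms of a solution of the Riccati equation. -/
theorem IsRiccatiSolution.feedback_iff (hP : S.regulator.IsFlow P) (hW : S.IsRiccatiSolution W)
    {t₀ t : ℝ} (ht₀ : t₀ ≤ t) (ht : t ∈ Icc 0 S.tf) (x : X) (u : ℝ → U) :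
    u t = -S.Rinv ((S.B†) (S.PiTilde₀ (S.state t₀ x u t) + W t (S.E (S.state t₀ x u t)))) ↔
      S.regulator.defect P t₀ (S.projX₁ x) u t = 0 := by
  obtain ⟨Z₂, Z₄, -, -, -, h⟩ := hW.exists_blocks hP
  rw [map_add, adjoint_B_PiTilde₀, h t ht, adjoint_B_upperBlock_E, coefficient_block₁ hP ht,
    projX₁_state, projX₀_state, adjoint_B₀_Pi₀, map_neg, map_neg, neg_neg, adjoint_Bt₀_Q₀_Bt₀,
    state₁_eq ht₀]
  change _ ↔ u t + S.Rtinv (((S.Bt₁)†) (P t (S.regulator.state t₀ (S.projX₁ x) u t))) = 0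
  set q := ((S.Bt₁)†) (P t (S.regulator.state t₀ (S.projX₁ x) u t))
  -- The feedback law reads `u = -R⁻¹ (Rt u - R u + q)`, that is, `R⁻¹ (Rt u + q) = 0`, which is
  -- equivalent to `u + Rt⁻¹ q = 0`.
  rw [map_add, map_sub, Rinv_R]
  constructor
  · intro hu
    have h1 : S.Rinv (S.Rt (u t)) + S.Rinv q = 0 := by
      rw [← sub_eq_zero] at hu
      rw [← hu]
      abel
    have h2 := congrArg S.R h1
    rw [map_add, R_Rinv, R_Rinv, map_zero] at h2
    have h3 := congrArg S.Rtinv h2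
    rwa [map_add, Rtinv_Rt, map_zero] at h3
  · intro hu
    have h2 := congrArg S.Rt hu
    rw [map_add, Rt_Rtinv, map_zero] at h2
    have h3 := congrArg S.Rinv h2
    rw [map_add, map_zero] at h3
    rw [eq_neg_of_add_eq_zero_left h3]
    abel

end LQProblem

theorem theorem3 {𝕜 X Z U : Type*} [RCLike 𝕜]
    [NormedAddCommGroup X] [InnerProductSpace 𝕜 X] [CompleteSpace X]
    [NormedAddCommGroup Z] [InnerProductSpace 𝕜 Z] [CompleteSpace Z]
    [NormedAddCommGroup U] [InnerProductSpace 𝕜 U] [CompleteSpace U]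
    (S : LQProblem 𝕜 X Z U) :
    -- `Π₁(t)` is well defined, `Π̃₁` is strongly continuous, with the stated differentiability
    (∀ t ∈ Icc 0 S.tf, ∀ a : S.X₁, ∀ b : S.X₁, S.IsPi₁Value t a b ↔ b = S.Pi₁ t a) ∧
    S.StronglyContinuous S.PiTilde₁ ∧
    (∀ y x : S.A.domain, ∀ t ∈ Ioo 0 S.tf,
      DifferentiableAt ℝ (fun t => inner 𝕜 (S.E y) (S.PiTilde₁ t (S.E x))) t) ∧
    -- solutions exist, and the general solution
    (∃ W : ℝ → Z →L[𝕜] Z, S.IsRiccatiSolution W) ∧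
    (∀ W : ℝ → Z →L[𝕜] Z, S.IsRiccatiSolution W ↔
      ∃ (Z₂ : ℝ → S.Z₀ →L[𝕜] S.Z₁) (Z₄ : ℝ → S.Z₀ →L[𝕜] S.Z₀),
        S.StronglyContinuous Z₂ ∧ S.StronglyContinuous Z₄ ∧ S.SolvesAlgebraic Z₂ ∧
        ∀ t ∈ Icc 0 S.tf, W t = S.PiTilde₁ t + (S.projZ₁)† ∘L Z₂ t ∘L S.projZ₀
          + (S.projZ₀)† ∘L Z₄ t ∘L S.projZ₀) ∧
    -- uniqueness of `W(t) E`
    (∀ W W' : ℝ → Z →L[𝕜] Z, S.IsRiccatiSolution W → S.IsRiccatiSolution W' →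
      ∀ t ∈ Icc 0 S.tf, W t ∘L S.E = W' t ∘L S.E) ∧
    -- optimal feedback and minimum cost
    (∀ xi : X, ∃ (x : X) (u : ℝ → U), S.E x = S.E xi ∧ S.IsOptimal 0 x u) ∧
    (∀ W : ℝ → Z →L[𝕜] Z, S.IsRiccatiSolution W → ∀ xi : X,
      (∀ u ∈ S.admissible 0 xi, S.IsOptimal 0 xi u ↔ ∀ t ∈ Icc 0 S.tf,
        u t = - S.Rinv ((S.B†) (S.PiTilde₀ (S.state 0 xi u t) +
          W t (S.E (S.state 0 xi u t))))) ∧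
      (∀ u v : ℝ → U, S.IsOptimal 0 xi u → S.IsOptimal 0 xi v → EqOn u v (Icc 0 S.tf)) ∧
      (∀ u : ℝ → U, S.IsOptimal 0 xi u →
        (S.cost 0 xi u : 𝕜) = inner 𝕜 (S.E xi) (W 0 (S.E xi))) ∧
      ((S.admissible 0 xi).Nonempty →
        IsGLB (S.cost 0 xi '' S.admissible 0 xi)
          (RCLike.re (inner 𝕜 (S.E xi) (W 0 (S.E xi)))))) := by
  obtain ⟨P, hP⟩ := S.regulator.exists_isFlow
  have h0 : (0:ℝ) ∈ Icc 0 S.tf := ⟨le_rfl, S.tf_pos.le⟩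
  have h0' : (0:ℝ) ∈ Ico 0 S.tf := ⟨le_rfl, S.tf_pos⟩
  refine ⟨fun t ht a b => ?_, LQProblem.stronglyContinuous_PiTilde₁ hP, fun y x t ht => ?_, ?_,
    fun W => ?_, fun W W' hW hW' t ht => ?_, fun xi => ?_, fun W hW xi => ⟨fun u hu => ?_,
      fun u v hu hv => ?_, fun u hu => ?_, ?_⟩⟩
  · rw [LQProblem.isPi₁Value_iff hP ht, LQProblem.Pi₁_eq hP ht]
  · exact (LQProblem.hasDerivAt_of_coefficient hP y x ht fun t _ =>
      ⟨0, 0, LQProblem.PiTilde₁_eq_upperBlock t⟩).differentiableAt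
  · obtain ⟨Z₂, h₂, halg⟩ := LQProblem.exists_solvesAlgebraic hP
    exact ⟨_, LQProblem.isRiccatiSolution_of_blocks hP h₂ (Z₄ := fun _ => 0)
      (fun _ => continuousOn_const) halg fun _ _ => rfl⟩
  · constructor
    · exact fun hW => hW.exists_blocks hP
    · rintro ⟨Z₂, Z₄, h₂, h₄, halg, hW⟩
      exact LQProblem.isRiccatiSolution_of_blocks hP h₂ h₄ halg hW
  · rw [hW.apply_E hP ht, hW'.apply_E hP ht]
  -- Only the `X₀`-component of the initial state is changed, and `E` does not see it.
  · obtain ⟨x, u, hx, hu⟩ := LQProblem.exists_isOptimal hP h0 (S.projX₁ xi)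
    exact ⟨x, u, by rw [S.E_eq, S.E_eq, hx], hu⟩
  · constructor
    · intro h t ht
      rw [hW.feedback_iff hP ht.1 ht]
      exact h.defect_eq_zero hP h0' t ht
    · intro h
      refine LQProblem.isOptimal_of_defect hP h0 hu fun t ht => ?_
      rw [← hW.feedback_iff hP ht.1 ht]
      exact h t ht
  · have key := hP.control_unique h0' (S.projX₁ xi)
      (LQProblem.continuous_extendControl h0.2 hu.1.1)
      (LQProblem.continuous_extendControl h0.2 hv.1.1)
      (fun s hs => (LQProblem.defect_extendControl _ hs).trans (hu.defect_eq_zero hP h0' s hs))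
      (fun s hs => (LQProblem.defect_extendControl _ hs).trans (hv.defect_eq_zero hP h0' s hs))
    intro s hs
    have hu' := LQProblem.eqOn_extendControl (S := S) (t₀ := 0) (u := u) hs
    have hv' := LQProblem.eqOn_extendControl (S := S) (t₀ := 0) (u := v) hs
    exact hu'.symm.trans ((key hs).trans hv')
  · have hc : S.cost 0 xi u = RCLike.re (inner 𝕜 (S.projX₁ xi) (P 0 (S.projX₁ xi))) :=
      le_antisymm ((LQProblem.isOptimal_iff_cost_le hP h0 hu.1).1 hu)
        (LQProblem.le_cost hP h0 hu.1)
    rw [hc, hW.inner_E hP h0]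
    -- The equality of scalars also asserts that the form is real, which follows from the
    -- self-adjointness of `P 0`.
    refine RCLike.conj_eq_iff_re.1 ?_
    rw [inner_conj_symm]
    exact (hP.selfAdjoint 0).inner_left _ _
  · rintro ⟨u, hu⟩
    rw [hW.inner_E hP h0]
    refine ⟨?_, fun c hc => le_of_forall_pos_le_add fun ε hε => ?_⟩
    · rintro _ ⟨v, hv, rfl⟩
      exact LQProblem.le_cost hP h0 hv
    · obtain ⟨v, hv, hvc⟩ := LQProblem.exists_cost_le hP h0 hu hε
      exact (hc ⟨v, hv, rfl⟩).trans hvc
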